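/- All algorithms and adversaries below are (uniform) quantum polynomial-time (QPT), all of them also receive the security parameter $1^\lambda$, and $\mathsf{negl}$ denotes a negligible function. A *two-tier one-shot signature scheme* (2-OSS) $\mathsf{OS}$ consists of QPT algorithms $\mathsf{Setup}(1^\lambda)\to(\mathsf{pp},\mathsf{sk})$, $\mathsf{KeyGen}(\mathsf{pp})\to(\mathsf{sigk},\mathsf{vk})$, $\mathsf{Sign}(\mathsf{sigk},m)\to\sigma$ for $m\in\{0,1\}$, $\mathsf{Ver}_0(\mathsf{pp},\mathsf{vk},\sigma)\to\top/\bot$ and $\mathsf{Ver}_1(\mathsf{pp},\mathsf{sk},\mathsf{vk},\sigma)\to\top/\bot$, where $\mathsf{sigk}$ is a quantum state and everything else is classical, such that: (correctness) for $m\in\{0,1\}$, an honestly generated signature of $m$ is accepted by $\mathsf{Ver}_m$ with probability at least $1-\mathsf{negl}(\lambda)$; (security) for every QPT adversary $\mathcal A$, if $(\mathsf{pp},\mathsf{sk})\gets\mathsf{Setup}(1^\lambda)$ and $(\mathsf{vk},\sigma_0,\sigma_1)\gets\mathcal A(\mathsf{pp})$, then $\mathsf{Ver}_0(\mathsf{pp},\mathsf{vk},\sigma_0)$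 and $\mathsf{Ver}_1(\mathsf{pp},\mathsf{sk},\mathsf{vk},\sigma_1)$ both accept with probability at most $\mathsf{negl}(\lambda)$. A (stateful) *digital signature scheme with revocable signing keys* with message space $\{0,1\}$ consists of QPT algorithms $\mathsf{Setup}(1^\lambda)\to(\mathsf{ck},\mathsf{pp})$, $\mathsf{KeyGen}(\mathsf{pp})\to(\mathsf{sigk},\mathsf{vk})$, $\mathsf{Sign}(\mathsf{pp},\mathsf{sigk},m)\to(\mathsf{sigk}',\sigma)$, $\mathsf{Ver}(\mathsf{pp},\mathsf{vk},m,\sigma)\to\top/\bot$, $\mathsf{Del}(\mathsf{sigk})\to\mathsf{cert}$ and $\mathsf{Cert}(\mathsf{pp},\mathsf{vk},\mathsf{ck},\mathsf{cert},S)\to\top/\bot$, where $S$ is a set of messages, the signing keys are quantum states and everything else is classical. Its one-time properties are: * *One-time correctness:* for every message $m$ (which may depend on $\lambda$), an honest signature of $m$ under a fresh key is accepted by $\mathsf{Ver}$ with probability at least $1-\mathsf{negl}(\lambda)$. * *One-time EUF-CMA security:* every QPT adversary that is given $\mathsf{vk}$ and makes at most one query to the signing oracle (which holds $(\mathsf{pp},\mathsf{sigk})$)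 outputs, with probability at most $\mathsf{negl}(\lambda)$, a pair $(m^*,\sigma^*)$ such that $m^*$ was not queried and $\mathsf{Ver}(\mathsf{pp},\mathsf{vk},m^*,\sigma^*)=\top$. * *One-time deletion correctness:* the certificate output by $\mathsf{Del}$ on a fresh key is accepted by $\mathsf{Cert}$ with $S=\emptyset$, and the certificate output by $\mathsf{Del}$ after one message $m$ (which may depend on $\lambda$) has been signed is accepted with $S=\{m\}$, each with probability at least $1-\mathsf{negl}(\lambda)$. * *One-time deletion security:* for every QPT adversary $\mathcal A$, if $(\mathsf{ck},\mathsf{pp})\gets\mathsf{Setup}(1^\lambda)$ and $(\mathsf{vk},\mathsf{cert},S,m^*,\sigma^*)\gets\mathcal A(\mathsf{pp})$, the probability that $|S|\le 1$, $m^*\notin S$, $\mathsf{Cert}(\mathsf{pp},\mathsf{vk},\mathsf{ck},\mathsf{cert},S)=\top$ and $\mathsf{Ver}(\mathsf{pp},\mathsf{vk},m^*,\sigma^*)=\top$ is at most $\mathsf{negl}(\lambda)$. **Theorem.** Let $\mathsf{OS}$ be a two-tier one-shot signature scheme. Then there is a digital signature scheme with revocable signing keys with message space $\{0,1\}$ that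 satisfies one-time correctness, one-time EUF-CMA security, one-time deletion correctness and one-time deletion security, and whose algorithms run those of $\mathsf{OS}$ as follows: * $\mathsf{Setup}(1^\lambda)$ runs $(\mathsf{pp},\mathsf{sk})\gets\mathsf{OS.Setup}(1^\lambda)$ and outputs $\mathsf{ck}=\mathsf{sk}$ and $\mathsf{pp}$. * $\mathsf{KeyGen}(\mathsf{pp})$ runs $(\mathsf{sigk}_b,\mathsf{vk}_b)\gets\mathsf{OS.KeyGen}(\mathsf{pp})$ independently for $b=0,1$ and outputs $\mathsf{sigk}=(\mathsf{sigk}_0,\mathsf{sigk}_1)$, $\mathsf{vk}=(\mathsf{vk}_0,\mathsf{vk}_1)$. * $\mathsf{Sign}(\mathsf{pp},(\mathsf{sigk}_0,\mathsf{sigk}_1),m)$ outputs $\sigma\gets\mathsf{OS.Sign}(\mathsf{sigk}_m,0)$ and the new key $(1-m,\mathsf{sigk}_{1-m})$. * $\mathsf{Ver}(\mathsf{pp},(\mathsf{vk}_0,\mathsf{vk}_1),m,\sigma)$ runs $\mathsf{OS.Ver}_0(\mathsf{pp},\mathsf{vk}_m,\sigma)$. * $\mathsf{Del}$ maps $(\mathsf{sigk}_0,\mathsf{sigk}_1)$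 to $(0,1,\sigma_0',\sigma_1')$ with $\sigma_b'\gets\mathsf{OS.Sign}(\mathsf{sigk}_b,1)$, and maps $(1-m,\mathsf{sigk}_{1-m})$ to $(1-m,\sigma')$ with $\sigma'\gets\mathsf{OS.Sign}(\mathsf{sigk}_{1-m},1)$. * $\mathsf{Cert}(\mathsf{pp},(\mathsf{vk}_0,\mathsf{vk}_1),\mathsf{sk},\mathsf{cert},S)$ accepts if $S=\emptyset$, $\mathsf{cert}=(0,1,\sigma_0',\sigma_1')$ and $\mathsf{OS.Ver}_1(\mathsf{pp},\mathsf{sk},\mathsf{vk}_b,\sigma_b')=\top$ for both $b$; or if $S=\{m\}$, $\mathsf{cert}=(1-m,\sigma')$ and $\mathsf{OS.Ver}_1(\mathsf{pp},\mathsf{sk},\mathsf{vk}_{1-m},\sigma')=\top$; it rejects otherwise. -/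

import Mathlib

open Filter Asymptotics

noncomputable section

namespace RevSig

/-! ## Hybrid classical-quantum data

Data are binary trees whose leaves are empty, classical bits, or qubits.  The shape of a tree and its
classical bits are always classical. -/

/-- A basis element of the space of density operators on tree-shaped memory.  The leaf `qubit i j` is
the matrix unit `|i⟩⟨j|` of one qubit, and `pair` is the tensor product.  A tree without qubit leaves
is an ordinary classical datum. -/
inductive Data : Type
  | nil : Data
  | bit (b : Bool) : Data
  | qubit (i j : Bool) : Data
  | pair (a b : Data) : Data

infixr:67 " ⋆ " => Data.pair

/-- A finitely supported complex combination of elements of `α`.  `Mix Data` is the space of (not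
necessarily positive or normalised) density operators; a function `Data → Mix Data` is the linear map
(superoperator) given by its values on matrix units. -/
def Mix (α : Type) : Type := α →₀ ℂ

instance (α : Type) : AddCommGroup (Mix α) := inferInstanceAs (AddCommGroup (α →₀ ℂ))

instance (α : Type) : Module ℂ (Mix α) := inferInstanceAs (Module ℂ (α →₀ ℂ))

/-- The coefficient of `a`. -/
def Mix.coeff {α : Type} (μ : Mix α) (a : α) : ℂ := (show α →₀ ℂ from μ) a

/-- `pure a` is the basis vector `a`, and `bind` is linear extension. -/
instance : Monad Mix where
  pure a := Finsupp.single a (1 : ℂ)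
  bind μ f := Finsupp.linearCombination ℂ f μ

/-- The probability of the outcome `true` of an experiment. -/
def Mix.prob (μ : Mix Bool) : ℝ := (μ.coeff true).re

namespace Data

/-- The number of nodes. -/
def size : Data → ℕ
  | nil => 1
  | bit _ => 1
  | qubit _ _ => 1
  | pair a b => 1 + a.size + b.size

/-- No qubit leaf. -/
def IsClassical : Data → Prop
  | nil => True
  | bit _ => True
  | qubit _ _ => False
  | pair a b => a.IsClassical ∧ b.IsClassical

/-- The matrix units `|x⟩⟨y|` with `x = y`, that is, those of trace `1` (all others have trace `0`). -/
def IsDiag : Data → Prop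
  | nil => True
  | bit _ => True
  | qubit i j => i = j
  | pair a b => a.IsDiag ∧ b.IsDiag

open Classical in
/-- The trace (applied to one part of a tree: the partial trace), which discards a datum. -/
def drop (d : Data) : Mix Unit := if d.IsDiag then pure () else 0

/-- Measurement of all qubits of a datum in the computational basis. -/
def measure : Data → Mix Data
  | nil => pure nil
  | bit b => pure (bit b)
  | qubit i j => if i = j then pure (bit i) else 0
  | pair a b => do
      let a' ← a.measure
      let b' ← b.measure
      pure (a' ⋆ b')

/-- The one-qubit gate `U`, `|i⟩⟨j| ↦ U |i⟩⟨j| U†`; other data are left unchanged. -/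
def gate (U : Matrix Bool Bool ℂ) : Data → Mix Data
  | qubit i j => ∑ k : Bool, ∑ l : Bool, (U k i * star (U l j)) • (pure (qubit k l) : Mix Data)
  | d => pure d

/-- The unary representation `1ⁿ`. -/
def unary : ℕ → Data
  | 0 => nil
  | n + 1 => nil ⋆ unary n

/-- The representation of a set of one-bit messages by its two membership bits. -/
def ofSet (S : Finset Bool) : Data := bit (decide (false ∈ S)) ⋆ bit (decide (true ∈ S))

/-- The bit represented by a datum, if there is one. -/
def toBit? : Data → Option Bool
  | bit b => some b
  | _ => none

/-- The set of one-bit messages represented by a datum, if there is one. -/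
def toSet? : Data → Option (Finset Bool)
  | bit s ⋆ bit t => some ((if s then {false} else ∅) ∪ (if t then {true} else ∅))
  | _ => none

/-- The two components of a pair; the weight of a datum that is not a pair is lost. -/
def unpair : Data → Mix (Data × Data)
  | a ⋆ b => pure (a, b)
  | _ => 0

/-- A verification algorithm accepts if its output is the bit `true`. -/
def accepts : Data → Bool
  | bit b => b
  | _ => false

end Data

open Data

/-! ## Quantum programs with classical control, and their running time -/

/-- The Hadamard gate. -/
def hadamardGate : Matrix Bool Bool ℂ :=
  fun i j => (if i && j then -1 else 1) / (Real.sqrt 2 : ℂ)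

/-- The gate `T = diag(1, exp(iπ/4))`. -/
def tGate : Matrix Bool Bool ℂ :=
  Matrix.diagonal fun i => if i then Complex.exp (Real.pi / 4 * Complex.I) else 1

/-- Programs over hybrid data.  An instruction applied to a datum that does not have the form shown
leaves it unchanged. -/
inductive Prog : Type
  /-- `v ↦ v` -/
  | skip : Prog
  /-- first `p`, then `q` -/
  | seq (p q : Prog) : Prog
  /-- `(a, b) ↦ (p a, q b)` -/
  | par (p q : Prog) : Prog
  /-- `(a, b) ↦ (b, a)` -/
  | swap : Prog
  /-- `((a, b), c) ↦ (a, (b, c))` -/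
  | assoc : Prog
  /-- `v ↦ (nil, v)` -/
  | addNil : Prog
  /-- `(nil, v) ↦ v` -/
  | remNil : Prog
  /-- `nil ↦ bit b` -/
  | const (b : Bool) : Prog
  /-- `v ↦ (v, v)` for classical `v` -/
  | dup : Prog
  /-- `v ↦ nil` -/
  | discard : Prog
  /-- measure all qubits of the datum in the computational basis -/
  | measure : Prog
  /-- `bit b ↦` a qubit in the state `|b⟩` -/
  | prep : Prog
  /-- Hadamard gate on a qubit -/
  | had : Prog
  /-- `T` gate on a qubit -/
  | tee : Prog
  /-- controlled-NOT gate on a pair of qubits -/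
  | cnot : Prog
  /-- `(bit b, v) ↦ p v` if `b` is true, and `q v` otherwise -/
  | cond (p q : Prog) : Prog
  /-- run `p`, `q`, `r` or `s` according to whether the datum is `nil`, a bit, a qubit or a pair -/
  | shape (p q r s : Prog) : Prog
  /-- run `p`; if the result is `(true, v)`, repeat on `v`; if it is `(false, v)`, stop with `v` -/
  | loop (p : Prog) : Prog

open Classical in
/-- The action of an elementary instruction (on compound programs this is not used). -/
def Prog.elem : Prog → Data → Mix Data
  | .swap, a ⋆ b => pure (b ⋆ a)
  | .assoc, (a ⋆ b) ⋆ c => pure (a ⋆ b ⋆ c)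
  | .addNil, v => pure (nil ⋆ v)
  | .remNil, nil ⋆ v => pure v
  | .const b, nil => pure (bit b)
  | .dup, v => if v.IsClassical then pure (v ⋆ v) else pure v
  | .discard, v => do v.drop; pure nil
  | .measure, v => v.measure
  | .prep, bit b => pure (qubit b b)
  | .had, v => v.gate hadamardGate
  | .tee, v => v.gate tGate
  | .cnot, qubit i j ⋆ qubit k l => pure (qubit i j ⋆ qubit (xor i k) (xor j l))
  | _, v => pure v

/-- The number of steps of an elementary instruction: `1`, except for those that traverse the datum. -/
def Prog.elemCost : Prog → Data → ℕ
  | .dup, v => v.size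
  | .discard, v => v.size
  | .measure, v => v.size
  | _, _ => 1

/-- Spend `c` out of a budget of `k` steps; a computation that exceeds the budget is lost. -/
def spend (c k : ℕ) : Mix ℕ := if c ≤ k then pure (k - c) else 0

/-- At most `n` rounds of a loop with the body `f`. -/
def loopRounds (f : ℕ × Data → Mix (ℕ × Data)) : ℕ → ℕ × Data → Mix (ℕ × Data)
  | 0, _ => 0
  | n + 1, s => do
      let (k, v) ← f s
      let k' ← spend 1 k
      match v with
      | bit true ⋆ w => loopRounds f n (k', w)
      | bit false ⋆ w => pure (k', w)
      | w => pure (k', w)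

/-- `p.exec (k, v)`: run `p` on `v` with a budget of `k` steps.  The result is the combination of the
pairs (remaining budget, output) of those branches of the computation that halt within the budget.
(A round of a loop costs at least one step, so that `k + 1` rounds exhaust a budget of `k`.) -/
def Prog.exec : Prog → ℕ × Data → Mix (ℕ × Data)
  | .seq p q, s => do
      let t ← p.exec s
      q.exec t
  | .par p q, (k, v) => do
      let k₀ ← spend 1 k
      match v with
      | a ⋆ b => do
          let (k₁, a') ← p.exec (k₀, a)
          let (k₂, b') ← q.exec (k₁, b)
          pure (k₂, a' ⋆ b')
      | v => pure (k₀, v)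
  | .cond p q, (k, v) => do
      let k₀ ← spend 1 k
      match v with
      | bit b ⋆ w => if b then p.exec (k₀, w) else q.exec (k₀, w)
      | v => pure (k₀, v)
  | .shape p q r s, (k, v) => do
      let k₀ ← spend 1 k
      match v with
      | nil => p.exec (k₀, v)
      | bit _ => q.exec (k₀, v)
      | qubit _ _ => r.exec (k₀, v)
      | _ ⋆ _ => s.exec (k₀, v)
  | .loop p, (k, v) => loopRounds p.exec (k + 1) (k, v)
  | p, (k, v) => do
      let k₀ ← spend (p.elemCost v) k
      let w ← p.elem v
      pure (k₀, w)

/-- The result of running `p` on `v` for at most `k` steps. -/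
def Prog.result (p : Prog) (k : ℕ) (v : Data) : Mix Data := do
  let (_, w) ← p.exec (k, v)
  pure w

/-- The probability that `p` halts within `k` steps on the basis state `v`. -/
def Prog.haltProb (p : Prog) (k : ℕ) (v : Data) : ℂ :=
  Mix.coeff (do (← p.result k v).drop) ()

/-- A quantum polynomial-time (QPT) algorithm: a program with a polynomial that bounds its running time
on every input (every basis state, and so by linearity every state) in terms of the input size. -/
structure QPT where
  prog : Prog
  time : Polynomial ℕ
  halts : ∀ v : Data, v.IsDiag → prog.haltProb (time.eval v.size) v = 1

/-- The output of a QPT algorithm, as a superoperator given on matrix units. -/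
def QPT.run (A : QPT) (v : Data) : Mix Data := A.prog.result (A.time.eval v.size) v

/-- Every output of `A` on the input `v` has the property `P`. -/
def QPT.Outputs (A : QPT) (v : Data) (P : Data → Prop) : Prop := ∀ d, (A.run v).coeff d ≠ 0 → P d

/-! ## Negligible functions -/

/-- `ε` decreases faster than the inverse of every polynomial. -/
def Negligible (ε : ℕ → ℝ) : Prop := SuperpolynomialDecay atTop (fun n : ℕ => (n : ℝ)) ε

/-- `P(λ) ≥ 1 - negl(λ)`. -/
def Overwhelming (P : ℕ → ℝ) : Prop := ∃ ε, Negligible ε ∧ ∀ n, 1 - ε n ≤ P n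

/-- `P(λ) ≤ negl(λ)`. -/
def AtMostNegligible (P : ℕ → ℝ) : Prop := ∃ ε, Negligible ε ∧ ∀ n, P n ≤ ε n

/-! ## Two-tier one-shot signatures

As usual, every algorithm (and adversary) also receives the security parameter `1ⁿ`. -/

/-- The algorithms of a two-tier one-shot signature scheme.
`setup(1ⁿ) → (pp, sk)`, `keyGen(1ⁿ, pp) → (sigk, vk)`, `sign(1ⁿ, sigk, m) → σ`,
`ver₀(1ⁿ, pp, vk, σ) → ⊤/⊥`, `ver₁(1ⁿ, pp, sk, vk, σ) → ⊤/⊥`; all but `sigk` is classical. -/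
structure TwoTierOSS where
  setup : QPT
  keyGen : QPT
  sign : QPT
  ver₀ : QPT
  ver₁ : QPT
  setup_out : ∀ n, setup.Outputs (unary n)
    fun d => ∃ pp sk : Data, pp.IsClassical ∧ sk.IsClassical ∧ d = pp ⋆ sk
  keyGen_out : ∀ (n : ℕ) (pp : Data), pp.IsClassical → keyGen.Outputs (unary n ⋆ pp)
    fun d => ∃ sigk vk : Data, vk.IsClassical ∧ d = sigk ⋆ vk
  sign_out : ∀ (n : ℕ) (sigk : Data) (m : Bool),
    sign.Outputs (unary n ⋆ sigk ⋆ bit m) Data.IsClassical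
  ver₀_out : ∀ (n : ℕ) (pp vk σ : Data), pp.IsClassical → vk.IsClassical → σ.IsClassical →
    ver₀.Outputs (unary n ⋆ pp ⋆ vk ⋆ σ) fun d => ∃ b, d = bit b
  ver₁_out : ∀ (n : ℕ) (pp sk vk σ : Data), pp.IsClassical → sk.IsClassical → vk.IsClassical →
    σ.IsClassical → ver₁.Outputs (unary n ⋆ pp ⋆ sk ⋆ vk ⋆ σ) fun d => ∃ b, d = bit b

namespace TwoTierOSS

variable (S : TwoTierOSS)

/-- Sign `0` honestly and verify with `ver₀`. -/
def correctGame₀ (n : ℕ) : Mix Bool := do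
  let (pp, _) ← (← S.setup.run (unary n)).unpair
  let (sigk, vk) ← (← S.keyGen.run (unary n ⋆ pp)).unpair
  let σ ← S.sign.run (unary n ⋆ sigk ⋆ bit false)
  let v ← S.ver₀.run (unary n ⋆ pp ⋆ vk ⋆ σ)
  pure v.accepts

/-- Sign `1` honestly and verify with `ver₁`. -/
def correctGame₁ (n : ℕ) : Mix Bool := do
  let (pp, sk) ← (← S.setup.run (unary n)).unpair
  let (sigk, vk) ← (← S.keyGen.run (unary n ⋆ pp)).unpair
  let σ ← S.sign.run (unary n ⋆ sigk ⋆ bit true)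
  let v ← S.ver₁.run (unary n ⋆ pp ⋆ sk ⋆ vk ⋆ σ)
  pure v.accepts

def Correct : Prop :=
  Overwhelming (fun n => (S.correctGame₀ n).prob) ∧ Overwhelming (fun n => (S.correctGame₁ n).prob)

/-- The adversary receives `pp` and outputs `(vk, σ₀, σ₁)`.  Its output is measured, and it loses if
the output is not of this form. -/
def securityGame (A : QPT) (n : ℕ) : Mix Bool := do
  let (pp, sk) ← (← S.setup.run (unary n)).unpair
  let (vk, σs) ← (← (← A.run (unary n ⋆ pp)).measure).unpair
  let (σ₀, σ₁) ← σs.unpair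
  let v₀ ← S.ver₀.run (unary n ⋆ pp ⋆ vk ⋆ σ₀)
  let v₁ ← S.ver₁.run (unary n ⋆ pp ⋆ sk ⋆ vk ⋆ σ₁)
  pure (v₀.accepts && v₁.accepts)

def Secure : Prop := ∀ A : QPT, AtMostNegligible fun n => (S.securityGame A n).prob

end TwoTierOSS

/-! ## Digital signatures with revocable signing keys, for one-bit messages -/

/-- The algorithms of a (stateful) digital signature scheme with revocable signing keys and message
space `{0,1}`.  `setup(1ⁿ) → (ck, pp)`, `keyGen(1ⁿ, pp) → (sigk, vk)`,
`sign(1ⁿ, pp, sigk, m) → (sigk', σ)`, `ver(1ⁿ, pp, vk, m, σ) → ⊤/⊥`, `del(1ⁿ, sigk) → cert`,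
`cert(1ⁿ, pp, vk, ck, cert, S) → ⊤/⊥`; everything but the signing keys is classical. -/
structure DSRKey where
  setup : QPT
  keyGen : QPT
  sign : QPT
  ver : QPT
  del : QPT
  cert : QPT
  setup_out : ∀ n, setup.Outputs (unary n)
    fun d => ∃ ck pp : Data, ck.IsClassical ∧ pp.IsClassical ∧ d = ck ⋆ pp
  keyGen_out : ∀ (n : ℕ) (pp : Data), pp.IsClassical → keyGen.Outputs (unary n ⋆ pp)
    fun d => ∃ sigk vk : Data, vk.IsClassical ∧ d = sigk ⋆ vk
  sign_out : ∀ (n : ℕ) (pp sigk : Data) (m : Bool), pp.IsClassical →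
    sign.Outputs (unary n ⋆ pp ⋆ sigk ⋆ bit m)
      fun d => ∃ sigk' σ : Data, σ.IsClassical ∧ d = sigk' ⋆ σ
  ver_out : ∀ (n : ℕ) (pp vk : Data) (m : Bool) (σ : Data),
    pp.IsClassical → vk.IsClassical → σ.IsClassical →
    ver.Outputs (unary n ⋆ pp ⋆ vk ⋆ bit m ⋆ σ) fun d => ∃ b, d = bit b
  del_out : ∀ (n : ℕ) (sigk : Data), del.Outputs (unary n ⋆ sigk) Data.IsClassical
  cert_out : ∀ (n : ℕ) (pp vk ck c : Data) (S : Finset Bool),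
    pp.IsClassical → vk.IsClassical → ck.IsClassical → c.IsClassical →
    cert.Outputs (unary n ⋆ pp ⋆ vk ⋆ ck ⋆ c ⋆ ofSet S) fun d => ∃ b, d = bit b

namespace DSRKey

variable (D : DSRKey)

/-- Sign one message honestly and verify the signature. -/
def correctGame (m : Bool) (n : ℕ) : Mix Bool := do
  let (_, pp) ← (← D.setup.run (unary n)).unpair
  let (sigk, vk) ← (← D.keyGen.run (unary n ⋆ pp)).unpair
  let (sigk', σ) ← (← D.sign.run (unary n ⋆ pp ⋆ sigk ⋆ bit m)).unpair
  sigk'.drop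
  let v ← D.ver.run (unary n ⋆ pp ⋆ vk ⋆ bit m ⋆ σ)
  pure v.accepts

/-- One-time correctness.  The message may depend on the security parameter. -/
def OneTimeCorrect : Prop := ∀ m : ℕ → Bool, Overwhelming fun n => (D.correctGame (m n) n).prob

/-- An adversary with at most one query to the signing oracle, given by its two phases: before the
query, `A.1(1ⁿ, vk) → (st, q)`, where `st` is its (quantum) state, and where it queries the oracle on
`m` if `q` is the bit `m` and makes no query if `q` is anything else; and after the query,
`A.2(st, reply) → (m*, σ*)`, where `reply` is the signature, or `nil` if there was no query.
The adversary wins if `σ*` is a valid signature of `m*` and `m*` has not been queried. -/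
def forgeryGame (A : QPT × QPT) (n : ℕ) : Mix Bool := do
  let (_, pp) ← (← D.setup.run (unary n)).unpair
  let (sigk, vk) ← (← D.keyGen.run (unary n ⋆ pp)).unpair
  let (st, q) ← (← A.1.run (unary n ⋆ vk)).unpair
  let query := (← q.measure).toBit?
  let reply ← match query with
    | some m => do
        let (sigk', σ) ← (← D.sign.run (unary n ⋆ pp ⋆ sigk ⋆ bit m)).unpair
        sigk'.drop
        pure σ
    | none => do
        sigk.drop
        pure nil
  let (mStar, σStar) ← (← (← A.2.run (st ⋆ reply)).measure).unpair
  match mStar.toBit? with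
  | some m => do
      let v ← D.ver.run (unary n ⋆ pp ⋆ vk ⋆ bit m ⋆ σStar)
      pure (v.accepts && decide (query ≠ some m))
  | none => pure false

/-- One-time EUF-CMA security. -/
def OneTimeUnforgeable : Prop :=
  ∀ A : QPT × QPT, AtMostNegligible fun n => (D.forgeryGame A n).prob

/-- Delete the fresh signing key and check the certificate, with no message signed. -/
def deletionGame₀ (n : ℕ) : Mix Bool := do
  let (ck, pp) ← (← D.setup.run (unary n)).unpair
  let (sigk, vk) ← (← D.keyGen.run (unary n ⋆ pp)).unpair
  let c ← D.del.run (unary n ⋆ sigk)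
  let v ← D.cert.run (unary n ⋆ pp ⋆ vk ⋆ ck ⋆ c ⋆ ofSet ∅)
  pure v.accepts

/-- Sign `m`, then delete the signing key and check the certificate. -/
def deletionGame₁ (m : Bool) (n : ℕ) : Mix Bool := do
  let (ck, pp) ← (← D.setup.run (unary n)).unpair
  let (sigk, vk) ← (← D.keyGen.run (unary n ⋆ pp)).unpair
  let (sigk', _) ← (← D.sign.run (unary n ⋆ pp ⋆ sigk ⋆ bit m)).unpair
  let c ← D.del.run (unary n ⋆ sigk')
  let v ← D.cert.run (unary n ⋆ pp ⋆ vk ⋆ ck ⋆ c ⋆ ofSet {m})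
  pure v.accepts

/-- One-time deletion correctness (after zero and after one signed message). -/
def OneTimeDeletionCorrect : Prop :=
  Overwhelming (fun n => (D.deletionGame₀ n).prob) ∧
    ∀ m : ℕ → Bool, Overwhelming fun n => (D.deletionGame₁ (m n) n).prob

/-- The adversary receives `pp` and outputs `(vk, cert, S, m*, σ*)`; it wins if `|S| ≤ 1`, the
certificate is valid for `S`, `m* ∉ S`, and `σ*` is a valid signature of `m*`. -/
def deletionSecurityGame (A : QPT) (n : ℕ) : Mix Bool := do
  let (ck, pp) ← (← D.setup.run (unary n)).unpair
  let (vk, r₁) ← (← (← A.run (unary n ⋆ pp)).measure).unpair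
  let (c, r₂) ← r₁.unpair
  let (s, r₃) ← r₂.unpair
  let (mStar, σStar) ← r₃.unpair
  match s.toSet?, mStar.toBit? with
  | some S, some m => do
      let v₁ ← D.cert.run (unary n ⋆ pp ⋆ vk ⋆ ck ⋆ c ⋆ ofSet S)
      let v₂ ← D.ver.run (unary n ⋆ pp ⋆ vk ⋆ bit m ⋆ σStar)
      pure (v₁.accepts && v₂.accepts && decide (m ∉ S ∧ S.card ≤ 1))
  | _, _ => pure false

/-- One-time deletion security. -/
def OneTimeDeletionSecure : Prop :=
  ∀ A : QPT, AtMostNegligible fun n => (D.deletionSecurityGame A n).prob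

end DSRKey

/-! ## The scheme built from two keys of a two-tier one-shot signature scheme -/

/-- The signing key `(sigk₀, sigk₁)` before the first signature (with a tag that tells it from a used
key). -/
def freshKey (s₀ s₁ : Data) : Data := bit false ⋆ s₀ ⋆ s₁

/-- The signing key `(b, sigk_b)` after a signature. -/
def usedKey (b : Bool) (s : Data) : Data := bit true ⋆ bit b ⋆ s

/-- The check of a certificate against `S` in the construction. -/
def pairCert (O : TwoTierOSS) (n : ℕ) (pp v₀ v₁ sk c : Data) (S : Finset Bool) : Mix Data :=
  if S = ∅ then
    match c with
    | bit false ⋆ bit true ⋆ σ₀ ⋆ σ₁ => do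
        let a₀ ← O.ver₁.run (unary n ⋆ pp ⋆ sk ⋆ v₀ ⋆ σ₀)
        let a₁ ← O.ver₁.run (unary n ⋆ pp ⋆ sk ⋆ v₁ ⋆ σ₁)
        pure (bit (a₀.accepts && a₁.accepts))
    | _ => pure (bit false)
  else
    match c with
    | bit b ⋆ σ =>
        if S = {!b} then O.ver₁.run (unary n ⋆ pp ⋆ sk ⋆ (if b then v₁ else v₀) ⋆ σ)
        else pure (bit false)
    | _ => pure (bit false)

/-- `D` runs the algorithms of `O` as follows: a key is a pair of keys of `O`, a signature of `m` is a
signature of `0` under the key number `m`, and deletion signs `1` under each key not yet used. -/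
structure IsPairConstruction (O : TwoTierOSS) (D : DSRKey) : Prop where
  setup : ∀ n, D.setup.run (unary n) = do
    let (pp, sk) ← (← O.setup.run (unary n)).unpair
    pure (sk ⋆ pp)
  keyGen : ∀ (n : ℕ) (pp : Data), pp.IsClassical → D.keyGen.run (unary n ⋆ pp) = do
    let (s₀, v₀) ← (← O.keyGen.run (unary n ⋆ pp)).unpair
    let (s₁, v₁) ← (← O.keyGen.run (unary n ⋆ pp)).unpair
    pure (freshKey s₀ s₁ ⋆ v₀ ⋆ v₁)
  sign : ∀ (n : ℕ) (pp s₀ s₁ : Data) (m : Bool), pp.IsClassical →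
    D.sign.run (unary n ⋆ pp ⋆ freshKey s₀ s₁ ⋆ bit m) = do
      let σ ← O.sign.run (unary n ⋆ (if m then s₁ else s₀) ⋆ bit false)
      pure (usedKey (!m) (if m then s₀ else s₁) ⋆ σ)
  ver : ∀ (n : ℕ) (pp v₀ v₁ : Data) (m : Bool) (σ : Data),
    pp.IsClassical → v₀.IsClassical → v₁.IsClassical → σ.IsClassical →
    D.ver.run (unary n ⋆ pp ⋆ (v₀ ⋆ v₁) ⋆ bit m ⋆ σ) =
      O.ver₀.run (unary n ⋆ pp ⋆ (if m then v₁ else v₀) ⋆ σ)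
  del_fresh : ∀ (n : ℕ) (s₀ s₁ : Data), D.del.run (unary n ⋆ freshKey s₀ s₁) = do
    let σ₀ ← O.sign.run (unary n ⋆ s₀ ⋆ bit true)
    let σ₁ ← O.sign.run (unary n ⋆ s₁ ⋆ bit true)
    pure (bit false ⋆ bit true ⋆ σ₀ ⋆ σ₁)
  del_used : ∀ (n : ℕ) (b : Bool) (s : Data), D.del.run (unary n ⋆ usedKey b s) = do
    let σ ← O.sign.run (unary n ⋆ s ⋆ bit true)
    pure (bit b ⋆ σ)
  cert : ∀ (n : ℕ) (pp v₀ v₁ sk c : Data) (S : Finset Bool),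
    pp.IsClassical → v₀.IsClassical → v₁.IsClassical → sk.IsClassical → c.IsClassical →
    D.cert.run (unary n ⋆ pp ⋆ (v₀ ⋆ v₁) ⋆ sk ⋆ c ⋆ ofSet S) = pairCert O n pp v₀ v₁ sk c S

end RevSig

end

/-! Why the construction works. Signing `m` spends key number `m` on a signature of `0`, and
deletion spends every remaining key on a signature of `1`. One-shot security forbids holding a
`ver₀`-valid signature and a `ver₁`-valid signature under one verification key.

Deletion security: if `j ∉ S` and `S` has at most one element, an accepted certificate for `S`
contains a `ver₁`-valid signature under key `j`. Together with a signature of `j` it breaks the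
one-shot scheme, so the reduction only reads components off the adversary's output
(`deletionValue_le`). There are four ways to read them, and a union bound over these suffices.

Unforgeability: a forgery of `j` without a query of `j` is valid under a key whose signing key is
merely discarded. Because `sign` has classical output and preserves the trace, discarding this key
is the same as signing `1` with it and forgetting the result (`expect_keySigDist_fst`). The
reduction `breaker` therefore prepares a signature of `1` under the target key and a signature of
`0` under the other key, both before the forger starts, and simulates the forger exactly
(`forgeryValue_eq`). Its own signature passes `ver₁` except with the correctness error, which is
added to the bound (`expect_targetProb_le`).

Correctness: once the untouched key is traced out, signing and deletion after one signature succeed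
with exactly the probabilities of the two correctness games of the one-shot scheme
(`coeff_correctGame`, `coeff_deletionGame₁`). For a fresh key the two signatures are independent
given the parameters, and `c² ≥ 2c - 1` finishes the argument (`two_mul_coeff_le`).

The rest concerns the machine model. Coefficients are complex, and the field `halts` speaks of
diagonal inputs only. Every program is shown to be a completely positive map that does not increase
the trace (`Prog.isChan_exec`), with Choi matrices given by positive semidefinite kernels, one for
each classical part. Cauchy-Schwarz for these kernels carries statements from diagonal to arbitrary
matrix units: trace preservation (`QPT.trace_exec`) and the absence of branches exceeding the time
bound (`QPT.exec_late`). Hence algorithms compose with polynomial bounds (`QPT.eval`, `Eval.bind`),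
and classical outputs are probability distributions (`QPT.isDist_run`). Games then become iterated
expectations, compared in the partial order of `ℂ`. -/

noncomputable section

namespace RevSig

open Data
open scoped ComplexOrder

/-! ### The monad of finitely supported complex combinations -/

namespace Mix

variable {α β γ : Type}

/-- The basis elements with nonzero coefficient. -/
def supp (μ : Mix α) : Finset α := Finsupp.support (show α →₀ ℂ from μ)

/-- Linear extension as a linear map. -/
def bindₗ (f : α → Mix β) : Mix α →ₗ[ℂ] Mix β := Finsupp.linearCombination ℂ f

/-- The coefficient of `a` as a linear map. -/
def coeffₗ (a : α) : Mix α →ₗ[ℂ] ℂ := Finsupp.lapply a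

theorem mem_supp {μ : Mix α} {a : α} : a ∈ μ.supp ↔ μ.coeff a ≠ 0 := Finsupp.mem_support_iff

@[ext] theorem ext {μ ν : Mix α} (h : ∀ a, μ.coeff a = ν.coeff a) : μ = ν := Finsupp.ext h

theorem bind_eq_bindₗ (μ : Mix α) (f : α → Mix β) : (μ >>= f) = bindₗ f μ := rfl

@[simp] theorem coeff_zero (a : α) : (0 : Mix α).coeff a = 0 := rfl

@[simp] theorem coeff_add (μ ν : Mix α) (a : α) : (μ + ν).coeff a = μ.coeff a + ν.coeff a := rfl

@[simp] theorem coeff_smul (c : ℂ) (μ : Mix α) (a : α) : (c • μ).coeff a = c * μ.coeff a := rfl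

@[simp] theorem coeff_sum {ι : Type*} (s : Finset ι) (f : ι → Mix α) (a : α) :
    (∑ i ∈ s, f i).coeff a = ∑ i ∈ s, (f i).coeff a := map_sum (coeffₗ a) f s

open Classical in
theorem coeff_pure (a b : α) : (pure a : Mix α).coeff b = if b = a then 1 else 0 := by
  have : (pure a : Mix α).coeff b = Finsupp.single a (1 : ℂ) b := rfl
  rw [this, Finsupp.single_apply]
  simp [eq_comm]

@[simp] theorem coeff_pure_self (a : α) : (pure a : Mix α).coeff a = 1 := by
  classical simp [coeff_pure]

theorem bind_eq_sum (μ : Mix α) (f : α → Mix β) :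
    (μ >>= f) = ∑ a ∈ μ.supp, μ.coeff a • f a := rfl

theorem coeff_bind (μ : Mix α) (f : α → Mix β) (b : β) :
    (μ >>= f).coeff b = ∑ a ∈ μ.supp, μ.coeff a * (f a).coeff b := by
  rw [bind_eq_sum, coeff_sum]; rfl

theorem coeff_bind_of_subset {μ : Mix α} {s : Finset α} (h : μ.supp ⊆ s) (f : α → Mix β) (b : β) :
    (μ >>= f).coeff b = ∑ a ∈ s, μ.coeff a * (f a).coeff b := by
  rw [coeff_bind]
  refine Finset.sum_subset h fun a _ ha => ?_
  rw [not_not.mp (mt mem_supp.mpr ha), zero_mul]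

instance : LawfulMonad Mix := LawfulMonad.mk'
  (id_map := fun μ => by
    show (μ >>= fun a => pure (id a)) = μ
    classical
    ext b
    simp only [coeff_bind, coeff_pure, id, mul_ite, mul_one, mul_zero, Finset.sum_ite_eq]
    rw [ite_eq_left_iff]
    exact fun h => (not_not.mp (mt mem_supp.mpr h)).symm)
  (pure_bind := fun a f => by
    show Finsupp.linearCombination ℂ f (Finsupp.single a 1) = f a
    rw [Finsupp.linearCombination_single]; exact one_smul ℂ (f a))
  (bind_assoc := fun μ f g => by
    rw [bind_eq_bindₗ, bind_eq_sum μ f, map_sum, bind_eq_sum]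
    exact Finset.sum_congr rfl fun a _ => map_smul (bindₗ g) _ _)

@[simp] theorem zero_bind (f : α → Mix β) : ((0 : Mix α) >>= f) = 0 := map_zero (bindₗ f)

theorem add_bind (μ ν : Mix α) (f : α → Mix β) : (μ + ν >>= f) = (μ >>= f) + (ν >>= f) :=
  map_add (bindₗ f) μ ν

theorem smul_bind (c : ℂ) (μ : Mix α) (f : α → Mix β) : (c • μ >>= f) = c • (μ >>= f) :=
  map_smul (bindₗ f) c μ

theorem sum_bind {ι : Type*} (s : Finset ι) (μ : ι → Mix α) (f : α → Mix β) :
    (∑ i ∈ s, μ i) >>= f = ∑ i ∈ s, (μ i >>= f) := map_sum (bindₗ f) μ s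

@[simp] theorem bind_zero (μ : Mix α) : (μ >>= fun _ => (0 : Mix β)) = 0 := by
  rw [bind_eq_sum]; simp

/-- Elements of coefficient zero contribute nothing to a linear extension. This is how the `_out`
fields, which constrain only data of nonzero coefficient, enter the computation of outputs. -/
theorem bind_congr_supp {μ : Mix α} {f g : α → Mix β} (h : ∀ a, μ.coeff a ≠ 0 → f a = g a) :
    (μ >>= f) = (μ >>= g) := by
  rw [bind_eq_sum, bind_eq_sum]
  exact Finset.sum_congr rfl fun a ha => by rw [h a (mem_supp.mp ha)]

/-- Both sides are the same finite double sum: independent samples have no order. -/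
theorem bind_comm (μ : Mix α) (ν : Mix β) (f : α → β → Mix γ) :
    (μ >>= fun a => ν >>= fun b => f a b) = ν >>= fun b => μ >>= fun a => f a b := by
  simp only [bind_eq_sum, Finset.smul_sum]
  rw [Finset.sum_comm]
  exact Finset.sum_congr rfl fun b _ => Finset.sum_congr rfl fun a _ => smul_comm _ _ _

/-- The linear extension of `g : α → ℂ`. -/
def expect (μ : Mix α) (g : α → ℂ) : ℂ := ∑ a ∈ μ.supp, μ.coeff a * g a

theorem expect_eq_coeff (μ : Mix α) (g : α → ℂ) :
    μ.expect g = (μ >>= fun a => g a • (pure () : Mix Unit)).coeff () := by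
  simp [coeff_bind, expect]

theorem expect_of_subset {μ : Mix α} {s : Finset α} (h : μ.supp ⊆ s) (g : α → ℂ) :
    μ.expect g = ∑ a ∈ s, μ.coeff a * g a := by
  simp [expect_eq_coeff, coeff_bind_of_subset h]

@[simp] theorem expect_pure (a : α) (g : α → ℂ) : (pure a : Mix α).expect g = g a := by
  simp [expect_eq_coeff]

@[simp] theorem expect_zero (g : α → ℂ) : (0 : Mix α).expect g = 0 := by
  simp [expect_eq_coeff]

@[simp] theorem expect_smul (c : ℂ) (μ : Mix α) (g : α → ℂ) :
    (c • μ).expect g = c * μ.expect g := by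
  simp [expect_eq_coeff, smul_bind]

theorem expect_sum {ι : Type*} (s : Finset ι) (μ : ι → Mix α) (g : α → ℂ) :
    (∑ i ∈ s, μ i).expect g = ∑ i ∈ s, (μ i).expect g := by
  simp [expect_eq_coeff, sum_bind]

/-- The tower rule; it turns every game into a nested expectation. -/
theorem expect_bind (μ : Mix α) (f : α → Mix β) (g : β → ℂ) :
    (μ >>= f).expect g = μ.expect fun a => (f a).expect g := by
  rw [bind_eq_sum, expect_sum]
  exact Finset.sum_congr rfl fun a _ => expect_smul _ _ _

theorem coeff_bind_eq_expect (μ : Mix α) (f : α → Mix β) (b : β) :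
    (μ >>= f).coeff b = μ.expect fun a => (f a).coeff b := coeff_bind μ f b

theorem expect_congr {μ : Mix α} {g h : α → ℂ} (H : ∀ a, μ.coeff a ≠ 0 → g a = h a) :
    μ.expect g = μ.expect h :=
  Finset.sum_congr rfl fun a ha => by rw [H a (mem_supp.mp ha)]

theorem expect_mul_left (μ : Mix α) (c : ℂ) (g : α → ℂ) :
    (μ.expect fun a => c * g a) = c * μ.expect g := by
  simp only [expect, Finset.mul_sum]
  exact Finset.sum_congr rfl fun a _ => by ring

theorem expect_mul_right (μ : Mix α) (c : ℂ) (g : α → ℂ) :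
    (μ.expect fun a => g a * c) = μ.expect g * c := by
  simp only [expect, Finset.sum_mul, mul_assoc]

theorem expect_add (μ : Mix α) (g h : α → ℂ) :
    (μ.expect fun a => g a + h a) = μ.expect g + μ.expect h := by
  simp only [expect, mul_add, Finset.sum_add_distrib]

theorem expect_sub (μ : Mix α) (g h : α → ℂ) :
    (μ.expect fun a => g a - h a) = μ.expect g - μ.expect h := by
  simp only [expect, mul_sub, Finset.sum_sub_distrib]

theorem coeff_eq_expect [DecidableEq α] (μ : Mix α) (a : α) :
    μ.coeff a = μ.expect fun b => if a = b then 1 else 0 := by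
  rw [expect_eq_coeff, ← expect_eq_coeff]
  conv_lhs => rw [← bind_pure μ]
  rw [coeff_bind_eq_expect]
  congr 1; ext b; rw [coeff_pure]; congr

/-- Every basis element with nonzero coefficient has the property `P`. -/
def Supp (μ : Mix α) (P : α → Prop) : Prop := ∀ a, μ.coeff a ≠ 0 → P a

theorem Supp.mono {μ : Mix α} {P Q : α → Prop} (h : μ.Supp P) (hPQ : ∀ a, P a → Q a) : μ.Supp Q :=
  fun a ha => hPQ a (h a ha)

theorem supp_zero (P : α → Prop) : (0 : Mix α).Supp P := fun _ h => (h rfl).elim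

theorem supp_pure {P : α → Prop} {a : α} (h : P a) : (pure a : Mix α).Supp P := fun b hb => by
  classical
  rw [coeff_pure] at hb
  rwa [show b = a by by_contra hne; simp [hne] at hb]

theorem Supp.bind {μ : Mix α} {P : α → Prop} {f : α → Mix β} {Q : β → Prop} (h : μ.Supp P)
    (hf : ∀ a, P a → (f a).Supp Q) : (μ >>= f).Supp Q := fun b hb => by
  rw [coeff_bind] at hb
  obtain ⟨a, ha, hne⟩ := Finset.exists_ne_zero_of_sum_ne_zero hb
  exact hf a (h a (mem_supp.mp ha)) b (right_ne_zero_of_mul hne)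

theorem supp_true (μ : Mix α) : μ.Supp fun _ => True := fun _ _ => trivial

theorem Supp.smul {μ : Mix α} {P : α → Prop} (h : μ.Supp P) (c : ℂ) : (c • μ).Supp P :=
  fun a ha => h a (right_ne_zero_of_mul ha)

theorem supp_sum {ι : Type*} {s : Finset ι} {μ : ι → Mix α} {P : α → Prop}
    (h : ∀ i ∈ s, (μ i).Supp P) : (∑ i ∈ s, μ i).Supp P := fun a ha => by
  rw [coeff_sum] at ha
  obtain ⟨i, hi, hne⟩ := Finset.exists_ne_zero_of_sum_ne_zero ha
  exact h i hi a hne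

end Mix

/-! ### Positive semidefinite kernels -/

/-- The cone of positive semidefinite kernels of finite rank, generated by the kernels of rank one. -/
def Gram (X : Type) : AddSubmonoid (X → X → ℂ) :=
  AddSubmonoid.closure (Set.range fun (φ : X → ℂ) x y => φ x * star (φ y))

namespace Gram

variable {X Y : Type}

theorem rankOne (φ : X → ℂ) : (fun x y => φ x * star (φ y)) ∈ Gram X :=
  AddSubmonoid.subset_closure ⟨φ, rfl⟩

theorem comap {K : Y → Y → ℂ} (hK : K ∈ Gram Y) (g : X → Y) :
    (fun x y => K (g x) (g y)) ∈ Gram X := by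
  induction hK using AddSubmonoid.closure_induction with
  | mem K h => obtain ⟨φ, rfl⟩ := h; exact rankOne fun x => φ (g x)
  | zero => exact zero_mem _
  | add K L _ _ hK hL => exact add_mem hK hL

/-- The Schur product theorem. With the cone generated by rank-one kernels it reduces to the remark
that a product of two of these has rank one. -/
theorem mul {K L : X → X → ℂ} (hK : K ∈ Gram X) (hL : L ∈ Gram X) :
    (fun x y => K x y * L x y) ∈ Gram X := by
  induction hK using AddSubmonoid.closure_induction with
  | zero => convert zero_mem (Gram X) using 1; ext; simp
  | add K K' _ _ hK hK' => convert add_mem hK hK' using 1; ext; simp [add_mul]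
  | mem K h =>
    obtain ⟨φ, rfl⟩ := h
    induction hL using AddSubmonoid.closure_induction with
    | zero => convert zero_mem (Gram X) using 1; ext; simp
    | add L L' _ _ hL hL' => convert add_mem hL hL' using 1; ext; simp [mul_add]
    | mem L h =>
      obtain ⟨ψ, rfl⟩ := h
      convert rankOne fun x => φ x * ψ x using 3
      simp only [star_mul']; ring

theorem sum {ι : Type*} (s : Finset ι) {K : ι → X → X → ℂ} (h : ∀ i ∈ s, K i ∈ Gram X) :
    (fun x y => ∑ i ∈ s, K i x y) ∈ Gram X := by
  convert sum_mem h using 1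
  ext x y; simp

/-- Summing out a row index and a column index independently replaces `φ` by `∑ a, φ (x, a)`. This
contracts the intermediate system when two Choi kernels are composed. -/
theorem compress {ι : Type} (s : Finset ι) {K : X × ι → X × ι → ℂ} (hK : K ∈ Gram (X × ι)) :
    (fun x y => ∑ a ∈ s, ∑ b ∈ s, K (x, a) (y, b)) ∈ Gram X := by
  induction hK using AddSubmonoid.closure_induction with
  | zero => convert zero_mem (Gram X) using 1; ext; simp
  | add K L _ _ hK hL => convert add_mem hK hL using 1; ext; simp [Finset.sum_add_distrib]
  | mem K h =>
    obtain ⟨φ, rfl⟩ := h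
    convert rankOne fun x => ∑ a ∈ s, φ (x, a) using 3
    simp only [star_sum, Finset.sum_mul_sum]

theorem quadratic {K : X → X → ℂ} (hK : K ∈ Gram X) (x y : X) (c d : ℂ) :
    0 ≤ c * star c * K x x + c * star d * K x y + d * star c * K y x + d * star d * K y y := by
  induction hK using AddSubmonoid.closure_induction with
  | zero => simp
  | add K L _ _ hK hL =>
    convert add_nonneg hK hL using 1
    simp only [Pi.add_apply]; ring
  | mem K h =>
    obtain ⟨φ, rfl⟩ := h
    convert mul_star_self_nonneg (c * φ x + d * φ y) using 1
    simp only [star_add, star_mul']; ring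

theorem diag_nonneg {K : X → X → ℂ} (hK : K ∈ Gram X) (x : X) : 0 ≤ K x x := by
  simpa using quadratic hK x x 1 0

theorem hermitian {K : X → X → ℂ} (hK : K ∈ Gram X) (x y : X) : K y x = star (K x y) := by
  induction hK using AddSubmonoid.closure_induction with
  | zero => simp
  | add K L _ _ hK hL => simp [hK, hL]
  | mem K h => obtain ⟨φ, rfl⟩ := h; simp [mul_comm]

/-- The degenerate case of Cauchy-Schwarz. With vanishing diagonal terms, the quadratic form at the
coefficients `-star (K x y)` and `1` equals `-2 |K x y|²`, which must be nonnegative. -/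
theorem eq_zero_of_diag {K : X → X → ℂ} (hK : K ∈ Gram X) {x y : X} (hx : K x x = 0)
    (hy : K y y = 0) : K x y = 0 := by
  have h := quadratic hK x y (-star (K x y)) 1
  rw [hx, hy, hermitian hK x y] at h
  have h' : (0 : ℂ) ≤ -(2 * (K x y * star (K x y))) := by
    convert h using 1
    simp only [star_neg, star_star, star_one]; ring
  have h0 := mul_star_self_nonneg (K x y)
  have h1 : K x y * star (K x y) = 0 := by
    refine le_antisymm ?_ h0
    have h2 : (2 : ℂ) * (K x y * star (K x y)) ≤ 0 := neg_nonneg.mp h'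
    calc K x y * star (K x y) ≤ K x y * star (K x y) + K x y * star (K x y) :=
          le_add_of_nonneg_left h0
      _ = 2 * (K x y * star (K x y)) := by ring
      _ ≤ 0 := h2
  simpa using h1

end Gram

/-! ### Hybrid bases and channels -/

/-- A type of matrix units `v = |row v⟩⟨col v|`, where a basis vector is represented by the projection
onto it, and where `skel` is the classical part. -/
class Hyb (S : Type) where
  row : S → S
  col : S → S
  skel : S → S
  join : S → S → S
  skel_row : ∀ v, skel (row v) = skel v
  skel_col : ∀ v, skel (col v) = skel v
  skel_join : ∀ a b, skel a = skel b → skel (join a b) = skel a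
  row_join : ∀ a b, skel a = skel b → row (join a b) = row a
  col_join : ∀ a b, skel a = skel b → col (join a b) = row b
  join_row_col : ∀ v, join (row v) (col v) = v
  row_row : ∀ v, row (row v) = row v
  col_row : ∀ v, col (row v) = row v
  row_col : ∀ v, row (col v) = col v
  col_col : ∀ v, col (col v) = col v
  fin : ∀ σ, {v | skel v = σ}.Finite

namespace Hyb

attribute [simp] skel_row skel_col row_row col_row row_col col_col join_row_col

variable {S T U : Type} [Hyb S] [Hyb T] [Hyb U]

theorem ext_iff {v w : S} : v = w ↔ row v = row w ∧ col v = col w := by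
  refine ⟨by rintro rfl; simp, fun h => ?_⟩
  rw [← join_row_col v, h.1, h.2, join_row_col]

theorem row_eq_self {v : S} (h : row v = col v) : row v = v := by
  rw [ext_iff]; simp [h]

open Classical in
/-- The trace of a matrix unit. -/
def tr (v : S) : ℂ := if row v = col v then 1 else 0

theorem tr_of_eq {v : S} (h : row v = col v) : tr v = 1 := if_pos h

theorem tr_of_ne {v : S} (h : row v ≠ col v) : tr v = 0 := if_neg h

@[simp] theorem tr_row (v : S) : tr (row v) = 1 := tr_of_eq (by simp)

@[simp] theorem tr_col (v : S) : tr (col v) = 1 := tr_of_eq (by simp)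

theorem tr_nonneg (v : S) : 0 ≤ tr v := by
  unfold tr; split_ifs <;> simp

def fiber (σ : S) : Finset S := (fin σ).toFinset

@[simp] theorem mem_fiber {σ v : S} : v ∈ fiber σ ↔ skel v = σ := by simp [fiber]

open Classical in
def kets (σ : S) : Finset S := (fiber σ).filter fun a => row a = a

theorem mem_kets {σ a : S} : a ∈ kets σ ↔ skel a = σ ∧ row a = a := by simp [kets]

/-- Within a block of fixed classical part, matrix units correspond to pairs of basis vectors
through `join` and `(row, col)`. -/
theorem sum_fiber (σ : S) (h : S → ℂ) :
    ∑ w ∈ fiber σ, h w = ∑ a ∈ kets σ, ∑ b ∈ kets σ, h (join a b) := by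
  rw [← Finset.sum_product']
  refine Finset.sum_nbij' (fun w => (row w, col w)) (fun p => join p.1 p.2) ?_ ?_ ?_ ?_ ?_
  · simp +contextual [mem_kets]
  · rintro ⟨a, b⟩
    simp only [Finset.mem_product, mem_kets, mem_fiber]
    rintro ⟨⟨h1, h2⟩, h3, h4⟩
    rw [skel_join a b (h1.trans h3.symm), h1]
  · simp
  · rintro ⟨a, b⟩
    simp only [Finset.mem_product, mem_kets]
    rintro ⟨⟨h1, h2⟩, h3, h4⟩
    rw [row_join a b (h1.trans h3.symm), col_join a b (h1.trans h3.symm), h2, h4]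
  · simp

open Classical in
/-- All skeletons that occur in the images of the fiber over `σ`. -/
def targets (f : S → Mix T) (σ : S) : Finset T :=
  (fiber σ).biUnion fun v => (f v).supp.image skel

open Classical in
-- The index set depends on `v` only through `skel v`. A kernel built from such sums can therefore
-- serve the whole block at once.
theorem expect_eq_sum_kets {f : S → Mix T} {v : S} (g : T → ℂ) :
    (f v).expect g = ∑ τ ∈ targets f (skel v), ∑ a ∈ kets τ, ∑ b ∈ kets τ,
      (f v).coeff (join a b) * g (join a b) := by
  have hs : (f v).supp ⊆ (targets f (skel v)).biUnion fiber := fun w hw => by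
    simp only [Finset.mem_biUnion, targets, mem_fiber, Finset.mem_image]
    exact ⟨skel w, ⟨v, rfl, w, hw, rfl⟩, rfl⟩
  rw [Mix.expect_of_subset hs, Finset.sum_biUnion]
  · exact Finset.sum_congr rfl fun τ _ => sum_fiber τ fun w => (f v).coeff w * g w
  · intro τ _ τ' _ hne
    rw [Function.onFun, Finset.disjoint_left]
    intro w hw hw'
    rw [mem_fiber] at hw hw'
    exact hne (hw.symm.trans hw')

open Classical in
-- On one block the trace is the identity kernel, a finite sum of the projections onto the basis
-- vectors.
theorem gram_tr (σ : S) : ∃ L ∈ Gram S, ∀ v, skel v = σ → tr v = L (row v) (col v) := by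
  refine ⟨_, Gram.sum (kets σ) fun a _ => Gram.rankOne fun x => if x = a then 1 else 0, ?_⟩
  intro v hv
  have : ∀ a, star (if col v = a then (1 : ℂ) else 0) = if col v = a then 1 else 0 := by
    intro a; split_ifs <;> simp
  simp only [this, mul_ite, mul_one, mul_zero, Finset.sum_ite_eq]
  rw [if_pos (by simp [mem_kets, hv]), tr]

/-- The step budget is classical: each value is a block of its own. -/
instance : Hyb ℕ where
  row := id
  col := id
  skel := id
  join := fun a _ => a
  skel_row _ := rfl
  skel_col _ := rfl
  skel_join _ _ _ := rfl
  row_join _ _ _ := rfl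
  col_join _ _ h := h
  join_row_col _ := rfl
  row_row _ := rfl
  col_row _ := rfl
  row_col _ := rfl
  col_col _ := rfl
  fin σ := Set.finite_singleton σ

instance : Hyb (S × T) where
  row p := (row p.1, row p.2)
  col p := (col p.1, col p.2)
  skel p := (skel p.1, skel p.2)
  join p q := (join p.1 q.1, join p.2 q.2)
  skel_row _ := by simp
  skel_col _ := by simp
  skel_join p q h := by
    simp only [Prod.mk.injEq] at h
    simp [skel_join _ _ h.1, skel_join _ _ h.2]
  row_join p q h := by
    simp only [Prod.mk.injEq] at h
    simp [row_join _ _ h.1, row_join _ _ h.2]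
  col_join p q h := by
    simp only [Prod.mk.injEq] at h
    simp [col_join _ _ h.1, col_join _ _ h.2]
  join_row_col _ := by simp
  row_row _ := by simp
  col_row _ := by simp
  row_col _ := by simp
  col_col _ := by simp
  fin σ := by
    refine ((fin σ.1).prod (fin σ.2)).subset fun p hp => ?_
    exact ⟨congrArg Prod.fst hp, congrArg Prod.snd hp⟩

theorem row_mk (a : S) (b : T) : row (a, b) = (row a, row b) := rfl

theorem col_mk (a : S) (b : T) : col (a, b) = (col a, col b) := rfl

theorem skel_mk (a : S) (b : T) : skel (a, b) = (skel a, skel b) := rfl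

theorem row_nat (n : ℕ) : row n = n := rfl

theorem col_nat (n : ℕ) : col n = n := rfl

theorem skel_nat (n : ℕ) : skel n = n := rfl

theorem tr_mk (a : S) (b : T) : tr (a, b) = tr a * tr b := by
  classical
  simp only [tr, row_mk, col_mk, Prod.mk.injEq]
  by_cases h : row a = col a <;> by_cases h' : row b = col b <;> simp [h, h']

@[simp] theorem tr_nat (n : ℕ) : tr n = 1 := tr_of_eq rfl

end Hyb

open Hyb

variable {S T U : Type} [Hyb S] [Hyb T] [Hyb U]

/-- The trace of an operator. -/
def Mix.trace (μ : Mix S) : ℂ := μ.expect tr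

/-- On the part with skeleton `σ`, the superoperator `f` is completely positive and does not increase
the trace. -/
structure IsChanAt (σ : S) (f : S → Mix T) : Prop where
  cp : ∃ K ∈ Gram (S × T), ∀ v w, skel v = σ →
    (f v).coeff w = K (row v, row w) (col v, col w)
  sub : ∃ L ∈ Gram S, ∀ v, skel v = σ → tr v - (f v).trace = L (row v) (col v)

/-- Completely positive maps that do not increase the trace. -/
def IsChan (f : S → Mix T) : Prop := ∀ σ, IsChanAt σ f

namespace IsChanAt

/-- Control flow depends on the classical part only, so on each block a branching map may be
replaced by the branch it takes. -/
theorem congr {σ : S} {f g : S → Mix T} (hf : IsChanAt σ f) (h : ∀ v, skel v = σ → g v = f v) :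
    IsChanAt σ g := by
  obtain ⟨⟨K, hK, hK'⟩, L, hL, hL'⟩ := hf
  exact ⟨⟨K, hK, fun v w hv => by rw [h v hv, hK' v w hv]⟩,
    L, hL, fun v hv => by rw [h v hv, hL' v hv]⟩

theorem zero (σ : S) : IsChanAt σ fun _ => (0 : Mix T) := by
  obtain ⟨L, hL, hL'⟩ := gram_tr σ
  exact ⟨⟨0, zero_mem _, fun _ _ _ => rfl⟩, L, hL, fun v hv => by simp [Mix.trace, hL' v hv]⟩

open Classical in
-- Such a map is conjugation by a map of basis vectors. Its Choi kernel has rank one, and its trace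
-- defect is zero.
theorem relabel {σ : S} {g : S → T} (hrow : ∀ v, skel v = σ → row (g v) = g (row v))
    (hcol : ∀ v, skel v = σ → col (g v) = g (col v)) (htr : ∀ v, skel v = σ → tr (g v) = tr v) :
    IsChanAt σ fun v => pure (g v) := by
  refine ⟨⟨_, Gram.rankOne fun p => if p.2 = g p.1 then 1 else 0, fun v w hv => ?_⟩,
    0, zero_mem _, fun v hv => by simp [Mix.trace, htr v hv]⟩
  rw [Mix.coeff_pure, Hyb.ext_iff (v := w), hrow v hv, hcol v hv]
  by_cases h : row w = g (row v) <;> by_cases h' : col w = g (col v) <;> simp [h, h']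

open Classical in
-- Off-diagonal units are killed and diagonal ones relabelled, so the Choi kernel is the identity
-- kernel on the input times a rank-one kernel. Measuring and discarding are both of this form.
theorem dephase {σ : S} {g : S → T}
    (hg : ∀ v, skel v = σ → row v = v → row (g v) = g v ∧ col (g v) = g v) :
    IsChanAt σ fun v => tr v • pure (g v) := by
  obtain ⟨L, hL, hL'⟩ := gram_tr σ
  refine ⟨⟨_, Gram.mul (Gram.comap hL Prod.fst) (Gram.rankOne fun p => if p.2 = g p.1 then 1 else 0),
    fun v w hv => ?_⟩, 0, zero_mem _, fun v hv => ?_⟩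
  · rw [← hL' v hv, Mix.coeff_smul, Mix.coeff_pure]
    by_cases h : row v = col v
    · have h1 := row_eq_self h
      have h2 : col v = v := h.symm.trans h1
      obtain ⟨h3, h4⟩ := hg v hv h1
      rw [Hyb.ext_iff (v := w), h3, h4, h1, h2]
      congr 1
      by_cases h : row w = g v <;> by_cases h' : col w = g v <;> simp [h, h']
    · rw [tr_of_ne h, zero_mul, zero_mul]
  · by_cases h : row v = col v
    · obtain ⟨h3, h4⟩ := hg v hv (row_eq_self h)
      simp [Mix.trace, tr_of_eq h, tr_of_eq (h3.trans h4.symm)]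
    · simp [Mix.trace, tr_of_ne h]

/-- The Choi kernels are multiplied, then contracted over rows and columns of the intermediate
datum, separately for each of the finitely many intermediate skeletons. -/
theorem bind {σ : S} {f : S → Mix T} {g : T → Mix U} (hf : IsChanAt σ f) (hg : IsChan g) :
    IsChanAt σ fun v => f v >>= g := by
  obtain ⟨⟨K, hK, hK'⟩, L, hL, hL'⟩ := hf
  choose M hM hM' using fun τ => (hg τ).cp
  choose N hN hN' using fun τ => (hg τ).sub
  constructor
  · refine ⟨_, Gram.sum (targets f σ) fun τ _ => Gram.compress (kets τ) <|
      Gram.mul (Gram.comap hK fun p : (S × U) × T => (p.1.1, p.2))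
        (Gram.comap (hM τ) fun p : (S × U) × T => (p.2, p.1.2)), fun v u hv => ?_⟩
    rw [Mix.coeff_bind_eq_expect, expect_eq_sum_kets, hv]
    refine Finset.sum_congr rfl fun τ _ => Finset.sum_congr rfl fun a ha =>
      Finset.sum_congr rfl fun b hb => ?_
    rw [mem_kets] at ha hb
    have hab := ha.1.trans hb.1.symm
    rw [hK' v _ hv, hM' τ _ u ((skel_join a b hab).trans ha.1), row_join a b hab, col_join a b hab,
      ha.2, hb.2]
  · refine ⟨_, add_mem hL <| Gram.sum (targets f σ) fun τ _ => Gram.compress (kets τ) <|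
      Gram.mul (Gram.comap hK fun p : S × T => (p.1, p.2))
        (Gram.comap (hN τ) fun p : S × T => p.2), fun v hv => ?_⟩
    rw [Pi.add_apply, Pi.add_apply, ← hL' v hv]
    -- The trace defect of the composition is the defect of `f` plus the defect of `g` pulled back
    -- along `f`; both are positive kernels.
    have : tr v - (f v >>= g).trace =
        tr v - (f v).trace + (f v).expect fun w => tr w - (g w).trace := by
      rw [Mix.expect_sub, Mix.trace, Mix.trace, Mix.expect_bind]
      simp only [Mix.trace]; ring
    rw [this, expect_eq_sum_kets, hv]
    congr 1
    refine Finset.sum_congr rfl fun τ _ => Finset.sum_congr rfl fun a ha =>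
      Finset.sum_congr rfl fun b hb => ?_
    rw [mem_kets] at ha hb
    have hab := ha.1.trans hb.1.symm
    rw [hK' v _ hv, hN' τ _ ((skel_join a b hab).trans ha.1), row_join a b hab, col_join a b hab,
      ha.2, hb.2]

/-- Complete positivity is what makes a spectator system harmless: the kernel of `f` is multiplied
by the rank-one kernel of the identity on `U`. -/
theorem tensor {σ : S} {f : S → Mix T} (hf : IsChanAt σ f) (υ : U) :
    IsChanAt (σ, υ) fun p : S × U => f p.1 >>= fun t => pure (t, p.2) := by
  classical
  obtain ⟨⟨K, hK, hK'⟩, L, hL, hL'⟩ := hf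
  obtain ⟨M, hM, hM'⟩ := gram_tr υ
  constructor
  · refine ⟨_, Gram.mul (Gram.comap hK fun p : (S × U) × (T × U) => (p.1.1, p.2.1))
      (Gram.rankOne fun p => if p.2.2 = p.1.2 then 1 else 0), ?_⟩
    rintro ⟨s, u⟩ ⟨t, u'⟩ hv
    simp only [skel_mk, Prod.mk.injEq] at hv
    have : (f s >>= fun t => pure (t, u)).coeff (t, u') =
        (f s).coeff t * if u' = u then 1 else 0 := by
      rw [Mix.coeff_bind_eq_expect, Mix.coeff_eq_expect (f s) t, ← Mix.expect_mul_right]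
      congr 1; ext t'
      simp only [Mix.coeff_pure, Prod.mk.injEq]
      by_cases h : t = t' <;> by_cases h' : u' = u <;> simp [h, h']
    rw [this, hK' s t hv.1, Hyb.ext_iff (v := u')]
    simp only [row_mk, col_mk]
    congr 1
    by_cases h : row u' = row u <;> by_cases h' : col u' = col u <;> simp [h, h']
  · refine ⟨_, Gram.mul (Gram.comap hL fun p : S × U => p.1) (Gram.comap hM fun p : S × U => p.2), ?_⟩
    rintro ⟨s, u⟩ hv
    simp only [skel_mk, Prod.mk.injEq] at hv
    have : (f s >>= fun t => pure (t, u)).trace = (f s).trace * tr u := by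
      simp only [Mix.trace, Mix.expect_bind, Mix.expect_pure, tr_mk, Mix.expect_mul_right]
    simp only [this, tr_mk, row_mk, col_mk]
    rw [← hL' s hv.1, ← hM' u hv.2, sub_mul]

end IsChanAt

namespace IsChan

theorem bind {f : S → Mix T} {g : T → Mix U} (hf : IsChan f) (hg : IsChan g) :
    IsChan fun v => f v >>= g := fun σ => (hf σ).bind hg

theorem tensor {f : S → Mix T} (hf : IsChan f) :
    IsChan fun p : S × U => f p.1 >>= fun t => pure (t, p.2) := fun σ => (hf σ.1).tensor σ.2

theorem coeff_nonneg {f : S → Mix T} (hf : IsChan f) {v : S} {w : T} (hv : row v = col v)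
    (hw : row w = col w) : 0 ≤ (f v).coeff w := by
  obtain ⟨K, hK, hK'⟩ := (hf (skel v)).cp
  rw [hK' v w rfl, hv, hw]
  exact Gram.diag_nonneg hK _

/-- Cauchy-Schwarz for the Choi kernel, whose two relevant diagonal entries are the hypotheses. -/
theorem coeff_eq_zero {f : S → Mix T} (hf : IsChan f) {v : S} {w : T}
    (h : (f (row v)).coeff (row w) = 0) (h' : (f (col v)).coeff (col w) = 0) :
    (f v).coeff w = 0 := by
  obtain ⟨K, hK, hK'⟩ := (hf (skel v)).cp
  rw [hK' _ _ (by simp)] at h h'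
  rw [hK' v w rfl]
  refine Gram.eq_zero_of_diag hK ?_ ?_
  · simpa using h
  · simpa using h'

theorem trace_le {f : S → Mix T} (hf : IsChan f) {v : S} (hv : row v = col v) :
    (f v).trace ≤ 1 := by
  obtain ⟨L, hL, hL'⟩ := (hf (skel v)).sub
  have := hL' v rfl
  rw [tr_of_eq hv, hv] at this
  rw [← sub_nonneg, this]
  exact Gram.diag_nonneg hL _

/-- The defect kernel vanishes on the diagonal at `row v` and `col v`, hence also at the
off-diagonal entry between them. -/
theorem trace_eq {f : S → Mix T} (hf : IsChan f) {v : S} (h : (f (row v)).trace = 1)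
    (h' : (f (col v)).trace = 1) : (f v).trace = tr v := by
  obtain ⟨L, hL, hL'⟩ := (hf (skel v)).sub
  have h1 := hL' (row v) (by simp)
  have h2 := hL' (col v) (by simp)
  rw [h] at h1; rw [h'] at h2
  have := hL' v rfl
  rw [Gram.eq_zero_of_diag hL (by simpa using h1.symm) (by simpa using h2.symm)] at this
  exact (sub_eq_zero.mp this).symm

end IsChan

/-! ### The hybrid basis of tree-shaped memory -/

namespace Data

def toRow : Data → Data
  | nil => nil
  | bit b => bit b
  | qubit i _ => qubit i i
  | a ⋆ b => a.toRow ⋆ b.toRow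

def toCol : Data → Data
  | nil => nil
  | bit b => bit b
  | qubit _ j => qubit j j
  | a ⋆ b => a.toCol ⋆ b.toCol

def toSkel : Data → Data
  | nil => nil
  | bit b => bit b
  | qubit _ _ => qubit false false
  | a ⋆ b => a.toSkel ⋆ b.toSkel

def joinUnits : Data → Data → Data
  | qubit i _, qubit j _ => qubit i j
  | a ⋆ b, c ⋆ d => joinUnits a c ⋆ joinUnits b d
  | v, _ => v

theorem finite_toSkel_fiber (σ : Data) : {v : Data | v.toSkel = σ}.Finite := by
  induction σ with
  | nil =>
    refine (Set.finite_singleton nil).subset fun v hv => ?_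
    cases v <;> simp_all [toSkel]
  | bit b =>
    refine (Set.finite_singleton (bit b)).subset fun v hv => ?_
    cases v <;> simp_all [toSkel]
  | qubit i j =>
    refine (Set.finite_range fun p : Bool × Bool => qubit p.1 p.2).subset fun v hv => ?_
    cases v <;> simp_all [toSkel]
  | pair a b ha hb =>
    refine (Set.Finite.image2 pair ha hb).subset fun v hv => ?_
    cases v <;> simp_all [toSkel]

theorem toSkel_toRow (v : Data) : v.toRow.toSkel = v.toSkel := by
  induction v <;> simp_all [toRow, toSkel]

theorem toSkel_toCol (v : Data) : v.toCol.toSkel = v.toSkel := by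
  induction v <;> simp_all [toCol, toSkel]

theorem joinUnits_spec (a b : Data) (h : a.toSkel = b.toSkel) :
    (joinUnits a b).toSkel = a.toSkel ∧ (joinUnits a b).toRow = a.toRow ∧
      (joinUnits a b).toCol = b.toRow := by
  induction a generalizing b with
  | pair a c ha hc =>
    cases b with
    | pair b d =>
      simp only [toSkel, pair.injEq] at h
      simp [joinUnits, toSkel, toRow, toCol, ha b h.1, hc d h.2]
    | _ => simp [toSkel] at h
  | _ => cases b <;> simp_all [joinUnits, toSkel, toRow, toCol]

theorem joinUnits_toRow_toCol (v : Data) : joinUnits v.toRow v.toCol = v := by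
  induction v <;> simp_all [toRow, toCol, joinUnits]

theorem toRow_toRow (v : Data) : v.toRow.toRow = v.toRow := by
  induction v <;> simp_all [toRow]

theorem toCol_toRow (v : Data) : v.toRow.toCol = v.toRow := by
  induction v <;> simp_all [toRow, toCol]

theorem toRow_toCol (v : Data) : v.toCol.toRow = v.toCol := by
  induction v <;> simp_all [toRow, toCol]

theorem toCol_toCol (v : Data) : v.toCol.toCol = v.toCol := by
  induction v <;> simp_all [toCol]

instance : Hyb Data where
  row := toRow
  col := toCol
  skel := toSkel
  join := joinUnits
  skel_row := toSkel_toRow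
  skel_col := toSkel_toCol
  skel_join a b h := (joinUnits_spec a b h).1
  row_join a b h := (joinUnits_spec a b h).2.1
  col_join a b h := (joinUnits_spec a b h).2.2
  join_row_col := joinUnits_toRow_toCol
  row_row := toRow_toRow
  col_row := toCol_toRow
  row_col := toRow_toCol
  col_col := toCol_toCol
  fin := finite_toSkel_fiber

end Data

section

variable (a b : Data) (x i j : Bool)

@[simp] theorem row_nil : row nil = nil := rfl
@[simp] theorem col_nil : col nil = nil := rfl
@[simp] theorem skel_nil : skel nil = nil := rfl
@[simp] theorem row_bit : row (bit x) = bit x := rfl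
@[simp] theorem col_bit : col (bit x) = bit x := rfl
@[simp] theorem skel_bit : skel (bit x) = bit x := rfl
@[simp] theorem row_qubit : row (qubit i j) = qubit i i := rfl
@[simp] theorem col_qubit : col (qubit i j) = qubit j j := rfl
@[simp] theorem skel_qubit : skel (qubit i j) = qubit false false := rfl
@[simp] theorem row_pair : row (a ⋆ b) = row a ⋆ row b := rfl
@[simp] theorem col_pair : col (a ⋆ b) = col a ⋆ col b := rfl
@[simp] theorem skel_pair : skel (a ⋆ b) = skel a ⋆ skel b := rfl

theorem tr_prod (t : ℕ × Data) : tr t = tr t.2 := by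
  obtain ⟨n, v⟩ := t
  rw [tr_mk, tr_nat, one_mul]

@[simp] theorem tr_nil : tr nil = 1 := tr_of_eq rfl
@[simp] theorem tr_bit : tr (bit x) = 1 := tr_of_eq rfl
@[simp] theorem tr_qubit : tr (qubit i j) = if i = j then 1 else 0 := by
  classical simp [tr]
@[simp] theorem tr_pair : tr (a ⋆ b) = tr a * tr b := by
  classical
  simp only [tr, row_pair, col_pair, pair.injEq]
  by_cases h : row a = col a <;> by_cases h' : row b = col b <;> simp [h, h']

end

namespace Data

theorem isDiag_iff {v : Data} : v.IsDiag ↔ row v = col v := by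
  induction v <;> simp_all [IsDiag]

theorem IsClassical.row_eq {v : Data} (h : v.IsClassical) : row v = v := by
  induction v <;> simp_all [IsClassical]

theorem IsClassical.col_eq {v : Data} (h : v.IsClassical) : col v = v := by
  induction v <;> simp_all [IsClassical]

theorem IsClassical.isDiag {v : Data} (h : v.IsClassical) : v.IsDiag :=
  isDiag_iff.mpr (h.row_eq.trans h.col_eq.symm)

theorem isClassical_congr {v w : Data} (h : skel v = skel w) :
    v.IsClassical ↔ w.IsClassical := by
  induction v generalizing w with
  | pair a b ha hb =>
    cases w <;> simp only [skel_pair, skel_nil, skel_bit, skel_qubit, pair.injEq, reduceCtorEq] at h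
    rw [IsClassical, IsClassical, ha h.1, hb h.2]
  | _ => cases w <;> simp_all [IsClassical]

theorem size_congr {v w : Data} (h : skel v = skel w) : v.size = w.size := by
  induction v generalizing w with
  | pair a b ha hb =>
    cases w <;> simp only [skel_pair, skel_nil, skel_bit, skel_qubit, pair.injEq, reduceCtorEq] at h
    rw [size, size, ha h.1, hb h.2]
  | _ => cases w <;> simp_all [size]

theorem drop_eq (v : Data) : v.drop = tr v • pure () := by
  classical
  by_cases h : v.IsDiag
  · rw [drop, if_pos h, tr_of_eq (isDiag_iff.mp h), one_smul]
  · rw [drop, if_neg h, tr_of_ne (mt isDiag_iff.mpr h), zero_smul]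

/-- The classical outcome of the measurement of a basis vector. -/
def outcome : Data → Data
  | nil => nil
  | bit b => bit b
  | qubit i _ => bit i
  | a ⋆ b => a.outcome ⋆ b.outcome

theorem isClassical_outcome (v : Data) : v.outcome.IsClassical := by
  induction v <;> simp_all [outcome, IsClassical]

/-- A matrix unit is either a projection onto a basis vector, with a definite outcome, or traceless,
and then measurement erases it. -/
theorem measure_eq (v : Data) : v.measure = tr v • pure v.outcome := by
  induction v with
  | qubit i j => by_cases h : i = j <;> simp [measure, outcome, h]
  | pair a b ha hb =>
    simp only [measure, outcome, ha, hb, Mix.smul_bind, LawfulMonad.pure_bind, tr_pair, mul_smul]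
  | _ => simp [measure, outcome]

theorem IsClassical.outcome_eq {v : Data} (h : v.IsClassical) : v.outcome = v := by
  induction v <;> simp_all [IsClassical, outcome]

theorem IsClassical.tr_eq {v : Data} (h : v.IsClassical) : tr v = 1 :=
  tr_of_eq (h.row_eq.trans h.col_eq.symm)

theorem IsClassical.measure_eq {v : Data} (h : v.IsClassical) : v.measure = pure v := by
  rw [Data.measure_eq, h.tr_eq, h.outcome_eq, one_smul]

theorem IsClassical.drop_eq {v : Data} (h : v.IsClassical) : v.drop = pure () := by
  rw [Data.drop_eq, h.tr_eq, one_smul]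

end Data

/-! ### Programs are channels -/

theorem IsChan.of_map {S T : Type} [Hyb S] [Hyb T] {g : S → T} (hrow : ∀ v, row (g v) = g (row v))
    (hcol : ∀ v, col (g v) = g (col v)) (htr : ∀ v, tr (g v) = tr v) :
    IsChan fun v => pure (g v) :=
  fun _ => .relabel (fun v _ => hrow v) (fun v _ => hcol v) fun v _ => htr v

theorem isChan_pure {S : Type} [Hyb S] : IsChan fun v : S => pure v :=
  .of_map (fun _ => rfl) (fun _ => rfl) fun _ => rfl

theorem isChan_drop : IsChan fun v : Data => v.drop >>= fun _ => pure nil := fun _ =>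
  (IsChanAt.dephase (g := fun _ => nil) fun v _ _ => ⟨rfl, rfl⟩).congr fun v _ => by
    rw [drop_eq, Mix.smul_bind, LawfulMonad.pure_bind]

theorem isChan_measure : IsChan Data.measure := fun _ =>
  (IsChanAt.dephase (g := outcome) fun v _ _ =>
    ⟨(isClassical_outcome v).row_eq, (isClassical_outcome v).col_eq⟩).congr fun v _ => measure_eq v

theorem coeff_gate_qubit (U : Matrix Bool Bool ℂ) (i j : Bool) (w : Data) :
    ((qubit i j).gate U).coeff w =
      match w with
      | qubit k l => U k i * star (U l j)
      | _ => 0 := by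
  classical
  simp only [gate, Fintype.sum_bool, Mix.coeff_add, Mix.coeff_smul, Mix.coeff_pure]
  cases w with
  | qubit k l => cases k <;> cases l <;> simp
  | _ => simp

/-- Conjugation by `U` has the rank-one Choi kernel with vector `(i, k) ↦ U k i`. Orthonormality of
the columns makes the trace defect zero; data other than qubits are untouched. -/
theorem isChan_gate {U : Matrix Bool Bool ℂ}
    (hU : ∀ i j, ∑ k, U k i * star (U k j) = if i = j then 1 else 0) : IsChan (Data.gate U) := by
  intro σ
  cases σ with
  | qubit s t =>
    refine ⟨⟨_, Gram.rankOne fun p : Data × Data =>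
      match p with
      | (qubit i _, qubit k _) => U k i
      | _ => 0, fun v w hv => ?_⟩, 0, zero_mem _, fun v hv => ?_⟩
    · cases v <;> simp only [skel_nil, skel_bit, skel_qubit, skel_pair, reduceCtorEq] at hv
      rw [coeff_gate_qubit]
      cases w <;> simp only [row_qubit, col_qubit, row_nil, col_nil, row_bit, col_bit, row_pair,
        col_pair, star_zero, mul_zero]
    · cases v <;> simp only [skel_nil, skel_bit, skel_qubit, skel_pair, reduceCtorEq] at hv
      rename_i i j
      have := hU i j
      simp only [Fintype.sum_bool] at this
      simp [gate, Mix.trace, Mix.expect_eq_coeff, Mix.add_bind, Mix.smul_bind, ← this]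
  | _ =>
    refine (isChan_pure _).congr fun v hv => ?_
    cases v <;> simp_all [gate]

theorem hadamardGate_unitary (i j : Bool) :
    ∑ k, hadamardGate k i * star (hadamardGate k j) = if i = j then 1 else 0 := by
  have h : (Real.sqrt 2 : ℂ) * (Real.sqrt 2 : ℂ) = 2 := by
    rw [← Complex.ofReal_mul, Real.mul_self_sqrt (by norm_num)]; norm_num
  have h' : ((Real.sqrt 2 : ℂ))⁻¹ * ((Real.sqrt 2 : ℂ))⁻¹ = 1 / 2 := by
    rw [← mul_inv, h]; norm_num
  cases i <;> cases j <;> (simp [hadamardGate, div_eq_mul_inv, h']; try norm_num)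

theorem tGate_unitary (i j : Bool) :
    ∑ k, tGate k i * star (tGate k j) = if i = j then 1 else 0 := by
  have h : Complex.exp (Real.pi / 4 * Complex.I) *
      (starRingEnd ℂ) (Complex.exp (Real.pi / 4 * Complex.I)) = 1 := by
    rw [← Complex.exp_conj, ← Complex.exp_add]
    have : (starRingEnd ℂ) (Real.pi / 4 * Complex.I) = -(Real.pi / 4 * Complex.I) := by
      rw [map_mul, map_div₀, Complex.conj_ofReal, Complex.conj_I, Complex.conj_ofNat]; ring
    rw [this, add_neg_cancel, Complex.exp_zero]
  cases i <;> cases j <;> simp [tGate, h]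

/-- The action of the instructions that permute the matrix units. -/
def Prog.map : Prog → Data → Data
  | .swap, a ⋆ b => b ⋆ a
  | .assoc, (a ⋆ b) ⋆ c => a ⋆ b ⋆ c
  | .addNil, v => nil ⋆ v
  | .remNil, nil ⋆ v => v
  | .const b, nil => bit b
  | .prep, bit b => qubit b b
  | .cnot, qubit i j ⋆ qubit k l => qubit i j ⋆ qubit (xor i k) (xor j l)
  | _, v => v

theorem Prog.isChan_map (p : Prog) : IsChan fun v => pure (p.map v) := by
  have key : ∀ v, row (p.map v) = p.map (row v) ∧ col (p.map v) = p.map (col v) ∧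
      tr (p.map v) = tr v := by
    intro v
    cases p
    case swap => cases v <;> simp [Prog.map, mul_comm]
    case assoc => rcases v with _ | _ | _ | ⟨_ | _ | _ | _, _⟩ <;> simp [Prog.map, mul_assoc]
    case addNil => simp [Prog.map]
    case remNil => rcases v with _ | _ | _ | ⟨_ | _ | _ | _, _⟩ <;> simp [Prog.map]
    case const => cases v <;> simp [Prog.map]
    case prep => cases v <;> simp [Prog.map]
    case cnot =>
      rcases v with _ | _ | _ | ⟨_ | _ | ⟨i, j⟩ | _, _ | _ | ⟨k, l⟩ | _⟩ <;> simp [Prog.map]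
      cases i <;> cases j <;> cases k <;> cases l <;> rfl
    all_goals simp [Prog.map]
  exact .of_map (fun v => (key v).1) (fun v => (key v).2.1) fun v => (key v).2.2

/-- Having no qubit leaf is a property of the skeleton, so a block is copied as a whole or left
alone as a whole. In the first case all its units have trace one. -/
theorem isChan_dup : IsChan fun v => Prog.dup.elem v := by
  classical
  intro σ
  by_cases hσ : ∃ v : Data, skel v = σ ∧ v.IsClassical
  · obtain ⟨u, hu, hu'⟩ := hσ
    refine (IsChanAt.relabel (g := fun v => v ⋆ v) (fun v _ => rfl) (fun v _ => rfl)
      fun v hv => ?_).congr fun v hv => ?_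
    · simp [((isClassical_congr (hv.trans hu.symm)).mpr hu').tr_eq]
    · exact if_pos ((isClassical_congr (hv.trans hu.symm)).mpr hu')
  · exact (isChan_pure _).congr fun v hv => if_neg fun h => hσ ⟨v, hv, h⟩

theorem Prog.elem_eq_map {p : Prog} (hp : p ≠ dup ∧ p ≠ discard ∧ p ≠ measure ∧ p ≠ had ∧ p ≠ tee)
    (v : Data) : p.elem v = pure (p.map v) := by
  cases p
  case dup => exact (hp.1 rfl).elim
  case discard => exact (hp.2.1 rfl).elim
  case measure => exact (hp.2.2.1 rfl).elim
  case had => exact (hp.2.2.2.1 rfl).elim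
  case tee => exact (hp.2.2.2.2 rfl).elim
  case swap => cases v <;> rfl
  case assoc => rcases v with _ | _ | _ | ⟨_ | _ | _ | _, _⟩ <;> rfl
  case remNil => rcases v with _ | _ | _ | ⟨_ | _ | _ | _, _⟩ <;> rfl
  case const => cases v <;> rfl
  case prep => cases v <;> rfl
  case cnot => rcases v with _ | _ | _ | ⟨_ | _ | _ | _, _ | _ | _ | _⟩ <;> rfl
  all_goals rfl

theorem Prog.isChan_elem (p : Prog) : IsChan p.elem := by
  by_cases hp : p ≠ dup ∧ p ≠ discard ∧ p ≠ measure ∧ p ≠ had ∧ p ≠ tee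
  · rw [funext (elem_eq_map hp)]; exact p.isChan_map
  · cases p
    case dup => exact isChan_dup
    case discard => exact isChan_drop
    case measure => exact isChan_measure
    case had => exact isChan_gate hadamardGate_unitary
    case tee => exact isChan_gate tGate_unitary
    all_goals simp at hp

/-- Spend a number of steps that depends on the datum. -/
def charge (c : Data → ℕ) (s : ℕ × Data) : Mix (ℕ × Data) :=
  spend (c s.2) s.1 >>= fun k => pure (k, s.2)

/-- Price and budget are constant on a block. Either all of it can pay, which is a relabelling, or
all of it is lost. -/
theorem isChan_charge {c : Data → ℕ} (hc : ∀ v w : Data, skel v = skel w → c v = c w) :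
    IsChan (charge c) := by
  rintro ⟨n, σ⟩
  by_cases h : ∃ v : Data, skel v = σ ∧ c v ≤ n
  · obtain ⟨u, hu, hu'⟩ := h
    refine (IsChanAt.relabel (g := fun s => (s.1 - c u, s.2)) (fun _ _ => rfl) (fun _ _ => rfl)
      fun ⟨_, _⟩ _ => by simp [tr_mk]).congr ?_
    rintro ⟨k, v⟩ hv
    simp only [skel_mk, skel_nat, Prod.mk.injEq] at hv
    have := hc v u (hv.2.trans hu.symm)
    simp [charge, spend, this, hv.1, hu']
  · refine (IsChanAt.zero _).congr ?_
    rintro ⟨k, v⟩ hv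
    simp only [skel_mk, skel_nat, Prod.mk.injEq] at hv
    have : ¬ c v ≤ k := fun h' => h ⟨v, hv.2, hv.1 ▸ h'⟩
    simp only [charge, spend, this, if_false, Mix.zero_bind]

theorem charge_bind {α : Type} (c : Data → ℕ) (k : ℕ) (v : Data) (F : ℕ × Data → Mix α) :
    charge c (k, v) >>= F = spend (c v) k >>= fun k' => F (k', v) := by
  simp [charge]

/-- The second component of a pair. -/
def Data.right : Data → Data
  | _ ⋆ b => b
  | v => v

theorem isChanAt_right {σ : Data} {b : Bool} (hσ : ∀ v, skel v = σ → ∃ w, v = bit b ⋆ w) (n : ℕ) :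
    IsChanAt (n, σ) fun s : ℕ × Data => pure (s.1, s.2.right) := by
  refine .relabel ?_ ?_ ?_ <;>
  · rintro ⟨k, v⟩ hv
    obtain ⟨w, rfl⟩ := hσ v (congrArg Prod.snd hv)
    simp [right, row_mk, col_mk, tr_mk, row_nat, col_nat]

theorem isChan_loopRounds {f : ℕ × Data → Mix (ℕ × Data)} (hf : IsChan f) (n : ℕ) :
    IsChan (loopRounds f n) := by
  induction n with
  | zero => exact fun σ => IsChanAt.zero σ
  | succ n ih =>
    have hstep : IsChan fun s : ℕ × Data =>
        match s.2 with
        | bit true ⋆ w => loopRounds f n (s.1, w)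
        | bit false ⋆ w => pure (s.1, w)
        | w => pure (s.1, w) := by
      rintro ⟨m, σ⟩
      -- The continuation bit belongs to the skeleton, so each block takes exactly one branch of the
      -- loop.
      by_cases h1 : ∀ v, skel v = σ → ∃ w, v = bit true ⋆ w
      · refine ((isChanAt_right h1 m).bind ih).congr ?_
        rintro ⟨k, v⟩ hv
        obtain ⟨w, rfl⟩ := h1 v (congrArg Prod.snd hv)
        simp [right]
      by_cases h2 : ∀ v, skel v = σ → ∃ w, v = bit false ⋆ w
      · refine (isChanAt_right h2 m).congr ?_
        rintro ⟨k, v⟩ hv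
        obtain ⟨w, rfl⟩ := h2 v (congrArg Prod.snd hv)
        simp [right]
      refine (isChan_pure _).congr ?_
      rintro ⟨k, v⟩ hv
      have hv' : skel v = σ := congrArg Prod.snd hv
      subst hv'
      rcases v with _ | _ | _ | ⟨_ | b | _ | _, w⟩ <;> try rfl
      exfalso
      cases b
      · exact h2 fun u hu => by
          rcases u with _ | _ | _ | ⟨_ | b | _ | _, w⟩ <;> simp_all
      · exact h1 fun u hu => by
          rcases u with _ | _ | _ | ⟨_ | b | _ | _, w⟩ <;> simp_all
    have := (hf.bind (isChan_charge (c := fun _ => 1) fun _ _ _ => rfl)).bind hstep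
    convert this using 2 with s
    simp only [loopRounds, bind_assoc, charge, LawfulMonad.pure_bind]

theorem Prog.exec_elem {p : Prog} (k : ℕ) (v : Data)
    (h : p.exec (k, v) = spend (p.elemCost v) k >>= fun k₀ => p.elem v >>= fun w => pure (k₀, w)) :
    p.exec (k, v) = charge p.elemCost (k, v) >>= fun s =>
      pure (s.2, s.1) >>= fun t : Data × ℕ => (p.elem t.1 >>= fun w => pure (w, t.2)) >>= fun u =>
        pure (u.2, u.1) := by
  rw [h, charge_bind]; simp

theorem isChan_pair_swap {S T : Type} [Hyb S] [Hyb T] :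
    IsChan fun s : S × T => pure (s.2, s.1) :=
  .of_map (fun _ => rfl) (fun _ => rfl) fun ⟨_, _⟩ => by simp [tr_mk, mul_comm]

/-- After payment the remaining budget is a spectator. The two swaps bring the datum into the
position on which `tensor` acts. -/
theorem Prog.isChan_exec_of_elem {p : Prog} (h : ∀ k v, p.exec (k, v) =
    spend (p.elemCost v) k >>= fun k₀ => p.elem v >>= fun w => pure (k₀, w)) : IsChan p.exec := by
  have hc : IsChan (charge p.elemCost) := isChan_charge fun v w hvw => by
    cases p <;> simp [elemCost, size_congr hvw]
  convert hc.bind <| isChan_pair_swap.bind <| p.isChan_elem.tensor.bind isChan_pair_swap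
    using 2 with s
  exact exec_elem s.1 s.2 (h s.1 s.2)

theorem isChan_charge_one : IsChan (charge fun _ => 1) := isChan_charge fun _ _ _ => rfl

/-- Run `f` and `g` in turn on the two components of a pair, with a common budget. -/
def parStep (f g : ℕ × Data → Mix (ℕ × Data)) (s : ℕ × Data) : Mix (ℕ × Data) :=
  match s.2 with
  | a ⋆ b => f (s.1, a) >>= fun t => g (t.1, b) >>= fun u => pure (u.1, t.2 ⋆ u.2)
  | v => pure (s.1, v)

/-- The components of a pair. -/
def Data.split : Data → Data × Data
  | a ⋆ b => (a, b)
  | v => (v, nil)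

theorem isChan_parStep {f g : ℕ × Data → Mix (ℕ × Data)} (hf : IsChan f) (hg : IsChan g) :
    IsChan (parStep f g) := by
  rintro ⟨n, σ⟩
  by_cases h : ∃ σ₁ σ₂, σ = σ₁ ⋆ σ₂
  · obtain ⟨σ₁, σ₂, rfl⟩ := h
    have h1 : IsChanAt (n, σ₁ ⋆ σ₂) fun s : ℕ × Data =>
        pure (((s.1, s.2.split.1), s.2.split.2) : (ℕ × Data) × Data) := by
      refine .relabel ?_ ?_ ?_ <;>
      · rintro ⟨k, v⟩ hv
        cases v <;> simp only [skel_mk, Prod.mk.injEq, skel_nil, skel_bit, skel_qubit, and_false,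
          reduceCtorEq] at hv
        simp [split, row_mk, col_mk, tr_mk, row_nat, col_nat]
    have h2 : IsChan fun s : (ℕ × Data) × Data => pure ((s.1.1, s.2), s.1.2) :=
      .of_map (fun _ => rfl) (fun _ => rfl) fun ⟨⟨_, _⟩, _⟩ => by simp [tr_mk, mul_comm]
    have h3 : IsChan fun s : (ℕ × Data) × Data => pure (s.1.1, s.2 ⋆ s.1.2) :=
      .of_map (fun _ => rfl) (fun _ => rfl) fun ⟨⟨_, _⟩, _⟩ => by simp [tr_mk, mul_comm]
    refine (h1.bind <| hf.tensor.bind <| h2.bind <| hg.tensor.bind h3).congr ?_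
    rintro ⟨k, v⟩ hv
    cases v <;> simp only [skel_mk, Prod.mk.injEq, skel_nil, skel_bit, skel_qubit, and_false,
      reduceCtorEq] at hv
    simp only [parStep, split, LawfulMonad.pure_bind, bind_assoc]
  · refine (isChan_pure _).congr ?_
    rintro ⟨k, v⟩ hv
    cases v
    case pair a b => exact (h ⟨_, _, (congrArg Prod.snd hv).symm⟩).elim
    all_goals rfl

/-- Run `f` or `g` according to the first component of a pair. -/
def condStep (f g : ℕ × Data → Mix (ℕ × Data)) (s : ℕ × Data) : Mix (ℕ × Data) :=
  match s.2 with
  | bit b ⋆ w => if b then f (s.1, w) else g (s.1, w)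
  | v => pure (s.1, v)

theorem isChan_condStep {f g : ℕ × Data → Mix (ℕ × Data)} (hf : IsChan f) (hg : IsChan g) :
    IsChan (condStep f g) := by
  rintro ⟨n, σ⟩
  by_cases h : ∃ b, ∀ v, skel v = σ → ∃ w, v = bit b ⋆ w
  · obtain ⟨b, hb⟩ := h
    refine ((isChanAt_right hb n).bind (g := if b then f else g) (by cases b <;> simpa)).congr ?_
    rintro ⟨k, v⟩ hv
    obtain ⟨w, rfl⟩ := hb v (congrArg Prod.snd hv)
    cases b <;> simp [condStep, right]
  · refine (isChan_pure _).congr ?_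
    rintro ⟨k, v⟩ hv
    have hv' : skel v = σ := congrArg Prod.snd hv
    subst hv'
    rcases v with _ | _ | _ | ⟨_ | b | _ | _, w⟩ <;> try rfl
    exact (h ⟨b, fun u hu => by rcases u with _ | _ | _ | ⟨_ | b | _ | _, w⟩ <;> simp_all⟩).elim

/-- Run one of four maps according to the root of the datum. -/
def shapeStep (f g h i : ℕ × Data → Mix (ℕ × Data)) (s : ℕ × Data) : Mix (ℕ × Data) :=
  match s.2 with
  | nil => f s
  | bit _ => g s
  | qubit _ _ => h s
  | _ ⋆ _ => i s

theorem isChan_shapeStep {f g h i : ℕ × Data → Mix (ℕ × Data)} (hf : IsChan f) (hg : IsChan g)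
    (hh : IsChan h) (hi : IsChan i) : IsChan (shapeStep f g h i) := by
  have aux : ∀ {j : ℕ × Data → Mix (ℕ × Data)}, IsChan j → ∀ n σ,
      (∀ k v, skel v = σ → shapeStep f g h i (k, v) = j (k, v)) →
      IsChanAt (n, σ) (shapeStep f g h i) := fun hj n σ H =>
    (hj (n, σ)).congr fun v hv => H v.1 v.2 (congrArg Prod.snd hv)
  rintro ⟨n, σ⟩
  cases σ
  · exact aux hf n _ fun k v hv => by cases v <;> simp_all [shapeStep]
  · exact aux hg n _ fun k v hv => by cases v <;> simp_all [shapeStep]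
  · exact aux hh n _ fun k v hv => by cases v <;> simp_all [shapeStep]
  · exact aux hi n _ fun k v hv => by cases v <;> simp_all [shapeStep]

theorem Prog.exec_par (p q : Prog) (s : ℕ × Data) :
    (Prog.par p q).exec s = charge (fun _ => 1) s >>= parStep p.exec q.exec := by
  obtain ⟨k, v⟩ := s
  simp only [exec, charge_bind]
  cases v <;> rfl

theorem Prog.exec_cond (p q : Prog) (s : ℕ × Data) :
    (Prog.cond p q).exec s = charge (fun _ => 1) s >>= condStep p.exec q.exec := by
  obtain ⟨k, v⟩ := s
  simp only [exec, charge_bind]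
  rcases v with _ | _ | _ | ⟨_ | _ | _ | _, _⟩ <;> rfl

theorem Prog.exec_shape (p q r t : Prog) (s : ℕ × Data) :
    (Prog.shape p q r t).exec s =
      charge (fun _ => 1) s >>= shapeStep p.exec q.exec r.exec t.exec := by
  obtain ⟨k, v⟩ := s
  simp only [exec, charge_bind]
  cases v <;> rfl

theorem Prog.isChan_exec (p : Prog) : IsChan p.exec := by
  induction p with
  | seq p q hp hq =>
    convert hp.bind hq using 2 with s
    simp only [exec]
  | par p q hp hq => exact (funext (exec_par p q)) ▸ isChan_charge_one.bind (isChan_parStep hp hq)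
  | cond p q hp hq => exact (funext (exec_cond p q)) ▸ isChan_charge_one.bind (isChan_condStep hp hq)
  | shape p q r s hp hq hr hs =>
    exact (funext (exec_shape p q r s)) ▸ isChan_charge_one.bind (isChan_shapeStep hp hq hr hs)
  | loop p hp =>
    rintro ⟨n, σ⟩
    refine (isChan_loopRounds hp (n + 1) _).congr ?_
    rintro ⟨k, v⟩ hv
    -- The number of rounds is tied to the budget, which is constant on the block, so one fixed
    -- number of rounds covers the block.
    obtain rfl : k = n := congrArg Prod.fst hv
    rw [exec]
  | _ => exact isChan_exec_of_elem fun k v => by simp only [exec]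

/-! ### Running time -/

/-- Spending steps before or after `f` makes no difference. -/
def BudgetComm (f : ℕ × Data → Mix (ℕ × Data)) : Prop :=
  ∀ c s, (f s >>= charge fun _ => c) = charge (fun _ => c) s >>= f

/-- Either order amounts to spending `c + d` at once. -/
theorem spend_comm {α : Type} (c d k : ℕ) (F : ℕ → Mix α) :
    (spend c k >>= fun k' => spend d k' >>= F) = spend d k >>= fun k' => spend c k' >>= F := by
  have h : ∀ c d : ℕ, (spend c k >>= fun k' => spend d k' >>= F) =
      if c + d ≤ k then F (k - (c + d)) else 0 := by
    intro c d
    unfold spend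
    by_cases h : c ≤ k
    · by_cases h' : d ≤ k - c
      · rw [if_pos h, LawfulMonad.pure_bind, if_pos h', LawfulMonad.pure_bind, if_pos (by omega),
          Nat.sub_sub]
      · rw [if_pos h, LawfulMonad.pure_bind, if_neg h', Mix.zero_bind, if_neg (by omega)]
    · rw [if_neg h, Mix.zero_bind, if_neg (by omega)]
  rw [h, h, add_comm]

theorem charge_map (c k : ℕ) (v : Data) (g : Data → Data) :
    charge (fun _ => c) (k, g v) = charge (fun _ => c) (k, v) >>= fun t => pure (t.1, g t.2) := by
  simp only [charge, bind_assoc, LawfulMonad.pure_bind]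

namespace BudgetComm

theorem bind {f g : ℕ × Data → Mix (ℕ × Data)} (hf : BudgetComm f) (hg : BudgetComm g) :
    BudgetComm fun s => f s >>= g := fun c s => by
  rw [bind_assoc, funext fun t => hg c t, ← bind_assoc, hf, bind_assoc]

theorem charge (d : Data → ℕ) : BudgetComm (charge d) := fun c s => by
  simp only [RevSig.charge, bind_assoc, LawfulMonad.pure_bind]
  exact spend_comm _ _ _ _

theorem parStep {f g : ℕ × Data → Mix (ℕ × Data)} (hf : BudgetComm f) (hg : BudgetComm g) :
    BudgetComm (parStep f g) := by
  rintro c ⟨k, v⟩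
  cases v with
  | pair a b =>
    have h1 : ∀ (t u : ℕ × Data), RevSig.charge (fun _ => c) (u.1, t.2 ⋆ u.2) =
        RevSig.charge (fun _ => c) u >>= fun u => Pure.pure (u.1, t.2 ⋆ u.2) := fun t u =>
      charge_map c u.1 u.2 fun w => t.2 ⋆ w
    have h2 : ∀ t : ℕ × Data, (RevSig.charge (fun _ => c) (t.1, b) >>= fun u => g u >>= fun u =>
        Pure.pure (u.1, t.2 ⋆ u.2)) = RevSig.charge (fun _ => c) t >>= fun t => g (t.1, b) >>= fun u =>
        (Pure.pure (u.1, t.2 ⋆ u.2) : Mix (ℕ × Data)) := fun t => by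
      simp only [RevSig.charge, bind_assoc, LawfulMonad.pure_bind]
    simp only [RevSig.parStep, bind_assoc, LawfulMonad.pure_bind, h1]
    simp only [← bind_assoc (g _), hg c, bind_assoc (RevSig.charge _ _), h2]
    simp only [← bind_assoc (f _), hf c]
    simp only [RevSig.charge, bind_assoc, LawfulMonad.pure_bind]
    rfl
  | _ => simp [RevSig.parStep, RevSig.charge]

theorem condStep {f g : ℕ × Data → Mix (ℕ × Data)} (hf : BudgetComm f) (hg : BudgetComm g) :
    BudgetComm (condStep f g) := by
  rintro c ⟨k, v⟩
  rcases v with _ | _ | _ | ⟨_ | b | _ | _, w⟩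
  case pair.bit =>
    cases b
    · simp only [RevSig.condStep, hg c, charge_bind, Bool.false_eq_true, if_false]
    · simp only [RevSig.condStep, hf c, charge_bind, if_true]
  all_goals simp [RevSig.condStep, RevSig.charge]

theorem shapeStep {f g h i : ℕ × Data → Mix (ℕ × Data)} (hf : BudgetComm f) (hg : BudgetComm g)
    (hh : BudgetComm h) (hi : BudgetComm i) : BudgetComm (shapeStep f g h i) := by
  rintro c ⟨k, v⟩
  cases v <;> simp only [RevSig.shapeStep, hf c, hg c, hh c, hi c, charge_bind]

end BudgetComm

/-- The continuation of a loop after one round of its body. -/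
def loopStep (f : ℕ × Data → Mix (ℕ × Data)) (s : ℕ × Data) : Mix (ℕ × Data) :=
  match s.2 with
  | bit true ⋆ w => f (s.1, w)
  | bit false ⋆ w => pure (s.1, w)
  | w => pure (s.1, w)

theorem loopRounds_succ (f : ℕ × Data → Mix (ℕ × Data)) (n : ℕ) (s : ℕ × Data) :
    loopRounds f (n + 1) s =
      f s >>= fun t => charge (fun _ => 1) t >>= loopStep (loopRounds f n) := by
  simp only [loopRounds, charge, bind_assoc, LawfulMonad.pure_bind]
  rfl

theorem BudgetComm.loopStep {f : ℕ × Data → Mix (ℕ × Data)} (hf : BudgetComm f) :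
    BudgetComm (loopStep f) := by
  rintro c ⟨k, v⟩
  rcases v with _ | _ | _ | ⟨_ | b | _ | _, w⟩
  case pair.bit =>
    cases b
    · rw [charge_bind]
      simp only [RevSig.loopStep, RevSig.charge, LawfulMonad.pure_bind]
    · simp only [RevSig.loopStep, hf c, charge_bind]
  all_goals simp [RevSig.loopStep, RevSig.charge]

theorem BudgetComm.loopRounds {f : ℕ × Data → Mix (ℕ × Data)} (hf : BudgetComm f) (n : ℕ) :
    BudgetComm (loopRounds f n) := by
  induction n with
  | zero => exact fun c s => by simp [RevSig.loopRounds]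
  | succ n ih =>
    rw [funext (loopRounds_succ f n)]
    exact hf.bind ((BudgetComm.charge _).bind ih.loopStep)

/-- `f` does not increase the budget, and the size grows by at most two per step. -/
def Bounded (f : ℕ × Data → Mix (ℕ × Data)) : Prop :=
  ∀ s, (f s).Supp fun t => t.1 ≤ s.1 ∧ t.2.size + 2 * t.1 ≤ s.2.size + 2 * s.1

theorem Data.size_pos (v : Data) : 0 < v.size := by
  cases v <;> simp only [size] <;> omega

namespace Bounded

theorem bind {f g : ℕ × Data → Mix (ℕ × Data)} (hf : Bounded f) (hg : Bounded g) :
    Bounded fun s => f s >>= g := fun s =>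
  (hf s).bind fun t ht => (hg t).mono fun _ hu => ⟨hu.1.trans ht.1, hu.2.trans ht.2⟩

theorem charge (c : Data → ℕ) : Bounded (charge c) := fun s => by
  simp only [RevSig.charge, spend]
  split_ifs
  · rw [LawfulMonad.pure_bind]
    exact Mix.supp_pure ⟨Nat.sub_le _ _, by simp only; omega⟩
  · rw [Mix.zero_bind]; exact Mix.supp_zero _

theorem pure : Bounded pure := fun _ => Mix.supp_pure ⟨le_rfl, le_rfl⟩

theorem parStep {f g : ℕ × Data → Mix (ℕ × Data)} (hf : Bounded f) (hg : Bounded g) :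
    Bounded (parStep f g) := by
  rintro ⟨k, v⟩
  cases v with
  | pair a b =>
    refine (hf (k, a)).bind fun t ht => (hg (t.1, b)).bind fun u hu => Mix.supp_pure ?_
    simp only [size] at *
    omega
  | _ => exact pure _

theorem condStep {f g : ℕ × Data → Mix (ℕ × Data)} (hf : Bounded f) (hg : Bounded g) :
    Bounded (condStep f g) := by
  rintro ⟨k, v⟩
  rcases v with _ | _ | _ | ⟨_ | b | _ | _, w⟩
  case pair.bit =>
    cases b
    · exact (hg (k, w)).mono fun t ht => by simp only [size] at *; omega
    · exact (hf (k, w)).mono fun t ht => by simp only [size] at *; omega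
  all_goals exact pure _

theorem shapeStep {f g h i : ℕ × Data → Mix (ℕ × Data)} (hf : Bounded f) (hg : Bounded g)
    (hh : Bounded h) (hi : Bounded i) : Bounded (shapeStep f g h i) := by
  rintro ⟨k, v⟩
  cases v
  exacts [hf _, hg _, hh _, hi _]

theorem loopStep {f : ℕ × Data → Mix (ℕ × Data)} (hf : Bounded f) : Bounded (loopStep f) := by
  rintro ⟨k, v⟩
  rcases v with _ | _ | _ | ⟨_ | b | _ | _, w⟩
  case pair.bit =>
    cases b
    · exact Mix.supp_pure (by simp only [size]; omega)
    · exact (hf (k, w)).mono fun t ht => by simp only [size] at *; omega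
  all_goals exact pure _

theorem loopRounds {f : ℕ × Data → Mix (ℕ × Data)} (hf : Bounded f) (n : ℕ) :
    Bounded (loopRounds f n) := by
  induction n with
  | zero => exact fun s => Mix.supp_zero _
  | succ n ih =>
    rw [funext (loopRounds_succ f n)]
    exact hf.bind ((charge _).bind ih.loopStep)

end Bounded

theorem supp_spend (c k : ℕ) : (spend c k).Supp fun k' => k' + c = k := by
  unfold spend
  split_ifs with h
  · exact Mix.supp_pure (Nat.sub_add_cancel h)
  · exact Mix.supp_zero _

/-- Each round costs at least one step and the body never refunds any, so a number of rounds
exceeding the budget is never exhausted and its exact value is irrelevant. -/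
theorem loopRounds_stable {f : ℕ × Data → Mix (ℕ × Data)} (hf : Bounded f) (n m : ℕ) (s : ℕ × Data)
    (hn : s.1 < n) (hm : s.1 < m) : loopRounds f n s = loopRounds f m s := by
  induction n generalizing m s with
  | zero => omega
  | succ n ih =>
    cases m with
    | zero => omega
    | succ m =>
      rw [loopRounds_succ, loopRounds_succ]
      refine Mix.bind_congr_supp fun t ht => ?_
      have h1 := hf s t ht
      obtain ⟨j, v⟩ := t
      rw [charge_bind, charge_bind]
      refine Mix.bind_congr_supp fun k hk => ?_
      have h2 := supp_spend 1 j k hk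
      rcases v with _ | _ | _ | ⟨_ | b | _ | _, w⟩
      case pair.bit =>
        cases b
        · rfl
        · exact ih m (k, w) (by (try simp only at *); omega) (by (try simp only at *); omega)
      all_goals rfl

/-- The constant two comes from `addNil`, which adds a leaf and a node for one step. Copying doubles
the size plus one node, and is covered because its price is the size. -/
theorem Prog.size_elem (p : Prog) (v : Data) :
    (p.elem v).Supp fun w => w.size ≤ v.size + 2 * p.elemCost v := by
  have hv := v.size_pos
  by_cases hp : p ≠ dup ∧ p ≠ discard ∧ p ≠ measure ∧ p ≠ had ∧ p ≠ tee
  · have hsize : (p.map v).size ≤ v.size + 2 := by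
      cases p
      case swap => cases v <;> simp only [map, size] <;> omega
      case assoc =>
        rcases v with _ | _ | _ | ⟨_ | _ | _ | _, _⟩ <;> simp only [map, size] <;> omega
      case addNil => simp only [map, size]; omega
      case remNil =>
        rcases v with _ | _ | _ | ⟨_ | _ | _ | _, _⟩ <;> simp only [map, size] <;> omega
      case const => cases v <;> simp only [map, size] <;> omega
      case prep => cases v <;> simp only [map, size] <;> omega
      case cnot =>
        rcases v with _ | _ | _ | ⟨_ | _ | _ | _, _ | _ | _ | _⟩ <;> simp only [map, size] <;> omega
      all_goals simp [map]
    have hcost : 1 ≤ p.elemCost v := by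
      cases p <;> simp only [elemCost] <;> omega
    rw [elem_eq_map hp]
    exact Mix.supp_pure (by omega)
  · have hgate : ∀ U, (v.gate U).Supp fun w => w.size ≤ v.size + 2 * 1 := fun U => by
      cases v
      case qubit i j =>
        exact Mix.supp_sum fun k _ => Mix.supp_sum fun l _ =>
          (Mix.supp_pure (by simp only [size]; omega)).smul _
      all_goals exact Mix.supp_pure (by omega)
    cases p
    case dup =>
      simp only [elem, elemCost]
      split_ifs
      · exact Mix.supp_pure (by simp only [size]; omega)
      · exact Mix.supp_pure (by omega)
    case discard =>
      refine (Mix.supp_true v.drop).bind fun _ _ => Mix.supp_pure ?_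
      simp only [size, elemCost]
      omega
    case measure =>
      have : v.outcome.size = v.size := by
        clear hv hgate
        induction v <;> simp_all [outcome, size]
      simp only [elem, measure_eq]
      exact (Mix.supp_pure (by omega)).smul _
    case had => exact hgate _
    case tee => exact hgate _
    all_goals simp at hp

theorem budgetComm_of_elem {p : Prog} (h : ∀ k v, p.exec (k, v) =
    spend (p.elemCost v) k >>= fun k₀ => p.elem v >>= fun w => pure (k₀, w)) :
    BudgetComm p.exec := by
  rintro c ⟨k, v⟩
  have h1 : ∀ k' : ℕ, (p.elem v >>= fun w => charge (fun _ => c) (k', w)) =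
      spend c k' >>= fun k₀ => p.elem v >>= fun w => pure (k₀, w) := fun k' => by
    simp only [charge]
    rw [Mix.bind_comm]
  simp only [h, charge_bind, bind_assoc, LawfulMonad.pure_bind, h1]
  exact spend_comm _ _ _ _

theorem bounded_of_elem {p : Prog} (h : ∀ k v, p.exec (k, v) =
    spend (p.elemCost v) k >>= fun k₀ => p.elem v >>= fun w => pure (k₀, w)) :
    Bounded p.exec := by
  rintro ⟨k, v⟩
  rw [h]
  refine (supp_spend _ _).bind fun k' hk' => (p.size_elem v).bind fun w hw => Mix.supp_pure ?_
  simp only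
  omega

theorem Prog.bounded_exec (p : Prog) : Bounded p.exec := by
  induction p with
  | seq p q hp hq =>
    convert hp.bind hq using 2 with s
    simp only [exec]
  | par p q hp hq => exact (funext (exec_par p q)) ▸ (Bounded.charge _).bind (.parStep hp hq)
  | cond p q hp hq => exact (funext (exec_cond p q)) ▸ (Bounded.charge _).bind (.condStep hp hq)
  | shape p q r s hp hq hr hs =>
    exact (funext (exec_shape p q r s)) ▸ (Bounded.charge _).bind (.shapeStep hp hq hr hs)
  | loop p hp => exact fun s => by rw [exec]; exact hp.loopRounds _ s
  | _ => exact bounded_of_elem fun k v => by simp only [exec]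

/-- Steps are only subtracted, so their order is irrelevant. Only the loop needs care: spending
beforehand lowers its number of rounds, which `loopRounds_stable` shows to be harmless. -/
theorem Prog.budgetComm_exec (p : Prog) : BudgetComm p.exec := by
  induction p with
  | seq p q hp hq =>
    convert hp.bind hq using 2 with s
    simp only [exec]
  | par p q hp hq => exact (funext (exec_par p q)) ▸ (BudgetComm.charge _).bind (.parStep hp hq)
  | cond p q hp hq => exact (funext (exec_cond p q)) ▸ (BudgetComm.charge _).bind (.condStep hp hq)
  | shape p q r s hp hq hr hs =>
    exact (funext (exec_shape p q r s)) ▸ (BudgetComm.charge _).bind (.shapeStep hp hq hr hs)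
  | loop p hp =>
    rintro c ⟨k, v⟩
    rw [exec, hp.loopRounds]
    simp only [charge_bind]
    refine Mix.bind_congr_supp fun k' hk' => ?_
    have := supp_spend c k k' hk'
    rw [exec]
    exact loopRounds_stable p.bounded_exec _ _ _ (by simp only; omega) (by simp only; omega)
  | _ => exact budgetComm_of_elem fun k v => by simp only [exec]

/-! ### Evaluation within a time bound -/

/-- On the datum `v`, the map `f` spends at most `k` steps, and its output is `μ`. -/
def Eval (f : ℕ × Data → Mix (ℕ × Data)) (v : Data) (k : ℕ) (μ : Mix Data) : Prop :=
  ∀ K, k ≤ K → (f (K, v)).Supp (fun t => K ≤ t.1 + k) ∧ (f (K, v) >>= fun t => pure t.2) = μ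

theorem Prog.result_eq (p : Prog) (k : ℕ) (v : Data) :
    p.result k v = p.exec (k, v) >>= fun t => pure t.2 := rfl

theorem Prog.haltProb_eq (p : Prog) (k : ℕ) (v : Data) :
    p.haltProb k v = (p.exec (k, v)).trace := by
  rw [haltProb, result_eq, bind_assoc, Mix.trace, Mix.expect_eq_coeff]
  simp only [LawfulMonad.pure_bind, drop_eq, tr_prod]

theorem Mix.trace_snd (μ : Mix (ℕ × Data)) : (μ >>= fun t => pure t.2).trace = μ.trace := by
  simp only [trace, expect_bind, expect_pure, ← tr_prod]

/-- `halts` gives trace one on `row v` and `col v`, which have the size of `v` and hence the same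
time bound; `IsChan.trace_eq` fills in the off-diagonal units. -/
theorem QPT.trace_exec (A : QPT) (v : Data) :
    (A.prog.exec (A.time.eval v.size, v)).trace = tr v := by
  have h : ∀ w : Data, row w = col w → w.size = v.size →
      (A.prog.exec (A.time.eval v.size, w)).trace = 1 := fun w hw hs => by
    rw [← Prog.haltProb_eq, ← hs]
    exact A.halts w (isDiag_iff.mpr hw)
  have := A.prog.isChan_exec.trace_eq (v := (A.time.eval v.size, v))
    (h (row v) (by simp) (size_congr (by simp))) (h (col v) (by simp) (size_congr (by simp)))
  rw [this, tr_mk, tr_nat, one_mul]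

theorem QPT.trace_run (A : QPT) (v : Data) : (A.run v).trace = tr v := by
  rw [QPT.run, Prog.result_eq, Mix.trace_snd, trace_exec]

/-- For a diagonal input all weight already halts within the time bound, and the total weight is at
most one, so nothing is left for slower branches. Positivity excludes cancellation among these and
upgrades zero total weight to zero coefficients. -/
theorem QPT.exec_late (A : QPT) (v : Data) {K : ℕ} (hK : A.time.eval v.size ≤ K) :
    (A.prog.exec (K, v)).Supp fun t => K ≤ t.1 + A.time.eval v.size := by
  set T := A.time.eval v.size with hT
  have key : ∀ w : Data, row w = col w → w.size = v.size → ∀ t : ℕ × Data, row t.2 = col t.2 →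
      t.1 < K - T → (A.prog.exec (K, w)).coeff t = 0 := by
    intro w hw hs t ht htk
    have hnn : ∀ t ∈ (A.prog.exec (K, w)).supp, 0 ≤ (A.prog.exec (K, w)).coeff t *
        (if t.1 < K - T then tr t.2 else 0) := by
      intro t _
      split_ifs
      · by_cases hd : row t.2 = col t.2
        · refine mul_nonneg (A.prog.isChan_exec.coeff_nonneg (congrArg (Prod.mk K) hw) ?_)
            (tr_nonneg _)
          exact congrArg (Prod.mk t.1) hd
        · rw [tr_of_ne hd, mul_zero]
      · rw [mul_zero]
    have hle : (A.prog.exec (K, w)).expect (fun t => if t.1 < K - T then tr t.2 else 0) ≤ 0 := by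
      have h1 : (A.prog.exec (K, w)).trace ≤ 1 :=
        A.prog.isChan_exec.trace_le (congrArg (Prod.mk K) hw)
      -- Running with budget `K` and then spending `K - T` is, by commutation, a run with budget
      -- `T`, which loses no trace.
      have h2 : (A.prog.exec (K, w) >>= charge fun _ => K - T).trace = 1 := by
        rw [A.prog.budgetComm_exec, charge_bind, spend, if_pos (Nat.sub_le _ _),
          LawfulMonad.pure_bind, Nat.sub_sub_self hK, hT, ← hs, trace_exec, tr_of_eq hw]
      have h3 : (A.prog.exec (K, w)).expect (fun t => if t.1 < K - T then tr t.2 else 0) =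
          (A.prog.exec (K, w)).trace - (A.prog.exec (K, w) >>= charge fun _ => K - T).trace := by
        rw [Mix.trace, Mix.trace, Mix.expect_bind, ← Mix.expect_sub]
        refine Mix.expect_congr fun t _ => ?_
        obtain ⟨j, u⟩ := t
        simp only [charge, spend]
        by_cases h4 : j < K - T
        · rw [if_pos h4, if_neg (by omega), Mix.zero_bind, Mix.expect_zero, sub_zero, tr_prod]
        · rw [if_neg h4, if_pos (by omega), LawfulMonad.pure_bind]
          simp [tr_mk]
      rw [h3, h2, sub_nonpos]
      exact h1
    have h0 := le_antisymm hle (Finset.sum_nonneg hnn)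
    rw [Mix.expect, Finset.sum_eq_zero_iff_of_nonneg hnn] at h0
    by_contra hne
    have := h0 t (Mix.mem_supp.mpr hne)
    rw [if_pos htk, tr_of_eq ht, mul_one] at this
    exact hne this
  intro t ht
  by_contra hlt
  -- An off-diagonal output has the same remaining budget as its row and its column, both already
  -- excluded.
  refine ht (A.prog.isChan_exec.coeff_eq_zero ?_ ?_)
  · exact key (row v) (by simp) (size_congr (by simp)) (row t) (by simp [show row t = (t.1, row t.2) from rfl])
      (by simp only [show row t = (t.1, row t.2) from rfl]; omega)
  · exact key (col v) (by simp) (size_congr (by simp)) (col t) (by simp [show col t = (t.1, col t.2) from rfl])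
      (by simp only [show col t = (t.1, col t.2) from rfl]; omega)

/-- By `exec_late` no branch is lost when the surplus `K - T` is spent at the end, so forgetting the
budget gives the same output for all sufficient budgets. -/
theorem QPT.eval (A : QPT) (v : Data) : Eval A.prog.exec v (A.time.eval v.size) (A.run v) := by
  intro K hK
  have hlate := A.exec_late v hK
  refine ⟨hlate, ?_⟩
  set T := A.time.eval v.size with hT
  have h1 : (A.prog.exec (K, v) >>= charge fun _ => K - T) = A.prog.exec (T, v) := by
    rw [A.prog.budgetComm_exec, charge_bind, spend, if_pos (Nat.sub_le _ _),
      LawfulMonad.pure_bind, Nat.sub_sub_self hK]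
  rw [QPT.run, Prog.result_eq, ← hT, ← h1, bind_assoc]
  refine Mix.bind_congr_supp fun t ht => ?_
  have := hlate t ht
  simp only [charge, spend]
  rw [if_pos (by omega)]
  simp only [LawfulMonad.pure_bind]

/-! ### Combinators for quantum polynomial-time algorithms -/

namespace Eval

theorem mono {f : ℕ × Data → Mix (ℕ × Data)} {v : Data} {k k' : ℕ} {μ : Mix Data}
    (h : Eval f v k μ) (hk : k ≤ k') : Eval f v k' μ := fun K hK =>
  ⟨(h K (hk.trans hK)).1.mono fun _ ht => ht.trans (by omega), (h K (hk.trans hK)).2⟩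

theorem charge_bind {f : ℕ × Data → Mix (ℕ × Data)} {v : Data} {k : ℕ} {μ : Mix Data}
    (h : Eval f v k μ) (c : Data → ℕ) : Eval (fun s => charge c s >>= f) v (c v + k) μ := by
  intro K hK
  have := h (K - c v) (by omega)
  simp only [RevSig.charge_bind]
  rw [spend, if_pos (by omega), LawfulMonad.pure_bind]
  exact ⟨this.1.mono fun _ ht => by omega, this.2⟩

theorem pure (v : Data) : Eval Pure.pure v 0 (pure v) := fun K _ =>
  ⟨Mix.supp_pure le_rfl, by rw [LawfulMonad.pure_bind]⟩

/-- Within `k` steps a datum grows by at most `2 * k`, so one bound `k'` valid for all inputs of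
that size serves every branch of the first stage. -/
theorem bind {f g : ℕ × Data → Mix (ℕ × Data)} {v : Data} {k k' : ℕ} {μ : Mix Data}
    {ν : Data → Mix Data} (hf : Bounded f) (h : Eval f v k μ)
    (h' : ∀ w : Data, w.size ≤ v.size + 2 * k → Eval g w k' (ν w)) :
    Eval (fun s => f s >>= g) v (k + k') (μ >>= ν) := by
  intro K hK
  have h1 := h K (by omega)
  have h2 : ∀ t, (f (K, v)).coeff t ≠ 0 → t.2.size ≤ v.size + 2 * k ∧ k' ≤ t.1 ∧ K ≤ t.1 + k := by
    intro t ht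
    have := hf (K, v) t ht
    have := h1.1 t ht
    simp only at *
    omega
  constructor
  · refine Mix.Supp.bind (P := fun t : ℕ × Data =>
      t.2.size ≤ v.size + 2 * k ∧ k' ≤ t.1 ∧ K ≤ t.1 + k) h2 ?_
    intro t ht
    exact ((h' t.2 ht.1) t.1 ht.2.1).1.mono fun u hu => by omega
  · rw [bind_assoc, ← h1.2, bind_assoc]
    refine Mix.bind_congr_supp fun t ht => ?_
    rw [LawfulMonad.pure_bind]
    exact ((h' t.2 (h2 t ht).1) t.1 (h2 t ht).2.1).2

theorem parStep {f g : ℕ × Data → Mix (ℕ × Data)} {a b : Data} {k k' : ℕ} {μ ν : Mix Data}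
    (h : Eval f a k μ) (h' : Eval g b k' ν) :
    Eval (parStep f g) (a ⋆ b) (k + k') (μ >>= fun x => ν >>= fun y => Pure.pure (x ⋆ y)) := by
  intro K hK
  have h1 := h K (by omega)
  simp only [RevSig.parStep]
  constructor
  · refine h1.1.bind fun t ht => ((h' t.1 (by omega)).1).bind fun u hu => Mix.supp_pure ?_
    simp only
    omega
  · rw [← h1.2, bind_assoc, bind_assoc]
    refine Mix.bind_congr_supp fun t ht => ?_
    rw [bind_assoc, LawfulMonad.pure_bind, ← (h' t.1 (by have := h1.1 t ht; omega)).2, bind_assoc]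
    simp only [LawfulMonad.pure_bind]

end Eval

theorem polynomial_eval_mono (P : Polynomial ℕ) {m n : ℕ} (h : m ≤ n) : P.eval m ≤ P.eval n := by
  induction P using Polynomial.induction_on' with
  | add P Q hP hQ => simp only [Polynomial.eval_add]; omega
  | monomial i a => simp only [Polynomial.eval_monomial]; gcongr

theorem Mix.trace_bind_of {μ : Mix Data} {f : Data → Mix Data} (hf : ∀ v, (f v).trace = tr v) :
    (μ >>= f).trace = μ.trace := by
  rw [trace, expect_bind]
  exact expect_congr fun v _ => hf v

namespace QPT

/-- The algorithm given by a program whose output and running time are known. -/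
def ofEval (p : Prog) (T : Polynomial ℕ) (F : Data → Mix Data)
    (h : ∀ v, Eval p.exec v (T.eval v.size) (F v)) (htr : ∀ v, (F v).trace = tr v) : QPT where
  prog := p
  time := T
  halts v hv := by
    rw [Prog.haltProb_eq, ← Mix.trace_snd, (h v _ le_rfl).2, htr, tr_of_eq (isDiag_iff.mp hv)]

theorem run_ofEval {p : Prog} {T : Polynomial ℕ} {F : Data → Mix Data}
    (h : ∀ v, Eval p.exec v (T.eval v.size) (F v)) (htr : ∀ v, (F v).trace = tr v) (v : Data) :
    (ofEval p T F h htr).run v = F v := (h v _ le_rfl).2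

theorem eval_of_elem {p : Prog} (h : ∀ k v, p.exec (k, v) =
    spend (p.elemCost v) k >>= fun k₀ => p.elem v >>= fun w => pure (k₀, w)) (v : Data) :
    Eval p.exec v ((Polynomial.X + 1 : Polynomial ℕ).eval v.size) (p.elem v) := by
  have hc : p.elemCost v ≤ v.size + 1 := by
    cases p <;> simp [Prog.elemCost]
  intro K hK
  simp only [Polynomial.eval_add, Polynomial.eval_X, Polynomial.eval_one] at hK ⊢
  rw [h, spend, if_pos (by omega), LawfulMonad.pure_bind]
  constructor
  · exact (Mix.supp_true _).bind fun _ _ => Mix.supp_pure (by simp only; omega)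
  · simp

/-- An elementary instruction. -/
def ofElem (p : Prog) (h : ∀ k v, p.exec (k, v) =
    spend (p.elemCost v) k >>= fun k₀ => p.elem v >>= fun w => pure (k₀, w))
    (htr : ∀ v, (p.elem v).trace = tr v) : QPT :=
  ofEval p (Polynomial.X + 1) p.elem (eval_of_elem h) htr

def skip : QPT := ofElem .skip (fun _ _ => by simp only [Prog.exec])
  fun v => by simp [Prog.elem, Mix.trace]

def swap : QPT := ofElem .swap (fun _ _ => by simp only [Prog.exec])
  fun v => by cases v <;> simp [Prog.elem, Mix.trace, mul_comm]

def assoc : QPT := ofElem .assoc (fun _ _ => by simp only [Prog.exec])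
  fun v => by
    rcases v with _ | _ | _ | ⟨_ | _ | _ | _, _⟩ <;> simp [Prog.elem, Mix.trace, mul_assoc]

def addNil : QPT := ofElem .addNil (fun _ _ => by simp only [Prog.exec])
  fun v => by simp [Prog.elem, Mix.trace]

def remNil : QPT := ofElem .remNil (fun _ _ => by simp only [Prog.exec])
  fun v => by rcases v with _ | _ | _ | ⟨_ | _ | _ | _, _⟩ <;> simp [Prog.elem, Mix.trace]

def const (b : Bool) : QPT := ofElem (.const b) (fun _ _ => by simp only [Prog.exec])
  fun v => by cases v <;> simp [Prog.elem, Mix.trace]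

def dup : QPT := ofElem .dup (fun _ _ => by simp only [Prog.exec])
  fun v => by
    simp only [Prog.elem]
    split_ifs with h
    · simp [Mix.trace, h.tr_eq]
    · simp [Mix.trace]

def discard : QPT := ofElem .discard (fun _ _ => by simp only [Prog.exec])
  fun v => by
    simp only [Prog.elem, drop_eq, Mix.smul_bind, LawfulMonad.pure_bind]
    simp [Mix.trace]

def measure : QPT := ofElem .measure (fun _ _ => by simp only [Prog.exec])
  fun v => by simp [Prog.elem, Mix.trace, measure_eq, (isClassical_outcome v).tr_eq]

theorem run_ofElem {p : Prog} (h : ∀ k v, p.exec (k, v) =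
    spend (p.elemCost v) k >>= fun k₀ => p.elem v >>= fun w => pure (k₀, w))
    (htr : ∀ v, (p.elem v).trace = tr v) (v : Data) : (ofElem p h htr).run v = p.elem v :=
  run_ofEval ..

theorem run_skip (v : Data) : skip.run v = pure v := (run_ofElem ..).trans rfl

theorem run_swap (a b : Data) : swap.run (a ⋆ b) = pure (b ⋆ a) := (run_ofElem ..).trans rfl

theorem run_assoc (a b c : Data) : assoc.run ((a ⋆ b) ⋆ c) = pure (a ⋆ b ⋆ c) := (run_ofElem ..).trans rfl

theorem run_addNil (v : Data) : addNil.run v = pure (nil ⋆ v) := (run_ofElem ..).trans rfl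

theorem run_remNil (v : Data) : remNil.run (nil ⋆ v) = pure v := (run_ofElem ..).trans rfl

theorem run_const (b : Bool) : (const b).run nil = pure (bit b) := (run_ofElem ..).trans rfl

theorem run_dup {v : Data} (h : v.IsClassical) : dup.run v = pure (v ⋆ v) :=
  (run_ofElem ..).trans (if_pos h)

theorem run_discard (v : Data) : discard.run v = v.drop >>= fun _ => pure nil := (run_ofElem ..).trans rfl

theorem run_measure (v : Data) : measure.run v = v.measure := (run_ofElem ..).trans rfl

/-- First `A`, then `B`. -/
def seq (A B : QPT) : QPT :=
  -- `B` receives a datum of size at most `|v|` plus twice the running time of `A`.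
  ofEval (.seq A.prog B.prog) (A.time + B.time.comp (Polynomial.X + 2 * A.time))
    (fun v => A.run v >>= B.run)
    (fun v => by
      have := (A.eval v).bind A.prog.bounded_exec (ν := B.run) (g := B.prog.exec) fun w hw =>
        (B.eval w).mono (polynomial_eval_mono B.time hw)
      have hexec : (Prog.seq A.prog B.prog).exec = fun s => A.prog.exec s >>= B.prog.exec :=
        funext fun s => by simp only [Prog.exec]
      rw [hexec]
      simpa [Polynomial.eval_comp] using this)
    fun v => by rw [Mix.trace_bind_of B.trace_run, A.trace_run]

theorem run_seq (A B : QPT) (v : Data) : (A.seq B).run v = A.run v >>= B.run := (run_ofEval ..).trans rfl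

/-- The action of `par`. -/
def parMap (A B : QPT) : Data → Mix Data
  | a ⋆ b => A.run a >>= fun a' => B.run b >>= fun b' => pure (a' ⋆ b')
  | v => pure v

theorem eval_par (A B : QPT) (v : Data) : Eval (Prog.par A.prog B.prog).exec v
    (1 + (A.time.eval v.size + B.time.eval v.size)) (parMap A B v) := by
  rw [funext (Prog.exec_par A.prog B.prog)]
  refine Eval.charge_bind ?_ fun _ => 1
  cases v with
  | pair a b =>
    exact ((A.eval a).mono (polynomial_eval_mono A.time (by simp only [size]; omega))).parStep
      ((B.eval b).mono (polynomial_eval_mono B.time (by simp only [size]; omega)))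
  | _ => exact (Eval.pure _).mono (Nat.zero_le _)

theorem trace_parMap (A B : QPT) (v : Data) : (parMap A B v).trace = tr v := by
  cases v with
  | pair a b =>
    have h : ∀ a', (B.run b >>= fun b' => pure (a' ⋆ b')).expect tr = tr a' * tr b := fun a' => by
      rw [Mix.expect_bind]
      simp only [Mix.expect_pure, tr_pair]
      rw [Mix.expect_mul_left, ← B.trace_run b, Mix.trace]
    rw [parMap, Mix.trace, Mix.expect_bind]
    simp only [h]
    rw [Mix.expect_mul_right, tr_pair, ← A.trace_run a, Mix.trace]
  | _ => simp [parMap, Mix.trace]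

/-- Run `A` and `B` on the components of a pair. -/
def par (A B : QPT) : QPT :=
  ofEval (.par A.prog B.prog) (1 + (A.time + B.time)) (parMap A B)
    (fun v => by simpa using eval_par A B v) (trace_parMap A B)

theorem run_par (A B : QPT) (a b : Data) : (A.par B).run (a ⋆ b) =
    A.run a >>= fun a' => B.run b >>= fun b' => pure (a' ⋆ b') := (run_ofEval ..).trans rfl

/-- The action of `cond`. -/
def condMap (A B : QPT) : Data → Mix Data
  | bit b ⋆ w => if b then A.run w else B.run w
  | v => pure v

/-- Branch on the first component of a pair. -/
def cond (A B : QPT) : QPT :=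
  ofEval (.cond A.prog B.prog) (1 + (A.time + B.time)) (condMap A B)
    (fun v => by
      rw [funext (Prog.exec_cond A.prog B.prog)]
      simp only [Polynomial.eval_add, Polynomial.eval_one]
      have : Eval (condStep A.prog.exec B.prog.exec) v (A.time.eval v.size + B.time.eval v.size)
          (condMap A B v) := by
        rcases v with _ | _ | _ | ⟨_ | b | _ | _, w⟩
        case pair.bit =>
          have h : w.size ≤ (bit b ⋆ w).size := by simp only [size]; omega
          cases b
          · exact (B.eval w).mono ((polynomial_eval_mono B.time h).trans (Nat.le_add_left _ _))
          · exact (A.eval w).mono ((polynomial_eval_mono A.time h).trans (Nat.le_add_right _ _))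
        all_goals exact (Eval.pure _).mono (Nat.zero_le _)
      exact this.charge_bind fun _ => 1)
    fun v => by
      rcases v with _ | _ | _ | ⟨_ | b | _ | _, w⟩
      case pair.bit => cases b <;> simp [condMap, trace_run]
      all_goals simp [condMap, Mix.trace]

theorem run_cond (A B : QPT) (b : Bool) (w : Data) :
    (A.cond B).run (bit b ⋆ w) = if b then A.run w else B.run w := (run_ofEval ..).trans rfl

/-- The action of `shape`. -/
def shapeMap (A B C D : QPT) : Data → Mix Data
  | nil => A.run nil
  | bit b => B.run (bit b)
  | qubit i j => C.run (qubit i j)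
  | a ⋆ b => D.run (a ⋆ b)

/-- Branch on the root of a datum. -/
def shape (A B C D : QPT) : QPT :=
  ofEval (.shape A.prog B.prog C.prog D.prog) (1 + (A.time + B.time + C.time + D.time))
    (shapeMap A B C D)
    (fun v => by
      rw [funext (Prog.exec_shape A.prog B.prog C.prog D.prog)]
      simp only [Polynomial.eval_add, Polynomial.eval_one]
      have : Eval (shapeStep A.prog.exec B.prog.exec C.prog.exec D.prog.exec) v
          (A.time.eval v.size + B.time.eval v.size + C.time.eval v.size + D.time.eval v.size)
          (shapeMap A B C D v) := by
        cases v
        · exact (A.eval _).mono (by omega)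
        · exact (B.eval _).mono (by omega)
        · exact (C.eval _).mono (by omega)
        · exact (D.eval _).mono (by omega)
      exact this.charge_bind fun _ => 1)
    fun v => by cases v <;> simp [shapeMap, trace_run]

theorem run_shape (A B C D : QPT) (v : Data) :
    (shape A B C D).run v = shapeMap A B C D v := (run_ofEval ..).trans rfl

end QPT

/-! ### Wiring -/

@[simp] theorem isClassical_nil : nil.IsClassical := trivial

@[simp] theorem isClassical_bit (b : Bool) : (bit b).IsClassical := trivial

@[simp] theorem isClassical_pair {a b : Data} :
    (a ⋆ b).IsClassical ↔ a.IsClassical ∧ b.IsClassical := Iff.rfl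

@[simp] theorem isClassical_unary (n : ℕ) : (unary n).IsClassical := by
  induction n with
  | zero => trivial
  | succ n ih => exact ⟨trivial, ih⟩

@[simp] theorem isClassical_ofSet (S : Finset Bool) : (ofSet S).IsClassical := ⟨trivial, trivial⟩

@[simp] theorem unpair_pair (a b : Data) : (a ⋆ b).unpair = pure (a, b) := rfl

namespace QPT

attribute [simp] run_skip run_swap run_assoc run_addNil run_remNil run_const run_dup run_seq run_par
  run_cond

theorem run_discard_classical {v : Data} (h : v.IsClassical) : discard.run v = pure nil := by
  rw [run_discard, h.drop_eq, LawfulMonad.pure_bind]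

/-- The first component of a pair. -/
def fst : QPT := (par skip discard).seq (swap.seq remNil)

/-- The second component of a pair. -/
def snd : QPT := (par discard skip).seq remNil

theorem run_fst_eq (a b : Data) : fst.run (a ⋆ b) = b.drop >>= fun _ => pure a := by
  simp [fst, run_discard, -bind_pure_comp]

@[simp] theorem run_fst (a : Data) {b : Data} (h : b.IsClassical) : fst.run (a ⋆ b) = pure a := by
  rw [run_fst_eq, h.drop_eq, LawfulMonad.pure_bind]

@[simp] theorem run_snd {a : Data} (b : Data) (h : a.IsClassical) : snd.run (a ⋆ b) = pure b := by
  simp [snd, run_discard_classical h, -bind_pure_comp]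

/-- Run two algorithms on copies of a classical input. -/
def fork (A B : QPT) : QPT := dup.seq (par A B)

@[simp] theorem run_fork (A B : QPT) {v : Data} (h : v.IsClassical) :
    (fork A B).run v = A.run v >>= fun a => B.run v >>= fun b => pure (a ⋆ b) := by
  simp [fork, h, -bind_pure_comp]

/-- The output `bit b`, for every input. -/
def constant (b : Bool) : QPT := discard.seq (const b)

@[simp] theorem run_constant (b : Bool) {v : Data} (h : v.IsClassical) :
    (constant b).run v = pure (bit b) := by
  simp [constant, run_discard_classical h]

/-- `v ↦ (bit b, v)` -/
def consBit (b : Bool) : QPT := addNil.seq (par (const b) skip)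

@[simp] theorem run_consBit (b : Bool) (v : Data) : (consBit b).run v = pure (bit b ⋆ v) := by
  simp [consBit, -bind_pure_comp]

/-- `v ↦ (v, bit b)` -/
def snocBit (b : Bool) : QPT := (consBit b).seq swap

@[simp] theorem run_snocBit (b : Bool) (v : Data) : (snocBit b).run v = pure (v ⋆ bit b) := by
  simp [snocBit]

/-- `(a, (b, c)) ↦ ((a, b), c)` -/
def assocInv : QPT := swap.seq (assoc.seq (swap.seq (assoc.seq swap)))

@[simp] theorem run_assocInv (a b c : Data) : assocInv.run (a ⋆ b ⋆ c) = pure ((a ⋆ b) ⋆ c) := by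
  simp [assocInv]

/-- `((a, b), (c, d)) ↦ ((a, c), (b, d))` -/
def exchange : QPT :=
  assoc.seq ((par skip (assocInv.seq ((par swap skip).seq assoc))).seq assocInv)

@[simp] theorem run_exchange (a b c d : Data) :
    exchange.run ((a ⋆ b) ⋆ c ⋆ d) = pure ((a ⋆ c) ⋆ b ⋆ d) := by
  simp [exchange, -bind_pure_comp]

/-- Component number `k` of an iterated pair. -/
def item : ℕ → QPT
  | 0 => fst
  | k + 1 => snd.seq (item k)

/-- An iterated pair without its first `k` components. -/
def tail : ℕ → QPT
  | 0 => skip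
  | k + 1 => snd.seq (tail k)

end QPT

/-! ### Patterns -/

/-- Patterns for classical data. -/
inductive Pat : Type
  | any : Pat
  | bit (b : Bool) : Pat
  | pair (p q : Pat) : Pat

/-- Does the datum have the form of the pattern? -/
def Pat.matches : Pat → Data → Bool
  | any, _ => true
  | bit b, .bit c => b == c
  | pair p q, a ⋆ b => p.matches a && q.matches b
  | _, _ => false

namespace QPT

/-- The negation of a bit. -/
def not : QPT := addNil.seq (swap.seq (cond (const false) (const true)))

@[simp] theorem run_not (b : Bool) : not.run (bit b) = pure (bit (!b)) := by
  cases b <;> simp [not]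

/-- Test whether the input has the form of a pattern. -/
def test : Pat → QPT
  | .any => constant true
  | .bit b => shape (constant false) (if b then skip else not) (constant false) (constant false)
  | .pair p q => shape (constant false) (constant false) (constant false)
      ((par (test p) (test q)).seq (cond skip (constant false)))

@[simp] theorem run_test (p : Pat) {v : Data} (h : v.IsClassical) :
    (test p).run v = pure (bit (p.matches v)) := by
  induction p generalizing v with
  | any => simp [test, Pat.matches, h]
  | bit b =>
    cases v
    case bit c => cases b <;> cases c <;> simp [test, run_shape, shapeMap, Pat.matches]
    case qubit i j => exact h.elim
    all_goals simp only [test, run_shape, shapeMap, Pat.matches, run_constant _ h]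
  | pair p q hp hq =>
    cases v
    case pair a b =>
      simp only [test, run_shape, shapeMap, run_seq, run_par, hp h.1, hq h.2, Pat.matches,
        LawfulMonad.pure_bind, run_cond]
      cases p.matches a <;> simp
    case qubit i j => exact h.elim
    all_goals simp only [test, run_shape, shapeMap, Pat.matches, run_constant _ h]

/-- Branch according to a pattern. -/
def ite (p : Pat) (A B : QPT) : QPT := (fork (test p) skip).seq (cond A B)

@[simp] theorem run_ite (p : Pat) (A B : QPT) {v : Data} (h : v.IsClassical) :
    (ite p A B).run v = if p.matches v then A.run v else B.run v := by
  simp [ite, h]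

/-! ### Normalisation of malformed keys -/

/-- Turn every datum into a pair of a bit and a datum. -/
def normKey : QPT :=
  shape (discard.seq (consBit true)) (discard.seq (consBit true)) (discard.seq (consBit true))
    (par (shape (constant true) skip (constant true) (constant true)) skip)

@[simp] theorem run_normKey (b : Bool) (v : Data) :
    normKey.run (bit b ⋆ v) = pure (bit b ⋆ v) := by
  simp [normKey, run_shape, shapeMap, -bind_pure_comp]

theorem supp_constant (b : Bool) (v : Data) :
    ((constant b).run v).Supp fun d => d = bit b := by
  rw [constant, run_seq, run_discard, bind_assoc]
  refine (Mix.supp_true _).bind fun _ _ => ?_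
  rw [LawfulMonad.pure_bind, run_const]
  exact Mix.supp_pure rfl

theorem supp_normKey (v : Data) : (normKey.run v).Supp fun d => ∃ b w, d = bit b ⋆ w := by
  have h : ∀ v, ((discard.seq (consBit true)).run v).Supp fun d => ∃ b w, d = bit b ⋆ w := by
    intro v
    rw [run_seq]
    refine (Mix.supp_true _).bind fun _ _ => ?_
    rw [run_consBit]
    exact Mix.supp_pure ⟨_, _, rfl⟩
  rw [normKey, run_shape]
  cases v with
  | pair a b =>
    rw [shapeMap, run_par]
    refine Mix.Supp.bind (P := fun d => ∃ b, d = bit b) ?_ ?_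
    · rw [run_shape]
      cases a with
      | bit c => rw [shapeMap, run_skip]; exact Mix.supp_pure ⟨c, rfl⟩
      | _ => exact (supp_constant _ _).mono fun d hd => ⟨_, hd⟩
    · rintro _ ⟨c, rfl⟩
      rw [run_skip, LawfulMonad.pure_bind]
      exact Mix.supp_pure ⟨_, _, rfl⟩
  | _ => exact h _

/-- Turn every datum into a pair. -/
def normPair : QPT :=
  shape (discard.seq addNil) (discard.seq addNil) (discard.seq addNil) skip

@[simp] theorem run_normPair (a b : Data) : normPair.run (a ⋆ b) = pure (a ⋆ b) := by
  simp [normPair, run_shape, shapeMap]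

theorem supp_normPair (v : Data) : (normPair.run v).Supp fun d => ∃ a b, d = a ⋆ b := by
  have h : ∀ v, ((discard.seq addNil).run v).Supp fun d => ∃ a b, d = a ⋆ b := by
    intro v
    rw [run_seq]
    refine (Mix.supp_true _).bind fun _ _ => ?_
    rw [run_addNil]
    exact Mix.supp_pure ⟨_, _, rfl⟩
  rw [normPair, run_shape]
  cases v with
  | pair a b => rw [shapeMap, run_skip]; exact Mix.supp_pure ⟨_, _, rfl⟩
  | _ => exact h _

end QPT

namespace TwoTierOSS

open QPT

variable (O : TwoTierOSS)

/-! ### The algorithms of the construction -/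

/-- The input `(1ⁿ, pp)` is classical and may be copied for two independent runs; `exchange` gathers
the signing keys on the left, where they receive the tag of an unused key. -/
def pairKeyGen : QPT := (fork O.keyGen O.keyGen).seq (exchange.seq (par (consBit false) skip))

/-- Sign the fixed message `b`: `(1ⁿ, sigk) ↦ σ`. -/
def signBit (b : Bool) : QPT := (snocBit b).seq (assoc.seq O.sign)

@[simp] theorem run_signBit (b : Bool) (n s : Data) :
    (O.signBit b).run (n ⋆ s) = O.sign.run (n ⋆ s ⋆ bit b) := by
  simp [signBit]

/-- `(1ⁿ, (s, s')) ↦ (usedKey b s', σ)` where `σ` signs `0` under the key `s`. -/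
def useKey (b : Bool) : QPT :=
  assocInv.seq ((par (O.signBit false) skip).seq
    (swap.seq (par ((consBit b).seq (consBit true)) skip)))

@[simp] theorem run_useKey (b : Bool) (n s s' : Data) : (O.useKey b).run (n ⋆ s ⋆ s') =
    O.sign.run (n ⋆ s ⋆ bit false) >>= fun σ => pure (usedKey b s' ⋆ σ) := by
  simp [useKey, usedKey, -bind_pure_comp]

/-- The signing algorithm, on `((s, s'), (m, 1ⁿ))`. -/
def signFresh : QPT :=
  (par normPair skip).seq (swap.seq (assoc.seq
    (cond ((par skip swap).seq (O.useKey false)) (O.useKey true))))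

/-- The parameters are dropped, the key is put into tagged form, and the tag is brought to the front
as a control bit. A used key is not asked to sign again: it yields `(nil, nil)`. -/
def pairSign : QPT :=
  (par skip snd).seq ((par skip (par normKey skip)).seq (swap.seq (assoc.seq (assoc.seq
    (cond (discard.seq addNil) O.signFresh)))))

/-- Two patterns, one per message, select the verification key. A key that is not a pair is
rejected. -/
def pairVer : QPT :=
  ite (.pair .any (.pair .any (.pair (.pair .any .any) (.pair (.bit false) .any))))
    ((fork (item 0) (fork (item 1) (fork ((item 2).seq fst) (tail 4)))).seq O.ver₀)
    (ite (.pair .any (.pair .any (.pair (.pair .any .any) (.pair (.bit true) .any))))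
      ((fork (item 0) (fork (item 1) (fork ((item 2).seq snd) (tail 4)))).seq O.ver₀)
      (constant false))

/-- Deletion of a fresh key, on `((s₀, s₁), 1ⁿ)`. -/
def delFresh : QPT :=
  (par normPair dup).seq (exchange.seq
    ((par (swap.seq (O.signBit true)) (swap.seq (O.signBit true))).seq
      ((consBit true).seq (consBit false))))

/-- Deletion of a used key, on `((b, s), 1ⁿ)`. -/
def delUsed : QPT := (par normKey skip).seq (assoc.seq (par skip (swap.seq (O.signBit true))))

def pairDel : QPT :=
  (par skip normKey).seq (swap.seq (assoc.seq (cond O.delUsed O.delFresh)))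

/-- Verify with `ver₁`; the key and the signature are computed by `A` and `B`. -/
def certVer (A B : QPT) : QPT :=
  (fork (item 0) (fork (item 1) (fork (item 3) (fork ((item 2).seq A) ((item 4).seq B))))).seq O.ver₁

/-- The form of the input of the certificate check, for a given form of the certificate and a given
set. -/
def certPat (c : Pat) (s t : Bool) : Pat :=
  .pair .any (.pair .any (.pair (.pair .any .any) (.pair .any (.pair c (.pair (.bit s) (.bit t))))))

/-- The last two arguments of `certPat` are the membership bits of `0` and `1`. Thus `(false, true)`
is `S = {1}`, which requires a certificate for key `0`; the two-element set matches no pattern. -/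
def pairCertAlg : QPT :=
  ite (certPat (.pair (.bit false) (.pair (.bit true) (.pair .any .any))) false false)
    ((fork (O.certVer fst (item 2)) (O.certVer snd (tail 3))).seq (cond skip (constant false)))
    (ite (certPat (.pair (.bit false) .any) false true) (O.certVer fst snd)
      (ite (certPat (.pair (.bit true) .any) true false) (O.certVer snd snd) (constant false)))

/-! ### Their outputs -/

theorem run_pairKeyGen (n : ℕ) {pp : Data} (hpp : pp.IsClassical) :
    O.pairKeyGen.run (unary n ⋆ pp) = (do
      let (s₀, v₀) ← (← O.keyGen.run (unary n ⋆ pp)).unpair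
      let (s₁, v₁) ← (← O.keyGen.run (unary n ⋆ pp)).unpair
      pure (freshKey s₀ s₁ ⋆ v₀ ⋆ v₁)) := by
  simp only [pairKeyGen, run_seq, run_fork _ _ (show (unary n ⋆ pp).IsClassical by simp [hpp]),
    bind_assoc]
  refine Mix.bind_congr_supp fun a ha => ?_
  obtain ⟨s₀, v₀, -, rfl⟩ := O.keyGen_out n pp hpp a ha
  rw [unpair_pair, LawfulMonad.pure_bind]
  refine Mix.bind_congr_supp fun b hb => ?_
  obtain ⟨s₁, v₁, -, rfl⟩ := O.keyGen_out n pp hpp b hb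
  simp [freshKey, -bind_pure_comp]

theorem run_pairSign (n : ℕ) {pp : Data} (hpp : pp.IsClassical) (s₀ s₁ : Data) (m : Bool) :
    O.pairSign.run (unary n ⋆ pp ⋆ freshKey s₀ s₁ ⋆ bit m) = (do
      let σ ← O.sign.run (unary n ⋆ (if m then s₁ else s₀) ⋆ bit false)
      pure (usedKey (!m) (if m then s₀ else s₁) ⋆ σ)) := by
  simp only [pairSign, freshKey, signFresh]
  cases m <;> simp [hpp, -bind_pure_comp]

theorem run_pairVer (n : ℕ) {pp v₀ v₁ σ : Data} (m : Bool) (hpp : pp.IsClassical)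
    (h₀ : v₀.IsClassical) (h₁ : v₁.IsClassical) (hσ : σ.IsClassical) :
    O.pairVer.run (unary n ⋆ pp ⋆ (v₀ ⋆ v₁) ⋆ bit m ⋆ σ) =
      O.ver₀.run (unary n ⋆ pp ⋆ (if m then v₁ else v₀) ⋆ σ) := by
  cases m <;> simp [pairVer, Pat.matches, item, tail, hpp, h₀, h₁, hσ, -bind_pure_comp]

theorem run_pairVer_malformed (n : ℕ) {pp vk σ : Data} (m : Bool) (hpp : pp.IsClassical)
    (hvk : vk.IsClassical) (hσ : σ.IsClassical) (h : ∀ v₀ v₁, vk ≠ v₀ ⋆ v₁) :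
    O.pairVer.run (unary n ⋆ pp ⋆ vk ⋆ bit m ⋆ σ) = pure (bit false) := by
  cases vk
  case pair a b => exact (h a b rfl).elim
  all_goals simp_all [pairVer, Pat.matches, -bind_pure_comp]

theorem run_pairDel_fresh (n : ℕ) (s₀ s₁ : Data) : O.pairDel.run (unary n ⋆ freshKey s₀ s₁) = (do
    let σ₀ ← O.sign.run (unary n ⋆ s₀ ⋆ bit true)
    let σ₁ ← O.sign.run (unary n ⋆ s₁ ⋆ bit true)
    pure (bit false ⋆ bit true ⋆ σ₀ ⋆ σ₁)) := by
  simp [pairDel, freshKey, delFresh, -bind_pure_comp]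

theorem run_pairDel_used (n : ℕ) (b : Bool) (s : Data) :
    O.pairDel.run (unary n ⋆ usedKey b s) = (do
      let σ ← O.sign.run (unary n ⋆ s ⋆ bit true)
      pure (bit b ⋆ σ)) := by
  simp [pairDel, usedKey, delUsed, -bind_pure_comp]

theorem run_certVer (A B : QPT) (n : ℕ) {pp vk sk c S v σ : Data} (hpp : pp.IsClassical)
    (hvk : vk.IsClassical) (hsk : sk.IsClassical) (hc : c.IsClassical) (hS : S.IsClassical)
    (hA : A.run vk = pure v) (hB : B.run c = pure σ) :
    (O.certVer A B).run (unary n ⋆ pp ⋆ vk ⋆ sk ⋆ c ⋆ S) =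
      O.ver₁.run (unary n ⋆ pp ⋆ sk ⋆ v ⋆ σ) := by
  simp [certVer, item, hpp, hvk, hsk, hc, hS, hA, hB, -bind_pure_comp]

end TwoTierOSS

/-! ### The certificate check, the form of all outputs, and the assembled scheme -/

namespace TwoTierOSS

open QPT

variable (O : TwoTierOSS)

theorem run_pairCertAlg (n : ℕ) {pp v₀ v₁ sk c : Data} (S : Finset Bool) (hpp : pp.IsClassical)
    (h₀ : v₀.IsClassical) (h₁ : v₁.IsClassical) (hsk : sk.IsClassical) (hc : c.IsClassical) :
    O.pairCertAlg.run (unary n ⋆ pp ⋆ (v₀ ⋆ v₁) ⋆ sk ⋆ c ⋆ ofSet S) =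
      pairCert O n pp v₀ v₁ sk c S := by
  have hvk : (v₀ ⋆ v₁).IsClassical := ⟨h₀, h₁⟩
  have hall : (unary n ⋆ pp ⋆ (v₀ ⋆ v₁) ⋆ sk ⋆ c ⋆ ofSet S).IsClassical := by
    simp [hpp, h₀, h₁, hsk, hc]
  have hfst : fst.run (v₀ ⋆ v₁) = pure v₀ := run_fst _ h₁
  have hsnd : snd.run (v₀ ⋆ v₁) = pure v₁ := run_snd _ h₀
  rw [pairCertAlg, run_ite _ _ _ hall, run_ite _ _ _ hall, run_ite _ _ _ hall,
    run_constant _ hall]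
  have hS : S = ∅ ∨ S = {false} ∨ S = {true} ∨ S = {false, true} := by
    clear hall
    revert S; decide
  have key : ∀ (s t : Bool) (p : Pat), (certPat p s t).matches
      (unary n ⋆ pp ⋆ (v₀ ⋆ v₁) ⋆ sk ⋆ c ⋆ ofSet S) =
        (p.matches c && (decide (false ∈ S) == s && decide (true ∈ S) == t)) := by
    intro s t p
    simp only [certPat, Pat.matches, ofSet, Bool.true_and]
    congr 2 <;> exact Bool.beq_comm
  simp only [key]
  by_cases hS0 : S = ∅
  · unfold pairCert
    rw [if_pos hS0]
    subst hS0
    rcases c with _ | _ | _ | ⟨_ | a | _ | _, _ | _ | _ | ⟨_ | b | _ | _, _ | _ | _ | ⟨σ₀, σ₁⟩⟩⟩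
    case pair.bit.pair.bit.pair =>
      cases a <;> cases b
      case false.true =>
        simp only [Pat.matches, Finset.notMem_empty, decide_false, BEq.rfl, Bool.and_self, if_true]
        simp only [isClassical_pair] at hc
        rw [run_seq, run_fork _ _ hall,
          O.run_certVer _ _ n hpp hvk hsk (by simp [hc]) (isClassical_ofSet _) hfst
            (show _ = pure σ₀ by simp [item, hc, -bind_pure_comp]),
          O.run_certVer _ _ n hpp hvk hsk (by simp [hc]) (isClassical_ofSet _) hsnd
            (show _ = pure σ₁ by simp [tail, hc, -bind_pure_comp]), bind_assoc]
        -- Branching on the first answer agrees with the conjunction of `accepts` because `ver₁`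
        -- outputs bits.
        refine Mix.bind_congr_supp fun a ha => ?_
        obtain ⟨x, rfl⟩ := O.ver₁_out n pp sk v₀ σ₀ hpp hsk h₀ hc.2.2.1 a ha
        rw [bind_assoc]
        refine Mix.bind_congr_supp fun b hb => ?_
        obtain ⟨y, rfl⟩ := O.ver₁_out n pp sk v₁ σ₁ hpp hsk h₁ hc.2.2.2 b hb
        cases x <;> simp [accepts]
      all_goals simp [Pat.matches]
    all_goals simp [Pat.matches]
  · unfold pairCert
    rw [if_neg hS0]
    rcases c with _ | _ | _ | ⟨_ | b | _ | _, σ⟩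
    case pair.bit =>
      have hc' := hc
      simp only [isClassical_pair] at hc'
      have hσ : snd.run (bit b ⋆ σ) = pure σ := run_snd _ hc'.1
      rw [O.run_certVer _ _ n hpp hvk hsk hc (isClassical_ofSet _) hfst hσ,
        O.run_certVer _ _ n hpp hvk hsk hc (isClassical_ofSet _) hsnd hσ]
      rcases hS with rfl | rfl | rfl | rfl
      · exact (hS0 rfl).elim
      all_goals cases b <;> simp [Pat.matches]
      all_goals first | done | exact fun h => absurd h (by decide)
    all_goals simp [Pat.matches]

/-- The scheme must return a pair with classical signature even for a malformed key. After `normKey`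
and `normPair` only well-formed cases remain. -/
theorem supp_pairSign (n : ℕ) {pp : Data} (sigk : Data) (m : Bool) (hpp : pp.IsClassical) :
    (O.pairSign.run (unary n ⋆ pp ⋆ sigk ⋆ bit m)).Supp
      fun d => ∃ sigk' σ : Data, σ.IsClassical ∧ d = sigk' ⋆ σ := by
  simp only [pairSign, run_seq, run_par, run_skip, run_snd _ hpp, LawfulMonad.pure_bind, bind_assoc]
  refine (supp_normKey sigk).bind ?_
  rintro _ ⟨t, r, rfl⟩
  simp only [run_seq, LawfulMonad.pure_bind, run_swap, run_assoc, run_cond]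
  cases t
  · simp only [Bool.false_eq_true, if_false, signFresh, run_seq, run_par, run_skip,
      LawfulMonad.pure_bind, bind_assoc]
    refine (supp_normPair r).bind ?_
    rintro _ ⟨a, b, rfl⟩
    simp only [run_seq, LawfulMonad.pure_bind, run_swap, run_assoc, run_cond]
    cases m
    · simp only [Bool.false_eq_true, if_false, run_useKey]
      exact Mix.Supp.bind (O.sign_out n a false) fun σ hσ => Mix.supp_pure ⟨_, _, hσ, rfl⟩
    · simp only [if_true, run_par, run_skip, run_swap, LawfulMonad.pure_bind, run_useKey]
      exact Mix.Supp.bind (O.sign_out n b false) fun σ hσ => Mix.supp_pure ⟨_, _, hσ, rfl⟩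
  · simp only [if_true, run_discard, bind_assoc]
    refine (Mix.supp_true _).bind fun _ _ => ?_
    rw [LawfulMonad.pure_bind, run_addNil]
    exact Mix.supp_pure ⟨_, _, isClassical_nil, rfl⟩

theorem supp_pairDel (n : ℕ) (sigk : Data) :
    (O.pairDel.run (unary n ⋆ sigk)).Supp Data.IsClassical := by
  simp only [pairDel, run_seq, run_par, run_skip, LawfulMonad.pure_bind, bind_assoc]
  refine (supp_normKey sigk).bind ?_
  rintro _ ⟨t, r, rfl⟩
  simp only [run_seq, LawfulMonad.pure_bind, run_swap, run_assoc, run_cond]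
  cases t
  · simp only [Bool.false_eq_true, if_false, delFresh, run_seq, run_par,
      run_dup (isClassical_unary n), LawfulMonad.pure_bind, bind_assoc]
    refine (supp_normPair r).bind ?_
    rintro _ ⟨a, b, rfl⟩
    simp only [run_seq, LawfulMonad.pure_bind, run_exchange, run_par, run_swap, run_signBit,
      bind_assoc, run_consBit]
    exact Mix.Supp.bind (O.sign_out n a true) fun σ hσ =>
      Mix.Supp.bind (O.sign_out n b true) fun σ' hσ' => Mix.supp_pure ⟨trivial, trivial, hσ, hσ'⟩
  · simp only [if_true, delUsed, run_seq, run_par, run_skip, LawfulMonad.pure_bind, bind_assoc]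
    refine (supp_normKey r).bind ?_
    rintro _ ⟨b, s, rfl⟩
    simp only [LawfulMonad.pure_bind, run_assoc, run_par, run_skip, run_seq, run_swap, run_signBit]
    exact Mix.Supp.bind (O.sign_out n s true) fun σ hσ => Mix.supp_pure ⟨trivial, hσ⟩

theorem supp_pairVer (n : ℕ) (pp vk : Data) (m : Bool) (σ : Data) (hpp : pp.IsClassical)
    (hvk : vk.IsClassical) (hσ : σ.IsClassical) :
    (O.pairVer.run (unary n ⋆ pp ⋆ vk ⋆ bit m ⋆ σ)).Supp fun d => ∃ b, d = bit b := by
  by_cases h : ∃ v₀ v₁, vk = v₀ ⋆ v₁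
  · obtain ⟨v₀, v₁, rfl⟩ := h
    rw [O.run_pairVer n m hpp hvk.1 hvk.2 hσ]
    exact O.ver₀_out n pp _ σ hpp (by cases m; exacts [hvk.1, hvk.2]) hσ
  · rw [O.run_pairVer_malformed n m hpp hvk hσ fun v₀ v₁ h' => h ⟨v₀, v₁, h'⟩]
    exact Mix.supp_pure ⟨_, rfl⟩

theorem supp_pairCertAlg (n : ℕ) (pp vk ck c : Data) (S : Finset Bool) (hpp : pp.IsClassical)
    (hvk : vk.IsClassical) (hck : ck.IsClassical) (hc : c.IsClassical) :
    (O.pairCertAlg.run (unary n ⋆ pp ⋆ vk ⋆ ck ⋆ c ⋆ ofSet S)).Supp fun d => ∃ b, d = bit b := by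
  by_cases h : ∃ v₀ v₁, vk = v₀ ⋆ v₁
  · obtain ⟨v₀, v₁, rfl⟩ := h
    rw [O.run_pairCertAlg n S hpp hvk.1 hvk.2 hck hc]
    unfold pairCert
    split_ifs with hS
    · split
      · exact (Mix.supp_true _).bind fun _ _ => (Mix.supp_true _).bind fun _ _ =>
          Mix.supp_pure ⟨_, rfl⟩
      · exact Mix.supp_pure ⟨_, rfl⟩
    · split
      · split_ifs
        · exact O.ver₁_out n pp ck v₁ _ hpp hck hvk.2 hc.2
        · exact O.ver₁_out n pp ck v₀ _ hpp hck hvk.1 hc.2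
        · exact Mix.supp_pure ⟨_, rfl⟩
      · exact Mix.supp_pure ⟨_, rfl⟩
  · have : O.pairCertAlg.run (unary n ⋆ pp ⋆ vk ⋆ ck ⋆ c ⋆ ofSet S) = pure (bit false) := by
      cases vk
      case pair a b => exact (h ⟨a, b, rfl⟩).elim
      all_goals
        simp_all [pairCertAlg, certPat, Pat.matches, -bind_pure_comp]
    rw [this]
    exact Mix.supp_pure ⟨_, rfl⟩

theorem run_pairSetup (n : ℕ) : (O.setup.seq swap).run (unary n) = (do
    let (pp, sk) ← (← O.setup.run (unary n)).unpair
    pure (sk ⋆ pp)) := by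
  rw [run_seq]
  refine Mix.bind_congr_supp fun d hd => ?_
  obtain ⟨pp, sk, -, -, rfl⟩ := O.setup_out n d hd
  rw [run_swap, unpair_pair, LawfulMonad.pure_bind]

/-- Signatures with revocable signing keys from two keys of a two-tier one-shot signature scheme. -/
def pairScheme : DSRKey where
  setup := O.setup.seq swap
  keyGen := O.pairKeyGen
  sign := O.pairSign
  ver := O.pairVer
  del := O.pairDel
  cert := O.pairCertAlg
  setup_out n := by
    show Mix.Supp _ _
    rw [run_seq]
    refine Mix.Supp.bind (O.setup_out n) ?_
    rintro _ ⟨pp, sk, hpp, hsk, rfl⟩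
    rw [run_swap]
    exact Mix.supp_pure ⟨sk, pp, hsk, hpp, rfl⟩
  keyGen_out n pp hpp := by
    show Mix.Supp _ _
    rw [O.run_pairKeyGen n hpp]
    refine Mix.Supp.bind (O.keyGen_out n pp hpp) ?_
    rintro _ ⟨s₀, v₀, h₀, rfl⟩
    rw [unpair_pair, LawfulMonad.pure_bind]
    refine Mix.Supp.bind (O.keyGen_out n pp hpp) ?_
    rintro _ ⟨s₁, v₁, h₁, rfl⟩
    rw [unpair_pair, LawfulMonad.pure_bind]
    exact Mix.supp_pure ⟨_, _, isClassical_pair.mpr ⟨h₀, h₁⟩, rfl⟩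
  sign_out n _ sigk m hpp := O.supp_pairSign n sigk m hpp
  ver_out := O.supp_pairVer
  del_out := O.supp_pairDel
  cert_out := O.supp_pairCertAlg

theorem isPairConstruction : IsPairConstruction O O.pairScheme where
  setup := O.run_pairSetup
  keyGen n _ hpp := O.run_pairKeyGen n hpp
  sign n _ s₀ s₁ m hpp := O.run_pairSign n hpp s₀ s₁ m
  ver n _ _ _ m _ hpp h₀ h₁ hσ := O.run_pairVer n m hpp h₀ h₁ hσ
  del_fresh := O.run_pairDel_fresh
  del_used := O.run_pairDel_used
  cert n _ _ _ _ _ S hpp h₀ h₁ hsk hc := O.run_pairCertAlg n S hpp h₀ h₁ hsk hc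

end TwoTierOSS

/-! ### Probability distributions -/

/-- The indicator of a truth value. -/
def ind (b : Bool) : ℂ := if b then 1 else 0

@[simp] theorem ind_true : ind true = 1 := rfl

@[simp] theorem ind_false : ind false = 0 := rfl

theorem ind_and (a b : Bool) : ind (a && b) = ind a * ind b := by
  cases a <;> cases b <;> simp

theorem ind_nonneg (b : Bool) : 0 ≤ ind b := by cases b <;> simp

theorem ind_le_one (b : Bool) : ind b ≤ 1 := by cases b <;> simp

namespace Mix

variable {α β : Type}

theorem coeff_pure_true (b : Bool) : (pure b : Mix Bool).coeff true = ind b := by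
  cases b <;> simp [coeff_pure]

/-- Nonnegative coefficients with sum `1`. -/
structure IsDist (μ : Mix α) : Prop where
  nonneg : ∀ a, 0 ≤ μ.coeff a
  mass : μ.expect (fun _ => 1) = 1

theorem expect_comm (μ : Mix α) (ν : Mix β) (g : α → β → ℂ) :
    (μ.expect fun a => ν.expect fun b => g a b) = ν.expect fun b => μ.expect fun a => g a b := by
  simp only [expect, Finset.mul_sum]
  rw [Finset.sum_comm]
  exact Finset.sum_congr rfl fun b _ => Finset.sum_congr rfl fun a _ => by ring

namespace IsDist

theorem pure (a : α) : (pure a : Mix α).IsDist := by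
  classical
  refine ⟨fun b => ?_, by simp⟩
  rw [coeff_pure]
  split_ifs <;> simp

theorem expect_mono {μ : Mix α} (hμ : μ.IsDist) {P : α → Prop} (hP : μ.Supp P) {g h : α → ℂ}
    (hgh : ∀ a, P a → g a ≤ h a) : μ.expect g ≤ μ.expect h :=
  Finset.sum_le_sum fun a ha => mul_le_mul_of_nonneg_left (hgh a (hP a (mem_supp.mp ha)))
    (hμ.nonneg a)

theorem expect_const {μ : Mix α} (hμ : μ.IsDist) (c : ℂ) : (μ.expect fun _ => c) = c := by
  simpa [hμ.mass] using μ.expect_mul_left c fun _ => 1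

theorem expect_nonneg {μ : Mix α} (hμ : μ.IsDist) {P : α → Prop} (hP : μ.Supp P) {g : α → ℂ}
    (hg : ∀ a, P a → 0 ≤ g a) : 0 ≤ μ.expect g := by
  simpa [hμ.expect_const] using hμ.expect_mono hP hg

theorem expect_le_one {μ : Mix α} (hμ : μ.IsDist) {P : α → Prop} (hP : μ.Supp P) {g : α → ℂ}
    (hg : ∀ a, P a → g a ≤ 1) : μ.expect g ≤ 1 := by
  simpa [hμ.expect_const] using hμ.expect_mono hP hg

theorem bind {μ : Mix α} (hμ : μ.IsDist) {P : α → Prop} (hP : μ.Supp P) {f : α → Mix β}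
    (hf : ∀ a, P a → (f a).IsDist) : (μ >>= f).IsDist where
  nonneg b := by
    rw [coeff_bind_eq_expect]
    exact hμ.expect_nonneg hP fun a ha => (hf a ha).nonneg b
  mass := by
    rw [expect_bind]
    exact (expect_congr fun a ha => (hf a (hP a ha)).mass).trans hμ.mass

end IsDist

end Mix

theorem supp_measure (v : Data) : v.measure.Supp Data.IsClassical := by
  rw [measure_eq]
  exact (Mix.supp_pure (isClassical_outcome v)).smul _

/-- Classical data are diagonal, so complete positivity makes their coefficients nonnegative. Each
has trace one, so the total mass is the trace of the output, which equals that of the input. -/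
theorem QPT.isDist_run (A : QPT) {v : Data} (hv : v.IsClassical)
    (hA : (A.run v).Supp Data.IsClassical) : (A.run v).IsDist where
  nonneg w := by
    by_cases hw : (A.run v).coeff w = 0
    · rw [hw]
    · have h : IsChan fun s => A.prog.exec s >>= fun t => (pure t.2 : Mix Data) :=
        A.prog.isChan_exec.bind
          (.of_map (fun _ => rfl) (fun _ => rfl) fun t => (tr_prod t).symm)
      exact h.coeff_nonneg (v := (A.time.eval v.size, v))
        (congrArg (Prod.mk _) (isDiag_iff.mp hv.isDiag)) (isDiag_iff.mp (hA w hw).isDiag)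
  mass := by
    have h := A.trace_run v
    rw [hv.tr_eq] at h
    exact (Mix.expect_congr fun w hw => (hA w hw).tr_eq.symm).trans h

/-- The probability that the output is the bit `true`. -/
def acc (μ : Mix Data) : ℂ := μ.expect fun d => ind d.accepts

theorem acc_pure (v : Data) : acc (pure v) = ind v.accepts := by simp [acc]

theorem acc_nonneg {μ : Mix Data} (h : μ.IsDist) : 0 ≤ acc μ :=
  h.expect_nonneg μ.supp_true fun _ _ => ind_nonneg _

theorem acc_le_one {μ : Mix Data} (h : μ.IsDist) : acc μ ≤ 1 :=
  h.expect_le_one μ.supp_true fun _ _ => ind_le_one _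

theorem Mix.prob_le {μ : Mix Bool} {x : ℂ} (h : μ.coeff true ≤ x) : μ.prob ≤ x.re :=
  (Complex.le_def.mp h).1

theorem expect_drop (v : Data) (g : Unit → ℂ) : v.drop.expect g = tr v * g () := by
  rw [drop_eq, Mix.expect_smul, Mix.expect_pure]

namespace TwoTierOSS

open QPT

variable (O : TwoTierOSS)

/-! ### Sampling keys and signatures -/

/-- The distribution of `(pp, sk)`. -/
def setupDist (n : ℕ) : Mix (Data × Data) := O.setup.run (unary n) >>= unpair

theorem isDist_setupDist (n : ℕ) : (O.setupDist n).IsDist := by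
  refine Mix.IsDist.bind (O.setup.isDist_run (isClassical_unary n) ?_) (O.setup_out n) ?_
  · refine Mix.Supp.mono (O.setup_out n) ?_
    rintro _ ⟨pp, sk, hpp, hsk, rfl⟩
    exact ⟨hpp, hsk⟩
  · rintro _ ⟨pp, sk, hpp, hsk, rfl⟩
    exact Mix.IsDist.pure _

theorem supp_setupDist (n : ℕ) :
    (O.setupDist n).Supp fun x => x.1.IsClassical ∧ x.2.IsClassical := by
  refine Mix.Supp.bind (O.setup_out n) ?_
  rintro _ ⟨pp, sk, hpp, hsk, rfl⟩
  exact Mix.supp_pure ⟨hpp, hsk⟩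

/-- The mixture of pairs `(sigk, vk)`. -/
def keyMix (n : ℕ) (pp : Data) : Mix (Data × Data) := O.keyGen.run (unary n ⋆ pp) >>= unpair

theorem supp_keyMix (n : ℕ) {pp : Data} (hpp : pp.IsClassical) :
    (O.keyMix n pp).Supp fun x => x.2.IsClassical := by
  refine Mix.Supp.bind (O.keyGen_out n pp hpp) ?_
  rintro _ ⟨s, v, hv, rfl⟩
  exact Mix.supp_pure hv

theorem expect_keyMix_tr (n : ℕ) {pp : Data} (hpp : pp.IsClassical) :
    (O.keyMix n pp).expect (fun x => tr x.1) = 1 := by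
  have hcl : (unary n ⋆ pp).IsClassical := isClassical_pair.mpr ⟨isClassical_unary n, hpp⟩
  rw [keyMix, Mix.expect_bind, ← hcl.tr_eq, ← O.keyGen.trace_run, Mix.trace]
  refine Mix.expect_congr fun d hd => ?_
  obtain ⟨s, v, hv, rfl⟩ := O.keyGen_out n pp hpp d hd
  rw [unpair_pair, Mix.expect_pure, tr_pair, hv.tr_eq, mul_one]

/-- A forgotten signature is a discarded key: the output is classical and so has trace one, and
signing preserves the trace. -/
theorem expect_sign_const (n : ℕ) (s : Data) (b : Bool) (c : ℂ) :
    ((O.sign.run (unary n ⋆ s ⋆ bit b)).expect fun _ => c) = tr s * c := by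
  have h := O.sign.trace_run (unary n ⋆ s ⋆ bit b)
  rw [tr_pair, tr_pair, (isClassical_unary n).tr_eq, tr_bit, one_mul, mul_one] at h
  rw [← h, Mix.trace, ← Mix.expect_mul_right]
  refine Mix.expect_congr fun d hd => ?_
  rw [Data.IsClassical.tr_eq (O.sign_out n s b d hd), one_mul]

/-- A fresh verification key with a signature of `b`. -/
def keySigDist (n : ℕ) (pp : Data) (b : Bool) : Mix (Data × Data) :=
  O.keyMix n pp >>= fun x => O.sign.run (unary n ⋆ x.1 ⋆ bit b) >>= fun σ => pure (x.2, σ)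

theorem expect_keySigDist (n : ℕ) (pp : Data) (b : Bool) (g : Data × Data → ℂ) :
    (O.keySigDist n pp b).expect g = (O.keyMix n pp).expect fun x =>
      (O.sign.run (unary n ⋆ x.1 ⋆ bit b)).expect fun σ => g (x.2, σ) := by
  simp only [keySigDist, Mix.expect_bind, Mix.expect_pure]

/-- An algorithm that samples `keySigDist`. -/
def keySign (b : Bool) : QPT :=
  (fork fst skip).seq ((par skip O.keyGen).seq (assocInv.seq ((par (O.signBit b) skip).seq swap)))

theorem run_keySign (n : ℕ) {pp : Data} (hpp : pp.IsClassical) (b : Bool) :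
    (O.keySign b).run (unary n ⋆ pp) = O.keySigDist n pp b >>= fun x => pure (x.1 ⋆ x.2) := by
  have hcl : (unary n ⋆ pp).IsClassical := isClassical_pair.mpr ⟨isClassical_unary n, hpp⟩
  simp only [keySign, run_seq, run_fork _ _ hcl, run_fst _ hpp, run_skip, LawfulMonad.pure_bind,
    run_par, bind_assoc, keySigDist, keyMix]
  refine Mix.bind_congr_supp fun d hd => ?_
  obtain ⟨s, v, -, rfl⟩ := O.keyGen_out n pp hpp d hd
  simp [-bind_pure_comp]

theorem supp_keySigDist (n : ℕ) {pp : Data} (hpp : pp.IsClassical) (b : Bool) :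
    (O.keySigDist n pp b).Supp fun x => x.1.IsClassical ∧ x.2.IsClassical :=
  (O.supp_keyMix n hpp).bind fun x hx =>
    Mix.Supp.bind (O.sign_out n x.1 b) fun _ hσ => Mix.supp_pure ⟨hx, hσ⟩

/-- `keyMix` need not be a distribution, since signing keys may be off-diagonal. Once the key is
consumed by signing, everything is classical and is the output of the algorithm `keySign`. -/
theorem isDist_keySigDist (n : ℕ) {pp : Data} (hpp : pp.IsClassical) (b : Bool) :
    (O.keySigDist n pp b).IsDist := by
  have hcl : (unary n ⋆ pp).IsClassical := isClassical_pair.mpr ⟨isClassical_unary n, hpp⟩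
  have hsupp : ((O.keySign b).run (unary n ⋆ pp)).Supp
      fun d => ∃ v σ : Data, v.IsClassical ∧ σ.IsClassical ∧ d = v ⋆ σ := by
    rw [O.run_keySign n hpp]
    exact (O.supp_keySigDist n hpp b).bind fun x hx => Mix.supp_pure ⟨_, _, hx.1, hx.2, rfl⟩
  have h : O.keySigDist n pp b = (O.keySign b).run (unary n ⋆ pp) >>= unpair := by
    rw [O.run_keySign n hpp, bind_assoc]
    simp
  rw [h]
  refine (QPT.isDist_run _ hcl (hsupp.mono ?_)).bind hsupp ?_
  · rintro _ ⟨v, σ, hv, hσ, rfl⟩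
    exact isClassical_pair.mpr ⟨hv, hσ⟩
  · rintro _ ⟨v, σ, hv, hσ, rfl⟩
    exact Mix.IsDist.pure _

/-- The acceptance probability of `ver₀`. -/
def p₀ (n : ℕ) (pp vk σ : Data) : ℂ := acc (O.ver₀.run (unary n ⋆ pp ⋆ vk ⋆ σ))

/-- The acceptance probability of `ver₁`. -/
def p₁ (n : ℕ) (pp sk vk σ : Data) : ℂ := acc (O.ver₁.run (unary n ⋆ pp ⋆ sk ⋆ vk ⋆ σ))

theorem isDist_ver₀ (n : ℕ) {pp vk σ : Data} (hpp : pp.IsClassical) (hvk : vk.IsClassical) (hσ : σ.IsClassical) :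
    (O.ver₀.run (unary n ⋆ pp ⋆ vk ⋆ σ)).IsDist := by
  refine O.ver₀.isDist_run (by simp [hpp, hvk, hσ])
    (Mix.Supp.mono (O.ver₀_out n pp vk σ hpp hvk hσ) ?_)
  rintro _ ⟨b, rfl⟩
  exact isClassical_bit b

theorem isDist_ver₁ (n : ℕ) {pp sk vk σ : Data} (hpp : pp.IsClassical) (hsk : sk.IsClassical) (hvk : vk.IsClassical)
    (hσ : σ.IsClassical) : (O.ver₁.run (unary n ⋆ pp ⋆ sk ⋆ vk ⋆ σ)).IsDist := by
  refine O.ver₁.isDist_run (by simp [hpp, hsk, hvk, hσ])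
    (Mix.Supp.mono (O.ver₁_out n pp sk vk σ hpp hsk hvk hσ) ?_)
  rintro _ ⟨b, rfl⟩
  exact isClassical_bit b

/-- The probability that an honest signature of `0` is accepted, for given public parameters. -/
def c₀ (n : ℕ) (pp : Data) : ℂ := (O.keySigDist n pp false).expect fun x => O.p₀ n pp x.1 x.2

/-- The probability that an honest signature of `1` is accepted, for given parameters. -/
def c₁ (n : ℕ) (pp sk : Data) : ℂ :=
  (O.keySigDist n pp true).expect fun x => O.p₁ n pp sk x.1 x.2

theorem coeff_correctGame₀ (n : ℕ) :
    (O.correctGame₀ n).coeff true = (O.setupDist n).expect fun x => O.c₀ n x.1 := by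
  simp only [c₀, expect_keySigDist, setupDist, keyMix, Mix.expect_bind, correctGame₀,
    Mix.coeff_bind_eq_expect, Mix.coeff_pure_true]
  rfl

theorem coeff_correctGame₁ (n : ℕ) :
    (O.correctGame₁ n).coeff true = (O.setupDist n).expect fun x => O.c₁ n x.1 x.2 := by
  simp only [c₁, expect_keySigDist, setupDist, keyMix, Mix.expect_bind, correctGame₁,
    Mix.coeff_bind_eq_expect, Mix.coeff_pure_true]
  rfl

/-! ### Correctness of the construction -/

/-- The expectation over the output of the setup of the construction. -/
theorem expect_pairSetup (n : ℕ) (g : Data × Data → ℂ) :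
    ((O.pairScheme.setup.run (unary n)).expect fun d => d.unpair.expect g) =
      (O.setupDist n).expect fun x => g (x.2, x.1) := by
  have : O.pairScheme.setup.run (unary n) = O.setupDist n >>= fun x => pure (x.2 ⋆ x.1) := by
    rw [setupDist, bind_assoc]
    exact O.run_pairSetup n
  rw [this, Mix.expect_bind]
  simp

theorem expect_pairKeyGen (n : ℕ) {pp : Data} (hpp : pp.IsClassical) (g : Data × Data → ℂ) :
    ((O.pairScheme.keyGen.run (unary n ⋆ pp)).expect fun d => d.unpair.expect g) =
      (O.keyMix n pp).expect fun x => (O.keyMix n pp).expect fun y =>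
        g (freshKey x.1 y.1, x.2 ⋆ y.2) := by
  have : O.pairScheme.keyGen.run (unary n ⋆ pp) = O.keyMix n pp >>= fun x => O.keyMix n pp >>=
      fun y => pure (freshKey x.1 y.1 ⋆ x.2 ⋆ y.2) := by
    simp only [keyMix, bind_assoc]
    exact O.run_pairKeyGen n hpp
  rw [this]
  simp only [Mix.expect_bind, Mix.expect_pure, unpair_pair]

theorem expect_pairSign (n : ℕ) {pp : Data} (hpp : pp.IsClassical) (s₀ s₁ : Data) (m : Bool)
    (g : Data × Data → ℂ) :
    ((O.pairScheme.sign.run (unary n ⋆ pp ⋆ freshKey s₀ s₁ ⋆ bit m)).expect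
      fun d => d.unpair.expect g) =
      (O.sign.run (unary n ⋆ (if m then s₁ else s₀) ⋆ bit false)).expect fun σ =>
        g (usedKey (!m) (if m then s₀ else s₁), σ) := by
  have : O.pairScheme.sign.run (unary n ⋆ pp ⋆ freshKey s₀ s₁ ⋆ bit m) = _ :=
    O.run_pairSign n hpp s₀ s₁ m
  rw [this]
  simp only [Mix.expect_bind, Mix.expect_pure, unpair_pair]

/-- A sum over two independent keys, of which only one is used. -/
theorem expect_keyMix_mul (n : ℕ) {pp : Data} (hpp : pp.IsClassical) (m : Bool)
    (g : Data × Data → ℂ) :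
    ((O.keyMix n pp).expect fun x => (O.keyMix n pp).expect fun y =>
      tr (if m then x.1 else y.1) * g (if m then y else x)) = (O.keyMix n pp).expect g := by
  cases m
  · simp only [Bool.false_eq_true, if_false, Mix.expect_mul_right, O.expect_keyMix_tr n hpp, one_mul]
  · simp only [if_true, Mix.expect_mul_left, Mix.expect_mul_right, O.expect_keyMix_tr n hpp, one_mul]

theorem tr_usedKey (b : Bool) (s : Data) : tr (usedKey b s) = tr s := by simp [usedKey]

theorem tr_freshKey (s₀ s₁ : Data) : tr (freshKey s₀ s₁) = tr s₀ * tr s₁ := by simp [freshKey]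

/-- Key number `m` plays the honest game with `ver₀`, and the other key is discarded with total
trace one, so the probabilities agree exactly. -/
theorem coeff_correctGame (m : Bool) (n : ℕ) :
    (O.pairScheme.correctGame m n).coeff true = (O.correctGame₀ n).coeff true := by
  rw [coeff_correctGame₀]
  simp only [DSRKey.correctGame, Mix.coeff_bind_eq_expect, Mix.coeff_pure_true]
  rw [expect_pairSetup]
  refine Mix.expect_congr fun x hx => ?_
  have hpp := (O.supp_setupDist n x hx).1
  simp only
  rw [O.expect_pairKeyGen n hpp, c₀, expect_keySigDist]
  refine Eq.trans ?_ (O.expect_keyMix_mul n hpp m _)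
  refine Mix.expect_congr fun y hy => Mix.expect_congr fun z hz => ?_
  have hy' := O.supp_keyMix n hpp y hy
  have hz' := O.supp_keyMix n hpp z hz
  simp only
  rw [O.expect_pairSign n hpp]
  simp only [expect_drop, tr_usedKey, Mix.expect_mul_left]
  congr 1
  rw [apply_ite Prod.fst m z y]
  refine Mix.expect_congr fun σ hσ => ?_
  have : O.pairScheme.ver.run (unary n ⋆ x.1 ⋆ (y.2 ⋆ z.2) ⋆ bit m ⋆ σ) = _ :=
    O.run_pairVer n m hpp hy' hz' (O.sign_out n _ _ σ hσ)
  rw [this]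
  cases m <;> rfl

theorem expect_pairDel_used (n : ℕ) (b : Bool) (s : Data) (g : Data → ℂ) :
    (O.pairScheme.del.run (unary n ⋆ usedKey b s)).expect g =
      (O.sign.run (unary n ⋆ s ⋆ bit true)).expect fun σ => g (bit b ⋆ σ) := by
  have : O.pairScheme.del.run (unary n ⋆ usedKey b s) = _ := O.run_pairDel_used n b s
  rw [this]
  simp only [Mix.expect_bind, Mix.expect_pure]

theorem expect_pairDel_fresh (n : ℕ) (s₀ s₁ : Data) (g : Data → ℂ) :
    (O.pairScheme.del.run (unary n ⋆ freshKey s₀ s₁)).expect g =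
      (O.sign.run (unary n ⋆ s₀ ⋆ bit true)).expect fun σ₀ =>
        (O.sign.run (unary n ⋆ s₁ ⋆ bit true)).expect fun σ₁ =>
          g (bit false ⋆ bit true ⋆ σ₀ ⋆ σ₁) := by
  have : O.pairScheme.del.run (unary n ⋆ freshKey s₀ s₁) = _ := O.run_pairDel_fresh n s₀ s₁
  rw [this]
  simp only [Mix.expect_bind, Mix.expect_pure]

/-- The probability that a certificate is accepted. -/
theorem acc_pairCert (n : ℕ) {pp v₀ v₁ sk c : Data} (S : Finset Bool) (hpp : pp.IsClassical)
    (h₀ : v₀.IsClassical) (h₁ : v₁.IsClassical) (hsk : sk.IsClassical) (hc : c.IsClassical) :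
    acc (O.pairScheme.cert.run (unary n ⋆ pp ⋆ (v₀ ⋆ v₁) ⋆ sk ⋆ c ⋆ ofSet S)) =
      acc (pairCert O n pp v₀ v₁ sk c S) :=
  congrArg acc (O.run_pairCertAlg n S hpp h₀ h₁ hsk hc)

theorem acc_pairCert_empty (n : ℕ) (pp v₀ v₁ sk σ₀ σ₁ : Data) :
    acc (pairCert O n pp v₀ v₁ sk (bit false ⋆ bit true ⋆ σ₀ ⋆ σ₁) ∅) =
      O.p₁ n pp sk v₀ σ₀ * O.p₁ n pp sk v₁ σ₁ := by
  simp only [pairCert, if_true, acc, p₁, Mix.expect_bind, Mix.expect_pure, accepts, ind_and,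
    Mix.expect_mul_left, Mix.expect_mul_right]

theorem acc_pairCert_singleton (n : ℕ) (pp v₀ v₁ sk σ : Data) (m : Bool) :
    acc (pairCert O n pp v₀ v₁ sk (bit (!m) ⋆ σ) {m}) =
      O.p₁ n pp sk (if m then v₀ else v₁) σ := by
  cases m <;> simp [pairCert, p₁]

theorem coeff_deletionGame₁ (m : Bool) (n : ℕ) :
    (O.pairScheme.deletionGame₁ m n).coeff true = (O.correctGame₁ n).coeff true := by
  rw [coeff_correctGame₁]
  simp only [DSRKey.deletionGame₁, Mix.coeff_bind_eq_expect, Mix.coeff_pure_true]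
  rw [expect_pairSetup]
  refine Mix.expect_congr fun x hx => ?_
  obtain ⟨hpp, hsk⟩ := O.supp_setupDist n x hx
  simp only
  rw [O.expect_pairKeyGen n hpp, c₁, expect_keySigDist]
  -- The surviving key `!m` signs `1`; the ignored signature under key `m` leaves only the trace of
  -- that key.
  refine Eq.trans ?_ (O.expect_keyMix_mul n hpp (!m) _)
  refine Mix.expect_congr fun y hy => Mix.expect_congr fun z hz => ?_
  have hy' := O.supp_keyMix n hpp y hy
  have hz' := O.supp_keyMix n hpp z hz
  simp only
  rw [O.expect_pairSign n hpp]
  simp only [O.expect_pairDel_used, expect_sign_const]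
  congr 1
  · cases m <;> rfl
  have h : (if !m then z else y).1 = (if m then y.1 else z.1) := by cases m <;> rfl
  rw [h]
  refine Mix.expect_congr fun σ hσ => ?_
  have hσ' := O.sign_out n _ _ σ hσ
  refine (O.acc_pairCert n {m} hpp hy' hz' hsk (isClassical_pair.mpr ⟨isClassical_bit _, hσ'⟩)).trans ?_
  rw [acc_pairCert_singleton]
  cases m <;> rfl

/-- Given `(pp, sk)` the two keys are independent, so the acceptance probability factors. The square
stays inside the average, as both keys share the parameters. -/
theorem coeff_deletionGame₀ (n : ℕ) : (O.pairScheme.deletionGame₀ n).coeff true =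
    (O.setupDist n).expect fun x => O.c₁ n x.1 x.2 * O.c₁ n x.1 x.2 := by
  simp only [DSRKey.deletionGame₀, Mix.coeff_bind_eq_expect, Mix.coeff_pure_true]
  rw [expect_pairSetup]
  refine Mix.expect_congr fun x hx => ?_
  obtain ⟨hpp, hsk⟩ := O.supp_setupDist n x hx
  simp only
  rw [O.expect_pairKeyGen n hpp, c₁, expect_keySigDist]
  simp only [O.expect_pairDel_fresh]
  rw [← Mix.expect_mul_right]
  refine Mix.expect_congr fun y hy => ?_
  rw [← Mix.expect_mul_left]
  refine Mix.expect_congr fun z hz => ?_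
  have hy' := O.supp_keyMix n hpp y hy
  have hz' := O.supp_keyMix n hpp z hz
  rw [← Mix.expect_mul_right]
  refine Mix.expect_congr fun σ hσ => ?_
  rw [← Mix.expect_mul_left]
  refine Mix.expect_congr fun τ hτ => ?_
  refine (O.acc_pairCert n ∅ hpp hy' hz' hsk ?_).trans (O.acc_pairCert_empty ..)
  simp [O.sign_out n _ _ σ hσ, O.sign_out n _ _ τ hτ]

end TwoTierOSS

namespace Mix

variable {α : Type}

theorem expect_finset_sum {ι : Type} (μ : Mix α) (s : Finset ι) (g : ι → α → ℂ) :
    (μ.expect fun a => ∑ i ∈ s, g i a) = ∑ i ∈ s, μ.expect (g i) := by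
  simp only [expect, Finset.mul_sum]
  exact Finset.sum_comm

end Mix

theorem le_sum_of_nonneg {ι : Type} [Fintype ι] {g : ι → ℂ} (h : ∀ i, 0 ≤ g i) (i : ι) :
    g i ≤ ∑ i, g i := by
  classical
  rw [← Finset.add_sum_erase _ g (Finset.mem_univ i)]
  exact le_add_of_nonneg_right (Finset.sum_nonneg fun j _ => h j)

/-! ### Negligible functions -/

theorem Negligible.add {ε δ : ℕ → ℝ} (hε : Negligible ε) (hδ : Negligible δ) :
    Negligible fun n => ε n + δ n := SuperpolynomialDecay.add hε hδ

theorem AtMostNegligible.mono {P Q : ℕ → ℝ} (hP : AtMostNegligible P) (h : ∀ n, Q n ≤ P n) :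
    AtMostNegligible Q := by
  obtain ⟨ε, hε, hle⟩ := hP
  exact ⟨ε, hε, fun n => (h n).trans (hle n)⟩

theorem AtMostNegligible.add {P Q : ℕ → ℝ} (hP : AtMostNegligible P) (hQ : AtMostNegligible Q) :
    AtMostNegligible fun n => P n + Q n := by
  obtain ⟨ε, hε, hle⟩ := hP
  obtain ⟨δ, hδ, hle'⟩ := hQ
  exact ⟨_, hε.add hδ, fun n => add_le_add (hle n) (hle' n)⟩

theorem AtMostNegligible.sum {ι : Type} (s : Finset ι) {P : ι → ℕ → ℝ}
    (h : ∀ i, AtMostNegligible (P i)) : AtMostNegligible fun n => ∑ i ∈ s, P i n := by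
  classical
  induction s using Finset.induction_on with
  | empty => exact ⟨0, superpolynomialDecay_zero _ _, fun n => by simp⟩
  | insert i s hi ih =>
    refine ((h i).add ih).mono fun n => ?_
    rw [Finset.sum_insert hi]

theorem overwhelming_iff {P : ℕ → ℝ} : Overwhelming P ↔ AtMostNegligible fun n => 1 - P n := by
  constructor <;> rintro ⟨ε, hε, h⟩ <;> exact ⟨ε, hε, fun n => by linarith [h n]⟩

/-! ### Acceptance probabilities and the two correctness properties -/

namespace TwoTierOSS

open QPT

variable (O : TwoTierOSS)

section

variable (n : ℕ) {pp sk vk σ : Data}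

theorem p₀_nonneg (hpp : pp.IsClassical) (hvk : vk.IsClassical) (hσ : σ.IsClassical) :
    0 ≤ O.p₀ n pp vk σ := acc_nonneg (O.isDist_ver₀ n hpp hvk hσ)

theorem p₀_le_one (hpp : pp.IsClassical) (hvk : vk.IsClassical) (hσ : σ.IsClassical) :
    O.p₀ n pp vk σ ≤ 1 := acc_le_one (O.isDist_ver₀ n hpp hvk hσ)

theorem p₁_nonneg (hpp : pp.IsClassical) (hsk : sk.IsClassical) (hvk : vk.IsClassical)
    (hσ : σ.IsClassical) : 0 ≤ O.p₁ n pp sk vk σ := acc_nonneg (O.isDist_ver₁ n hpp hsk hvk hσ)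

theorem p₁_le_one (hpp : pp.IsClassical) (hsk : sk.IsClassical) (hvk : vk.IsClassical)
    (hσ : σ.IsClassical) : O.p₁ n pp sk vk σ ≤ 1 := acc_le_one (O.isDist_ver₁ n hpp hsk hvk hσ)

theorem c₁_le_one (hpp : pp.IsClassical) (hsk : sk.IsClassical) : O.c₁ n pp sk ≤ 1 :=
  (O.isDist_keySigDist n hpp true).expect_le_one (O.supp_keySigDist n hpp true)
    fun _ hx => O.p₁_le_one n hpp hsk hx.1 hx.2

end

theorem oneTimeCorrect (h : O.Correct) : O.pairScheme.OneTimeCorrect := by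
  intro m
  simpa only [Mix.prob, coeff_correctGame] using h.1

/-- Average `(1 - c)² ≥ 0` over the parameters: the failure probability at most doubles. -/
theorem two_mul_coeff_le (n : ℕ) :
    2 * (O.correctGame₁ n).coeff true - 1 ≤ (O.pairScheme.deletionGame₀ n).coeff true := by
  rw [coeff_correctGame₁, coeff_deletionGame₀, ← Mix.expect_mul_left,
    ← (O.isDist_setupDist n).mass, ← Mix.expect_sub]
  refine (O.isDist_setupDist n).expect_mono (O.supp_setupDist n) ?_
  rintro ⟨pp, sk⟩ ⟨hpp, hsk⟩
  -- The order of `ℂ` sees only real differences; the bound `c₁ ≤ 1` makes `1 - c₁` real and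
  -- nonnegative, and hence its square as well.
  have h := sub_nonneg.mpr (O.c₁_le_one n hpp hsk)
  have h' := mul_nonneg h h
  rw [← sub_nonneg]
  convert h' using 1
  ring

theorem oneTimeDeletionCorrect (h : O.Correct) : O.pairScheme.OneTimeDeletionCorrect := by
  refine ⟨?_, fun m => by simpa only [Mix.prob, coeff_deletionGame₁] using h.2⟩
  rw [overwhelming_iff]
  have h2 := overwhelming_iff.mp h.2
  refine (h2.add h2).mono fun n => ?_
  have := (Complex.le_def.mp (O.two_mul_coeff_le n)).1
  simp only [Complex.sub_re, Complex.mul_re, Complex.re_ofNat, Complex.im_ofNat, Complex.one_re,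
    zero_mul, sub_zero] at this
  simp only [Mix.prob]
  linarith

/-! ### Adversaries against the one-shot signature scheme -/

/-- The probability that `(vk, σ₀, σ₁)` wins the security game; any other datum loses. -/
def forkValue (n : ℕ) (pp sk : Data) : Data → ℂ
  | vk ⋆ σ₀ ⋆ σ₁ => O.p₀ n pp vk σ₀ * O.p₁ n pp sk vk σ₁
  | _ => 0

theorem forkValue_nonneg (n : ℕ) {pp sk d : Data} (hpp : pp.IsClassical) (hsk : sk.IsClassical)
    (hd : d.IsClassical) : 0 ≤ O.forkValue n pp sk d := by
  unfold forkValue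
  split
  · exact mul_nonneg (O.p₀_nonneg n hpp hd.1 hd.2.1) (O.p₁_nonneg n hpp hsk hd.1 hd.2.2)
  · exact le_rfl

/-- The probability that the measured output of `A` on `v` wins the security game. -/
def winProb (n : ℕ) (pp sk : Data) (A : QPT) (v : Data) : ℂ :=
  ((A.seq measure).run v).expect (O.forkValue n pp sk)

theorem winProb_seq (n : ℕ) (pp sk : Data) (A B : QPT) (v : Data) :
    O.winProb n pp sk (A.seq B) v = (A.run v).expect (O.winProb n pp sk B) := by
  rw [winProb, run_seq, run_seq, bind_assoc, Mix.expect_bind]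
  exact Mix.expect_congr fun w _ => by rw [winProb, run_seq]

theorem winProb_eq (n : ℕ) {pp sk : Data} {A : QPT} {v d : Data} (h : A.run v = pure d)
    (hd : d.IsClassical) : O.winProb n pp sk A v = O.forkValue n pp sk d := by
  rw [winProb, run_seq, h, LawfulMonad.pure_bind, run_measure, hd.measure_eq, Mix.expect_pure]

theorem supp_seq_measure (A : QPT) (v : Data) : ((A.seq measure).run v).Supp Data.IsClassical := by
  rw [run_seq]
  exact (Mix.supp_true _).bind fun w _ => by rw [run_measure]; exact supp_measure w

theorem isDist_seq_measure (A : QPT) {v : Data} (hv : v.IsClassical) :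
    ((A.seq measure).run v).IsDist := QPT.isDist_run _ hv (supp_seq_measure A v)

theorem winProb_nonneg (n : ℕ) {pp sk v : Data} (hpp : pp.IsClassical) (hsk : sk.IsClassical)
    (A : QPT) (hv : v.IsClassical) : 0 ≤ O.winProb n pp sk A v :=
  (isDist_seq_measure A hv).expect_nonneg (supp_seq_measure A v)
    fun _ => O.forkValue_nonneg n hpp hsk

theorem coeff_securityGame (A : QPT) (n : ℕ) : (O.securityGame A n).coeff true =
    (O.setupDist n).expect fun x => O.winProb n x.1 x.2 A (unary n ⋆ x.1) := by
  simp only [securityGame, setupDist, Mix.expect_bind, winProb, run_seq,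
    Mix.coeff_bind_eq_expect, Mix.coeff_pure_true, ind_and]
  refine Mix.expect_congr fun a _ => Mix.expect_congr fun x _ => Mix.expect_congr fun d _ => ?_
  rw [run_measure]
  refine Mix.expect_congr fun e _ => ?_
  unfold forkValue
  split
  · simp only [unpair_pair, Mix.expect_pure, p₀, p₁, acc, Mix.expect_mul_left, Mix.expect_mul_right]
  · rename_i hne
    cases e with
    | pair a b =>
      rw [unpair_pair, Mix.expect_pure]
      cases b with
      | pair b c => exact (hne a b c rfl).elim
      | _ => exact Mix.expect_zero _
    | _ => exact Mix.expect_zero _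

/-! ### Deletion security -/

/-- Key number `j` of a pair. -/
def choose (j : Bool) : QPT := if j then snd else fst

theorem run_choose (j : Bool) {a b : Data} (ha : a.IsClassical) (hb : b.IsClassical) :
    (choose j).run (a ⋆ b) = pure (if j then b else a) := by
  cases j
  · exact run_fst _ hb
  · exact run_snd _ ha

/-- The signature of `1` under key number `j` in a certificate for a fresh key. -/
def certItem (j : Bool) : QPT := if j then tail 3 else item 2

theorem run_certItem (j : Bool) {a b c d : Data} (h : (a ⋆ b ⋆ c ⋆ d).IsClassical) :
    (certItem j).run (a ⋆ b ⋆ c ⋆ d) = pure (if j then d else c) := by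
  obtain ⟨ha, hb, hc, hd⟩ := h
  cases j <;> simp [certItem, item, tail, ha, hb, hc, hd]

/-- From `(vk, cert, S, m, σ)`, extract key number `j`, the signature `σ` of `0` and a signature of
`1` from a certificate for an unused (`fresh = true`) or used key. -/
def extract (j fresh : Bool) : QPT :=
  ite (.pair (.pair .any .any) (.pair (if fresh then .pair .any (.pair .any (.pair .any .any))
      else .pair .any .any) (.pair .any (.pair .any .any))))
    (fork (fst.seq (choose j)) (fork (tail 4) ((item 1).seq (if fresh then certItem j else snd))))
    (constant false)

theorem run_extract_fresh (j : Bool) {v₀ v₁ a b c d s m σ : Data}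
    (h : ((v₀ ⋆ v₁) ⋆ (a ⋆ b ⋆ c ⋆ d) ⋆ s ⋆ m ⋆ σ).IsClassical) :
    (extract j true).run ((v₀ ⋆ v₁) ⋆ (a ⋆ b ⋆ c ⋆ d) ⋆ s ⋆ m ⋆ σ) =
      pure ((if j then v₁ else v₀) ⋆ σ ⋆ if j then d else c) := by
  rw [extract, run_ite _ _ _ h]
  obtain ⟨⟨h₀, h₁⟩, ⟨ha, hb, hc, hd⟩, hs, hm, hσ⟩ := h
  simp [Pat.matches, item, tail, run_choose, run_certItem, h₀, h₁, ha, hb, hc, hd, hs, hm, hσ,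
    -bind_pure_comp]

theorem run_extract_used (j : Bool) {v₀ v₁ a b s m σ : Data}
    (h : ((v₀ ⋆ v₁) ⋆ (a ⋆ b) ⋆ s ⋆ m ⋆ σ).IsClassical) :
    (extract j false).run ((v₀ ⋆ v₁) ⋆ (a ⋆ b) ⋆ s ⋆ m ⋆ σ) =
      pure ((if j then v₁ else v₀) ⋆ σ ⋆ b) := by
  rw [extract, run_ite _ _ _ h]
  obtain ⟨⟨h₀, h₁⟩, ⟨ha, hb⟩, hs, hm, hσ⟩ := h
  simp [Pat.matches, item, tail, run_choose, h₀, h₁, ha, hb, hs, hm, hσ, -bind_pure_comp]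

/-- The probability that `(vk, cert, S, m, σ)` wins the deletion security game. -/
def deletionValue (n : ℕ) (pp sk : Data) : Data → ℂ
  | vk ⋆ c ⋆ s ⋆ m ⋆ σ =>
    match s.toSet?, m.toBit? with
    | some S, some j => acc (O.pairScheme.cert.run (unary n ⋆ pp ⋆ vk ⋆ sk ⋆ c ⋆ ofSet S)) *
        acc (O.pairScheme.ver.run (unary n ⋆ pp ⋆ vk ⋆ bit j ⋆ σ)) *
        ind (decide (j ∉ S ∧ S.card ≤ 1))
    | _, _ => 0
  | _ => 0

theorem coeff_deletionSecurityGame (A : QPT) (n : ℕ) :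
    (O.pairScheme.deletionSecurityGame A n).coeff true =
      (O.setupDist n).expect fun x =>
        ((A.seq measure).run (unary n ⋆ x.1)).expect (O.deletionValue n x.1 x.2) := by
  simp only [DSRKey.deletionSecurityGame, Mix.coeff_bind_eq_expect]
  rw [expect_pairSetup]
  simp only [run_seq, Mix.expect_bind]
  refine Mix.expect_congr fun x _ => Mix.expect_congr fun d _ => ?_
  rw [run_measure]
  refine Mix.expect_congr fun e _ => ?_
  unfold deletionValue
  split
  · simp only [unpair_pair, Mix.expect_pure]
    split
    · simp only [Mix.coeff_bind_eq_expect, Mix.coeff_pure_true, ind_and, acc,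
        Mix.expect_mul_left, Mix.expect_mul_right]
    · exact Mix.coeff_pure_true false
  · rename_i hne
    rcases e with _ | _ | _ | ⟨a, _ | _ | _ | ⟨b, _ | _ | _ | ⟨c, _ | _ | _ | ⟨d, e⟩⟩⟩⟩
    all_goals first
      | exact (hne _ _ _ _ _ rfl).elim
      | exact Mix.expect_zero _
      | (simp only [unpair_pair, Mix.expect_pure]; exact Mix.expect_zero _)

/-- For one-bit messages, `j ∉ S` leaves only `S = ∅` and `S = {!j}`. In both cases an accepted
certificate holds a signature of `1` under key `j`, at a place determined by `j` and `fresh`. Every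
other output is worth zero, and any extractor does at least as well. -/
theorem deletionValue_le (n : ℕ) {pp sk d : Data} (hpp : pp.IsClassical) (hsk : sk.IsClassical)
    (hd : d.IsClassical) :
    ∃ j fresh, O.deletionValue n pp sk d ≤ O.winProb n pp sk (extract j fresh) d := by
  have trivial_case : O.deletionValue n pp sk d = 0 →
      ∃ j fresh, O.deletionValue n pp sk d ≤ O.winProb n pp sk (extract j fresh) d := fun h =>
    ⟨false, false, h ▸ O.winProb_nonneg n hpp hsk _ hd⟩
  by_cases hform : ∃ vk c s m σ, d = vk ⋆ c ⋆ s ⋆ m ⋆ σ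
  swap
  · apply trivial_case
    unfold deletionValue
    split
    · exact (hform ⟨_, _, _, _, _, rfl⟩).elim
    · rfl
  obtain ⟨vk, c, s, m, σ, rfl⟩ := hform
  obtain ⟨hvk, hc, hs, hm, hσ⟩ := id hd
  by_cases hS : ∃ S, s.toSet? = some S
  swap
  · apply trivial_case
    simp only [deletionValue]
    split
    · exact (hS ⟨_, ‹_›⟩).elim
    · rfl
  obtain ⟨S, hS⟩ := hS
  by_cases hj : ∃ j, m.toBit? = some j
  swap
  · apply trivial_case
    simp only [deletionValue]
    split
    · exact (hj ⟨_, ‹_›⟩).elim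
    · rfl
  obtain ⟨j, hj⟩ := hj
  have hval : O.deletionValue n pp sk (vk ⋆ c ⋆ s ⋆ m ⋆ σ) =
      acc (O.pairScheme.cert.run (unary n ⋆ pp ⋆ vk ⋆ sk ⋆ c ⋆ ofSet S)) *
        acc (O.pairScheme.ver.run (unary n ⋆ pp ⋆ vk ⋆ bit j ⋆ σ)) *
        ind (decide (j ∉ S ∧ S.card ≤ 1)) := by
    simp only [deletionValue, hS, hj]
  by_cases hpair : ∃ v₀ v₁, vk = v₀ ⋆ v₁
  swap
  · apply trivial_case
    have : O.pairScheme.ver.run (unary n ⋆ pp ⋆ vk ⋆ bit j ⋆ σ) = pure (bit false) :=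
      O.run_pairVer_malformed n j hpp hvk hσ fun v₀ v₁ h => hpair ⟨v₀, v₁, h⟩
    rw [hval, this, acc_pure]
    simp [accepts]
  obtain ⟨v₀, v₁, rfl⟩ := hpair
  by_cases hjS : j ∈ S
  · apply trivial_case
    rw [hval]
    simp [hjS]
  have hver : O.pairScheme.ver.run (unary n ⋆ pp ⋆ (v₀ ⋆ v₁) ⋆ bit j ⋆ σ) = _ :=
    O.run_pairVer n j hpp hvk.1 hvk.2 hσ
  have hv : (if j then v₁ else v₀).IsClassical := by cases j; exacts [hvk.1, hvk.2]
  -- Messages are bits, so excluding `j` already bounds the size of `S`.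
  have hcard : S.card ≤ 1 := by
    have : S ⊆ {!j} := fun b hb => by
      cases j <;> cases b <;> simp_all
    exact Finset.card_le_card this
  rw [O.acc_pairCert n S hpp hvk.1 hvk.2 hsk hc, hver] at hval
  simp only [hjS, not_false_eq_true, hcard, and_self, decide_true, ind_true, mul_one] at hval
  by_cases hempty : S = ∅
  · subst hempty
    by_cases hcf : ∃ σ₀ σ₁, c = bit false ⋆ bit true ⋆ σ₀ ⋆ σ₁
    · obtain ⟨σ₀, σ₁, rfl⟩ := hcf
      refine ⟨j, true, ?_⟩
      have hσ' : (if j then σ₁ else σ₀).IsClassical := by cases j; exacts [hc.2.2.1, hc.2.2.2]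
      rw [hval, O.winProb_eq n (run_extract_fresh j hd)
        (isClassical_pair.mpr ⟨hv, isClassical_pair.mpr ⟨hσ, hσ'⟩⟩), acc_pairCert_empty, mul_comm]
      -- The certificate is checked under both keys; the factor of the key other than `j` is at most
      -- one and is dropped.
      refine mul_le_mul_of_nonneg_left ?_ (O.p₀_nonneg n hpp hv hσ)
      cases j
      · exact mul_le_of_le_one_right (O.p₁_nonneg n hpp hsk hvk.1 hc.2.2.1)
          (O.p₁_le_one n hpp hsk hvk.2 hc.2.2.2)
      · exact mul_le_of_le_one_left (O.p₁_nonneg n hpp hsk hvk.2 hc.2.2.2)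
          (O.p₁_le_one n hpp hsk hvk.1 hc.2.2.1)
    · apply trivial_case
      have : pairCert O n pp v₀ v₁ sk c ∅ = pure (bit false) := by
        unfold pairCert
        rw [if_pos rfl]
        split
        · exact (hcf ⟨_, _, rfl⟩).elim
        · rfl
      rw [hval, this, acc_pure]
      simp [accepts]
  · have hSj : S = {!j} := by
      ext b
      have h1 : S.Nonempty := Finset.nonempty_iff_ne_empty.mpr hempty
      obtain ⟨b', hb'⟩ := h1
      cases j <;> cases b <;> cases b' <;> simp_all
    subst hSj
    by_cases hcf : ∃ τ, c = bit j ⋆ τ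
    · obtain ⟨τ, rfl⟩ := hcf
      refine ⟨j, false, ?_⟩
      have := O.acc_pairCert_singleton n pp v₀ v₁ sk τ (!j)
      rw [Bool.not_not] at this
      rw [hval, O.winProb_eq n (run_extract_used j hd)
        (isClassical_pair.mpr ⟨hv, isClassical_pair.mpr ⟨hσ, hc.2⟩⟩), this, mul_comm]
      cases j <;> exact le_rfl
    · apply trivial_case
      have : pairCert O n pp v₀ v₁ sk c {!j} = pure (bit false) := by
        unfold pairCert
        rw [if_neg hempty]
        split
        · rename_i b τ
          rw [if_neg]
          intro h
          have hb : j = b := by simpa using h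
          exact hcf ⟨τ, by rw [hb]⟩
        · rfl
      rw [hval, this, acc_pure]
      simp [accepts]

/-- No single extractor fits all outputs, but the winning probability is at most the sum over the
four, each attached to `A` as an adversary of its own. -/
theorem oneTimeDeletionSecure (h : O.Secure) : O.pairScheme.OneTimeDeletionSecure := by
  intro A
  refine (AtMostNegligible.sum Finset.univ
    fun e : Bool × Bool => h ((A.seq measure).seq (extract e.1 e.2))).mono fun n => ?_
  have key : (O.pairScheme.deletionSecurityGame A n).coeff true ≤ ∑ e : Bool × Bool,
      (O.securityGame ((A.seq measure).seq (extract e.1 e.2)) n).coeff true := by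
    have : ∀ e : Bool × Bool, (O.securityGame ((A.seq measure).seq (extract e.1 e.2)) n).coeff true
        = _ := fun e => O.coeff_securityGame _ n
    simp only [this, coeff_deletionSecurityGame, winProb_seq,
      ← Mix.expect_finset_sum]
    refine (O.isDist_setupDist n).expect_mono (O.supp_setupDist n) ?_
    rintro ⟨pp, sk⟩ ⟨hpp, hsk⟩
    have hcl : (unary n ⋆ pp).IsClassical := isClassical_pair.mpr ⟨isClassical_unary n, hpp⟩
    refine (isDist_seq_measure A hcl).expect_mono (supp_seq_measure A _) fun d hd => ?_
    obtain ⟨j, f, hle⟩ := O.deletionValue_le n hpp hsk hd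
    refine hle.trans ?_
    exact le_sum_of_nonneg (g := fun e : Bool × Bool => O.winProb n pp sk (extract e.1 e.2) d)
      (fun e => O.winProb_nonneg n hpp hsk _ hd) (j, f)
  refine (Mix.prob_le key).trans ?_
  rw [Complex.re_sum]
  exact le_rfl

end TwoTierOSS

theorem Mix.expect_fun_zero {α : Type} (μ : Mix α) : (μ.expect fun _ => 0) = 0 := by
  simp [Mix.expect]

namespace QPT

/-! ### Running a forger with two keys -/

/-- Turn every datum that is not a pair into `(nil, bit j)`. -/
def normQuery (j : Bool) : QPT :=
  shape ((constant j).seq addNil) ((constant j).seq addNil) ((constant j).seq addNil) skip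

theorem run_normQuery_pair (j : Bool) (a b : Data) :
    (normQuery j).run (a ⋆ b) = pure (a ⋆ b) := by
  simp [normQuery, run_shape, shapeMap]

theorem supp_normQuery (j : Bool) {v : Data} (hv : ∀ a b, v ≠ a ⋆ b) :
    ((normQuery j).run v).Supp fun d => d = nil ⋆ bit j := by
  have h : ∀ v, (((constant j).seq addNil).run v).Supp fun d => d = nil ⋆ bit j := fun v => by
    rw [run_seq]
    refine (supp_constant j v).bind ?_
    rintro _ rfl
    rw [run_addNil]
    exact Mix.supp_pure rfl
  rw [normQuery, run_shape]
  cases v with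
  | pair a b => exact (hv a b rfl).elim
  | _ => exact h _

/-- The reply to a query, on `(query, σ)`: the signature `σ` if the query is the bit `b`. -/
def reply (b : Bool) : QPT := ite (.pair (.bit b) .any) snd discard

/-- The second half of `simulate`, on `(σ, (st, q))`. -/
def simulateReply (A : QPT) (j : Bool) : QPT :=
  (par skip (par skip measure)).seq (swap.seq (assoc.seq ((par skip (fork (reply (!j)) fst)).seq
    (assocInv.seq (par (A.seq measure) skip)))))

/-- Run a forger on `(σ, (1ⁿ, vk))`, where `σ` is the reply to the query `!j`.  The output consists of
the forgery and the query. -/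
def simulate (A : QPT × QPT) (j : Bool) : QPT :=
  (par skip (A.1.seq (normQuery j))).seq (simulateReply A.2 j)

theorem run_reply (b : Bool) {q σ : Data} (hq : q.IsClassical) (hσ : σ.IsClassical) :
    (reply b).run (q ⋆ σ) = pure (if q.toBit? = some b then σ else nil) := by
  have hc : (q ⋆ σ).IsClassical := isClassical_pair.mpr ⟨hq, hσ⟩
  rw [reply, run_ite _ _ _ hc, run_snd _ hq, run_discard_classical hc]
  cases q with
  | bit c => cases b <;> cases c <;> simp [Pat.matches, toBit?]
  | _ => simp [Pat.matches, toBit?]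

theorem expect_simulateReply (A : QPT) (j : Bool) (st q : Data) {σ : Data} (hσ : σ.IsClassical)
    (g : Data → ℂ) : ((simulateReply A j).run (σ ⋆ st ⋆ q)).expect g = q.measure.expect fun q' =>
      ((A.seq measure).run (st ⋆ if q'.toBit? = some (!j) then σ else nil)).expect
        fun o => g (o ⋆ q') := by
  simp only [simulateReply, run_seq, run_par, run_skip, run_measure, run_swap, run_assoc,
    LawfulMonad.pure_bind, bind_assoc, Mix.expect_bind]
  refine Mix.expect_congr fun q' hq' => ?_
  have hc := supp_measure q q' hq'
  rw [run_fork _ _ (isClassical_pair.mpr ⟨hc, hσ⟩), run_reply _ hc hσ, run_fst _ hσ]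
  simp only [run_seq, run_par, run_skip, run_measure, run_assocInv,
    LawfulMonad.pure_bind, bind_assoc, Mix.expect_bind, Mix.expect_pure]

theorem expect_simulate (A : QPT × QPT) (j : Bool) {σ : Data} (v : Data) (g : Data → ℂ) :
    ((simulate A j).run (σ ⋆ v)).expect g = (A.1.run v).expect fun d =>
      ((normQuery j).run d).expect fun e => ((simulateReply A.2 j).run (σ ⋆ e)).expect g := by
  simp only [simulate, run_seq, run_par, run_skip, LawfulMonad.pure_bind, bind_assoc,
    Mix.expect_bind]

/-- Normalising the first phase ensures that even a misbehaving forger reaches the final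
measurement, so the simulation always yields a genuine distribution. -/
theorem supp_simulate (A : QPT × QPT) (j : Bool) {σ : Data} (hσ : σ.IsClassical) (v : Data) :
    ((simulate A j).run (σ ⋆ v)).Supp Data.IsClassical := by
  simp only [simulate, run_seq, run_par, run_skip, LawfulMonad.pure_bind, bind_assoc]
  refine (Mix.supp_true _).bind fun d _ => ?_
  refine Mix.Supp.bind (P := fun e => ∃ a b, e = a ⋆ b) ?_ ?_
  · by_cases h : ∃ a b, d = a ⋆ b
    · obtain ⟨a, b, rfl⟩ := h
      rw [run_normQuery_pair]
      exact Mix.supp_pure ⟨a, b, rfl⟩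
    · exact (supp_normQuery j fun a b hab => h ⟨a, b, hab⟩).mono fun _ he => ⟨_, _, he⟩
  · rintro _ ⟨st, q, rfl⟩
    simp only [simulateReply, run_seq, run_par, run_skip, run_measure, run_swap, run_assoc,
      LawfulMonad.pure_bind, bind_assoc]
    refine (supp_measure q).bind fun q' hc => ?_
    rw [run_fork _ _ (isClassical_pair.mpr ⟨hc, hσ⟩), run_reply _ hc hσ, run_fst _ hσ]
    simp only [run_seq, run_par, run_skip, run_measure, run_assocInv,
      LawfulMonad.pure_bind, bind_assoc]
    exact (Mix.supp_true _).bind fun o _ => (supp_measure o).bind fun o' ho' =>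
      Mix.supp_pure (isClassical_pair.mpr ⟨ho', hc⟩)

end QPT

namespace TwoTierOSS

open QPT

variable (O : TwoTierOSS)

/-! ### Unforgeability -/

/-- The probability that the output of a forger wins, for a given query. -/
def forgeValue (n : ℕ) (pp vk : Data) (query : Option Bool) : Data → ℂ
  | m ⋆ σ =>
    match m.toBit? with
    | some j => acc (O.pairScheme.ver.run (unary n ⋆ pp ⋆ vk ⋆ bit j ⋆ σ)) *
        ind (decide (query ≠ some j))
    | none => 0
  | _ => 0

/-- The expectation of `g` over the reply of the signing oracle. -/
def oracleValue (n : ℕ) (k : Bool → Data) (query : Option Bool) (g : Data → ℂ) : ℂ :=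
  match query with
  | some m => (O.sign.run (unary n ⋆ k m ⋆ bit false)).expect fun σ => tr (k !m) * g σ
  | none => tr (k false) * tr (k true) * g nil

/-- The probability of a forgery, for given keys. -/
def forgeryValue (A : QPT × QPT) (n : ℕ) (pp : Data) (k : Bool → Data × Data) : ℂ :=
  (A.1.run (unary n ⋆ (k false).2 ⋆ (k true).2)).expect fun d => d.unpair.expect fun r =>
    r.2.measure.expect fun q => O.oracleValue n (fun j => (k j).1) q.toBit? fun a =>
      ((A.2.seq measure).run (r.1 ⋆ a)).expect
        (O.forgeValue n pp ((k false).2 ⋆ (k true).2) q.toBit?)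

/-- Two keys as a family. -/
def keyPair (x y : Data × Data) (j : Bool) : Data × Data := if j then y else x

theorem coeff_forgeryGame (A : QPT × QPT) (n : ℕ) :
    (O.pairScheme.forgeryGame A n).coeff true =
      (O.setupDist n).expect fun x => (O.keyMix n x.1).expect fun y => (O.keyMix n x.1).expect
        fun z => O.forgeryValue A n x.1 (keyPair y z) := by
  simp only [DSRKey.forgeryGame, Mix.coeff_bind_eq_expect]
  rw [expect_pairSetup]
  refine Mix.expect_congr fun x hx => ?_
  obtain ⟨hpp, hsk⟩ := O.supp_setupDist n x hx
  simp only
  rw [O.expect_pairKeyGen n hpp]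
  refine Mix.expect_congr fun y _ => Mix.expect_congr fun z _ => ?_
  refine Mix.expect_congr fun d _ => Mix.expect_congr fun r _ => Mix.expect_congr fun q _ => ?_
  have hfinal : ∀ a : Data, ((A.2.run (r.1 ⋆ a)).expect fun e => e.measure.expect fun f =>
      f.unpair.expect fun w => Mix.coeff (match w.1.toBit? with
        | some m => do
            let v ← O.pairScheme.ver.run (unary n ⋆ x.1 ⋆ (y.2 ⋆ z.2) ⋆ bit m ⋆ w.2)
            pure (v.accepts && decide (q.toBit? ≠ some m))
        | none => pure false) true) =
      ((A.2.seq measure).run (r.1 ⋆ a)).expect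
        (O.forgeValue n x.1 (y.2 ⋆ z.2) q.toBit?) := by
    intro a
    rw [run_seq, Mix.expect_bind]
    refine Mix.expect_congr fun e _ => ?_
    rw [run_measure]
    refine Mix.expect_congr fun f _ => ?_
    unfold forgeValue
    split
    · rw [unpair_pair, Mix.expect_pure]
      simp only
      split
      · simp only [Mix.coeff_bind_eq_expect, Mix.coeff_pure_true, ind_and, acc,
          Mix.expect_mul_right]
      · exact Mix.coeff_pure_true false
    · rename_i hne
      cases f with
      | pair a b => exact (hne a b rfl).elim
      | _ => exact Mix.expect_zero _
  have hfalse : keyPair y z false = y := rfl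
  have htrue : keyPair y z true = z := rfl
  simp only [oracleValue, hfalse, htrue]
  split
  · rename_i m hm
    simp only [hm] at hfinal ⊢
    simp only [Mix.coeff_bind_eq_expect]
    rw [O.expect_pairSign n hpp]
    simp only [expect_drop, tr_usedKey, Mix.expect_pure]
    cases m <;> exact Mix.expect_congr fun σ _ => congrArg _ (hfinal σ)
  · rename_i hm
    simp only [hm] at hfinal ⊢
    simp only [Mix.coeff_bind_eq_expect, expect_drop, Mix.expect_pure, tr_freshKey]
    exact congrArg _ (hfinal nil)

/-- The probability that the output of `simulate` is a forgery under key number `j`. -/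
def targetValue (n : ℕ) (pp : Data) (j : Bool) (vk : Data) : Data → ℂ
  | (m ⋆ σ) ⋆ q => if m.toBit? = some j ∧ q.toBit? ≠ some j then O.p₀ n pp vk σ else 0
  | _ => 0

/-- A query of the target message forfeits the game. Hence the simulator need not be able to answer
it, and may use it to mark failure. -/
theorem targetValue_eq_zero (n : ℕ) (pp : Data) (j : Bool) (vk o : Data) :
    O.targetValue n pp j vk (o ⋆ bit j) = 0 := by
  unfold targetValue
  split
  · rename_i h
    rw [pair.injEq] at h
    rw [if_neg]
    simp [← h.2, toBit?]
  · rfl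

/-- A forgery names one message, so winning splits disjointly according to the target key. -/
theorem forgeValue_eq (n : ℕ) {pp o q : Data} (vk : Bool → Data)
    (hpp : pp.IsClassical) (hvk : ∀ j, (vk j).IsClassical) (ho : o.IsClassical) :
    O.forgeValue n pp (vk false ⋆ vk true) q.toBit? o =
      O.targetValue n pp false (vk false) (o ⋆ q) + O.targetValue n pp true (vk true) (o ⋆ q) := by
  cases o with
  | pair m σ =>
    simp only [forgeValue, targetValue]
    cases hm : m.toBit? with
    | none => simp
    | some j =>
      have hver : O.pairScheme.ver.run (unary n ⋆ pp ⋆ (vk false ⋆ vk true) ⋆ bit j ⋆ σ) = _ :=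
        O.run_pairVer n j hpp (hvk false) (hvk true) ho.2
      simp only [hver]
      by_cases hq : q.toBit? = some j <;> cases j <;> simp [hq, p₀]
  | _ => simp [forgeValue, targetValue]

/-- The reply of the oracle, for one of the targets. -/
theorem oracleValue_target (A : QPT) (n : ℕ) {pp st q : Data} (k : Bool → Data × Data)
    (hpp : pp.IsClassical) (hk : ∀ j, (k j).2.IsClassical) :
    (O.oracleValue n (fun j => (k j).1) q.toBit? fun a => ((A.seq measure).run (st ⋆ a)).expect
      (O.forgeValue n pp ((k false).2 ⋆ (k true).2) q.toBit?)) =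
    ∑ j, (O.sign.run (unary n ⋆ (k !j).1 ⋆ bit false)).expect fun σ => tr (k j).1 *
      ((A.seq measure).run (st ⋆ if q.toBit? = some (!j) then σ else nil)).expect fun o =>
        O.targetValue n pp j (k j).2 (o ⋆ q) := by
  have hsplit : ∀ a, ((A.seq measure).run (st ⋆ a)).expect
      (O.forgeValue n pp ((k false).2 ⋆ (k true).2) q.toBit?) =
      (((A.seq measure).run (st ⋆ a)).expect fun o => O.targetValue n pp false (k false).2 (o ⋆ q)) +
      ((A.seq measure).run (st ⋆ a)).expect fun o => O.targetValue n pp true (k true).2 (o ⋆ q) := by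
    intro a
    rw [← Mix.expect_add]
    exact Mix.expect_congr fun o ho => O.forgeValue_eq n (fun j => (k j).2) hpp hk
      (supp_seq_measure A _ o ho)
  -- After a query of `j` only the target `!j` can still contribute, and its simulator holds exactly
  -- the signature that was asked for.
  have hz : ∀ (j : Bool) (v : Data) (μ : Mix Data), q.toBit? = some j →
      (μ.expect fun o => O.targetValue n pp j v (o ⋆ q)) = 0 := by
    intro j v μ hq
    have : q = bit j := by
      cases q <;> simp_all [toBit?]
    subst this
    simp only [targetValue_eq_zero, Mix.expect_fun_zero]
  simp only [Fintype.sum_bool, hsplit]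
  cases hq : q.toBit? with
  | none =>
    -- Without a query the prepared signature is never used and contributes only the trace of its
    -- signing key, as in the game.
    simp [oracleValue, expect_sign_const]
    ring
  | some m =>
    cases m <;> simp [oracleValue, hz _ _ _ hq, Mix.expect_fun_zero]

/-- The probability that `simulate` forges under key number `j`. -/
def simulateValue (A : QPT × QPT) (n : ℕ) (pp : Data) (j : Bool) (v v' σ : Data) : ℂ :=
  ((simulate A j).run (σ ⋆ unary n ⋆ if j then v' ⋆ v else v ⋆ v')).expect
    (O.targetValue n pp j v)

/-- The simulation is exact. The oracle's signature involves only a key independent of the forger's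
state, so it can be produced before the first phase and released or thrown away later. -/
theorem forgeryValue_eq (A : QPT × QPT) (n : ℕ) {pp : Data} (k : Bool → Data × Data)
    (hpp : pp.IsClassical) (hk : ∀ j, (k j).2.IsClassical) :
    O.forgeryValue A n pp k = ∑ j, (O.sign.run (unary n ⋆ (k !j).1 ⋆ bit false)).expect fun σ =>
      tr (k j).1 * O.simulateValue A n pp j (k j).2 (k !j).2 σ := by
  have hvk : ∀ j : Bool, (if j then (k !j).2 ⋆ (k j).2 else (k j).2 ⋆ (k !j).2) =
      (k false).2 ⋆ (k true).2 := by
    intro j; cases j <;> rfl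
  simp only [simulateValue, hvk, expect_simulate, forgeryValue]
  -- Here signing and the forger's first phase change places.
  simp only [← Mix.expect_mul_left (A.1.run _), Mix.expect_comm (O.sign.run _) (A.1.run _),
    ← Mix.expect_finset_sum]
  refine Mix.expect_congr fun d _ => ?_
  by_cases hd : ∃ st q, d = st ⋆ q
  · obtain ⟨st, q, rfl⟩ := hd
    simp only [unpair_pair, Mix.expect_pure, run_normQuery_pair]
    have : ∀ j, ((O.sign.run (unary n ⋆ (k !j).1 ⋆ bit false)).expect fun σ => tr (k j).1 *
        ((simulateReply A.2 j).run (σ ⋆ st ⋆ q)).expect (O.targetValue n pp j (k j).2)) =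
        q.measure.expect fun q' => (O.sign.run (unary n ⋆ (k !j).1 ⋆ bit false)).expect fun σ =>
          tr (k j).1 * ((A.2.seq measure).run
            (st ⋆ if q'.toBit? = some (!j) then σ else nil)).expect fun o =>
              O.targetValue n pp j (k j).2 (o ⋆ q') := by
      intro j
      rw [Mix.expect_comm]
      refine Mix.expect_congr fun σ hσ => ?_
      rw [expect_simulateReply _ _ _ _ (O.sign_out n _ _ σ hσ), Mix.expect_mul_left]
    simp only [this, ← Mix.expect_finset_sum]
    exact Mix.expect_congr fun q' _ => O.oracleValue_target A.2 n k hpp hk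
  · have hd' : ∀ a b, d ≠ a ⋆ b := fun a b h => hd ⟨a, b, h⟩
    -- In the game a first phase that does not output a pair loses its weight. The simulator turns
    -- it into the query `j`, which is worth zero for the target `j`.
    have hz : ∀ j, ((O.sign.run (unary n ⋆ (k !j).1 ⋆ bit false)).expect fun σ => tr (k j).1 *
        ((normQuery j).run d).expect fun e => ((simulateReply A.2 j).run (σ ⋆ e)).expect
          (O.targetValue n pp j (k j).2)) = 0 := by
      intro j
      rw [← Mix.expect_fun_zero]
      refine Mix.expect_congr fun σ hσ => ?_
      refine mul_eq_zero_of_right _ ?_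
      rw [← Mix.expect_fun_zero]
      refine Mix.expect_congr fun e he => ?_
      rw [supp_normQuery j hd' e he, expect_simulateReply _ _ _ _ (O.sign_out n _ _ σ hσ)]
      simp only [Data.measure, Mix.expect_pure, targetValue_eq_zero, Mix.expect_fun_zero]
    simp only [hz, Finset.sum_const_zero]
    cases d with
    | pair a b => exact (hd' a b rfl).elim
    | _ => exact Mix.expect_zero _

end TwoTierOSS

/-! ### The target key is independent of its signing key's fate -/

namespace TwoTierOSS

open QPT

variable (O : TwoTierOSS)

theorem targetValue_le_one (n : ℕ) {pp v d : Data} (j : Bool) (hpp : pp.IsClassical)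
    (hv : v.IsClassical) (hd : d.IsClassical) : O.targetValue n pp j v d ≤ 1 := by
  unfold targetValue
  split
  · split_ifs
    · exact O.p₀_le_one n hpp hv hd.1.2
    · exact zero_le_one
  · exact zero_le_one

theorem isDist_simulate (A : QPT × QPT) (j : Bool) {σ v : Data} (hσ : σ.IsClassical)
    (hv : v.IsClassical) : ((simulate A j).run (σ ⋆ v)).IsDist :=
  QPT.isDist_run _ (isClassical_pair.mpr ⟨hσ, hv⟩) (supp_simulate A j hσ v)

theorem isClassical_simulateInput (n : ℕ) (j : Bool) {v v' : Data} (hv : v.IsClassical)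
    (hv' : v'.IsClassical) : (unary n ⋆ if j then v' ⋆ v else v ⋆ v').IsClassical := by
  cases j <;> simp [hv, hv']

theorem simulateValue_le_one (A : QPT × QPT) (n : ℕ) {pp v v' σ : Data} (j : Bool)
    (hpp : pp.IsClassical) (hv : v.IsClassical) (hv' : v'.IsClassical) (hσ : σ.IsClassical) :
    O.simulateValue A n pp j v v' σ ≤ 1 :=
  (isDist_simulate A j hσ (isClassical_simulateInput n j hv hv')).expect_le_one
    (supp_simulate A j hσ _) fun _ hd => O.targetValue_le_one n j hpp hv hd

/-- The probability of a forgery under the key number `j`, if this key is `v`. -/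
def targetProb (A : QPT × QPT) (n : ℕ) (pp : Data) (j : Bool) (v : Data) : ℂ :=
  (O.keySigDist n pp false).expect fun x => O.simulateValue A n pp j v x.1 x.2

theorem targetProb_le_one (A : QPT × QPT) (n : ℕ) {pp v : Data} (j : Bool)
    (hpp : pp.IsClassical) (hv : v.IsClassical) : O.targetProb A n pp j v ≤ 1 :=
  (O.isDist_keySigDist n hpp false).expect_le_one (O.supp_keySigDist n hpp false)
    fun _ hx => O.simulateValue_le_one A n j hpp hv hx.1 hx.2

/-- The right side does not involve `b` or any signature: as far as the verification key is
concerned, signing and then forgetting equals discarding. This lets the reduction sign `1` under the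
key it hands to the forger. -/
theorem expect_keySigDist_fst (n : ℕ) (pp : Data) (b : Bool) (g : Data → ℂ) :
    ((O.keySigDist n pp b).expect fun x => g x.1) =
      (O.keyMix n pp).expect fun x => tr x.1 * g x.2 := by
  rw [expect_keySigDist]
  exact Mix.expect_congr fun x _ => O.expect_sign_const n x.1 b (g x.2)

/-- For each target, the trace factor of the target key is traded for a signature of `1`, and the
other key becomes a sample with a signature of `0`. -/
theorem expect_forgeryValue (A : QPT × QPT) (n : ℕ) {pp : Data} (hpp : pp.IsClassical) :
    ((O.keyMix n pp).expect fun y => (O.keyMix n pp).expect fun z =>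
      O.forgeryValue A n pp (keyPair y z)) =
      ∑ j, (O.keySigDist n pp true).expect fun x => O.targetProb A n pp j x.1 := by
  have h : ∀ j, ((O.keySigDist n pp true).expect fun x => O.targetProb A n pp j x.1) =
      (O.keyMix n pp).expect fun y => (O.keyMix n pp).expect fun z =>
        (O.sign.run (unary n ⋆ z.1 ⋆ bit false)).expect fun σ =>
          tr y.1 * O.simulateValue A n pp j y.2 z.2 σ := by
    intro j
    rw [expect_keySigDist_fst]
    simp only [targetProb, expect_keySigDist, Mix.expect_mul_left]
  -- For `j = true` the target is the second key, so the two key samples are interchanged before the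
  -- terms are added.
  rw [Fintype.sum_bool, (h true).trans (Mix.expect_comm _ _ _), h false, ← Mix.expect_add]
  refine Mix.expect_congr fun y hy => ?_
  rw [← Mix.expect_add]
  refine Mix.expect_congr fun z hz => ?_
  rw [O.forgeryValue_eq A n _ hpp, Fintype.sum_bool]
  · rfl
  · intro j
    cases j
    exacts [O.supp_keyMix n hpp y hy, O.supp_keyMix n hpp z hz]

/-! ### From a forger to an adversary against the one-shot signature scheme -/

/-- The input of `simulate`, from `((v, τ), (1ⁿ, pp))` and `(v', σ)`. -/
def simulateInput (j : Bool) : QPT :=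
  fork (snd.seq snd) (fork (fst.seq (snd.seq fst))
    (if j then fork (snd.seq fst) (fst.seq (fst.seq fst))
      else fork (fst.seq (fst.seq fst)) (snd.seq fst)))

theorem run_simulateInput (j : Bool) {n pp v τ v' σ : Data}
    (h : (((v ⋆ τ) ⋆ n ⋆ pp) ⋆ v' ⋆ σ).IsClassical) :
    (simulateInput j).run (((v ⋆ τ) ⋆ n ⋆ pp) ⋆ v' ⋆ σ) =
      pure (σ ⋆ n ⋆ if j then v' ⋆ v else v ⋆ v') := by
  obtain ⟨⟨⟨hv, hτ⟩, hn, hpp⟩, hv', hσ⟩ := h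
  cases j <;> simp [simulateInput, hv, hτ, hn, hpp, hv', hσ, -bind_pure_comp]

/-- From the output `((m, σ), q)` of `simulate` and `(v, τ)`, form `(v, σ, τ)`. -/
def collect : QPT :=
  ite (.pair (.pair (.pair .any .any) .any) (.pair .any .any))
    (fork (snd.seq fst) (fork (fst.seq (fst.seq snd)) (snd.seq snd))) (constant false)

theorem run_collect {m σ q v τ : Data} (h : (((m ⋆ σ) ⋆ q) ⋆ v ⋆ τ).IsClassical) :
    collect.run (((m ⋆ σ) ⋆ q) ⋆ v ⋆ τ) = pure (v ⋆ σ ⋆ τ) := by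
  rw [collect, run_ite _ _ _ h]
  obtain ⟨⟨⟨hm, hσ⟩, hq⟩, hv, hτ⟩ := h
  simp [Pat.matches, hm, hσ, hq, hv, hτ, -bind_pure_comp]

/-- Sign `1` under a key of one's own, and let a forger sign `0` under it. -/
def breaker (A : QPT × QPT) (j : Bool) : QPT :=
  (fork (O.keySign true) skip).seq ((fork skip (snd.seq (O.keySign false))).seq
    ((fork ((simulateInput j).seq (simulate A j)) (fst.seq fst)).seq collect))

theorem targetValue_mul_le (n : ℕ) {pp sk v τ d : Data} (j : Bool) (hpp : pp.IsClassical)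
    (hsk : sk.IsClassical) (hv : v.IsClassical) (hτ : τ.IsClassical) (hd : d.IsClassical) :
    O.targetValue n pp j v d * O.p₁ n pp sk v τ ≤ O.winProb n pp sk collect (d ⋆ v ⋆ τ) := by
  have hc : (d ⋆ v ⋆ τ).IsClassical := isClassical_pair.mpr ⟨hd, isClassical_pair.mpr ⟨hv, hτ⟩⟩
  have hnonneg := O.winProb_nonneg n hpp hsk collect hc
  unfold targetValue
  split
  · rename_i m σ q
    split_ifs
    · rw [O.winProb_eq n (run_collect hc) (isClassical_pair.mpr
        ⟨hv, isClassical_pair.mpr ⟨hd.1.2, hτ⟩⟩), forkValue]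
    · rwa [zero_mul]
  · rwa [zero_mul]

/-- With `(v, τ)` fixed, forging under `v` and acceptance of `τ` by `ver₁` are independent, and
together they are a win for the remaining stages of `breaker`. -/
theorem targetProb_mul_le (A : QPT × QPT) (n : ℕ) {pp sk v τ : Data} (j : Bool)
    (hpp : pp.IsClassical) (hsk : sk.IsClassical) (hv : v.IsClassical) (hτ : τ.IsClassical) :
    O.targetProb A n pp j v * O.p₁ n pp sk v τ ≤ O.winProb n pp sk
      ((fork skip (snd.seq (O.keySign false))).seq
        ((fork ((simulateInput j).seq (simulate A j)) (fst.seq fst)).seq collect))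
      ((v ⋆ τ) ⋆ unary n ⋆ pp) := by
  have hc : ((v ⋆ τ) ⋆ unary n ⋆ pp).IsClassical := by simp [hpp, hv, hτ]
  rw [winProb_seq, run_fork _ _ hc, run_skip, LawfulMonad.pure_bind, run_seq,
    run_snd _ (isClassical_pair.mpr ⟨hv, hτ⟩), LawfulMonad.pure_bind, O.run_keySign n hpp,
    bind_assoc, Mix.expect_bind, targetProb, ← Mix.expect_mul_right]
  refine (O.isDist_keySigDist n hpp false).expect_mono (O.supp_keySigDist n hpp false) ?_
  rintro ⟨v', σ⟩ ⟨hv', hσ⟩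
  have hc' : (((v ⋆ τ) ⋆ unary n ⋆ pp) ⋆ v' ⋆ σ).IsClassical := by simp [hpp, hv, hτ, hv', hσ]
  have hfst : (fst.seq fst).run (((v ⋆ τ) ⋆ unary n ⋆ pp) ⋆ v' ⋆ σ) = pure (v ⋆ τ) := by
    rw [run_seq, run_fst _ hc'.2, LawfulMonad.pure_bind, run_fst _ hc.2]
  rw [LawfulMonad.pure_bind, Mix.expect_pure, winProb_seq, run_fork _ _ hc', run_seq,
    run_simulateInput j hc', LawfulMonad.pure_bind, hfst, Mix.expect_bind, simulateValue,
    ← Mix.expect_mul_right]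
  refine (isDist_simulate A j hσ (isClassical_simulateInput n j hv hv')).expect_mono
    (supp_simulate A j hσ _) fun d hd => ?_
  rw [LawfulMonad.pure_bind, Mix.expect_pure]
  exact O.targetValue_mul_le n j hpp hsk hv hτ hd

/-- A forgery either meets an accepted signature of `1`, which breaks the one-shot scheme, or
coincides with a failure of honest `ver₁`-correctness. -/
theorem expect_targetProb_le (A : QPT × QPT) (n : ℕ) {pp sk : Data} (j : Bool)
    (hpp : pp.IsClassical) (hsk : sk.IsClassical) :
    ((O.keySigDist n pp true).expect fun x => O.targetProb A n pp j x.1) ≤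
      O.winProb n pp sk (O.breaker A j) (unary n ⋆ pp) + (1 - O.c₁ n pp sk) := by
  have hc : (unary n ⋆ pp).IsClassical := isClassical_pair.mpr ⟨isClassical_unary n, hpp⟩
  have hdist := O.isDist_keySigDist n hpp true
  rw [breaker, winProb_seq, run_fork _ _ hc, run_skip, O.run_keySign n hpp, bind_assoc,
    Mix.expect_bind, c₁, ← hdist.mass, ← Mix.expect_sub, ← Mix.expect_add]
  refine hdist.expect_mono (O.supp_keySigDist n hpp true) ?_
  rintro ⟨v, τ⟩ ⟨hv, hτ⟩
  rw [LawfulMonad.pure_bind, LawfulMonad.pure_bind, Mix.expect_pure]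
  refine le_trans ?_ (add_le_add_left (O.targetProb_mul_le A n j hpp hsk hv hτ) _)
  -- The union bound `a ≤ a * b + (1 - b)` is `(1 - a) * (1 - b) ≥ 0` expanded.
  have h := mul_nonneg (sub_nonneg.mpr (O.targetProb_le_one A n j hpp hv))
    (sub_nonneg.mpr (O.p₁_le_one n hpp hsk hv hτ))
  rw [← sub_nonneg]
  convert h using 1
  ring

theorem coeff_forgeryGame_le (A : QPT × QPT) (n : ℕ) : (O.pairScheme.forgeryGame A n).coeff true ≤
    ∑ j, ((O.securityGame (O.breaker A j) n).coeff true + (1 - (O.correctGame₁ n).coeff true)) := by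
  have hdist := O.isDist_setupDist n
  have : ∀ j, (O.securityGame (O.breaker A j) n).coeff true = _ :=
    fun j => O.coeff_securityGame _ n
  simp only [this]
  rw [coeff_correctGame₁, ← hdist.mass, ← Mix.expect_sub]
  simp only [← Mix.expect_add, ← Mix.expect_finset_sum]
  rw [coeff_forgeryGame]
  refine hdist.expect_mono (O.supp_setupDist n) ?_
  rintro ⟨pp, sk⟩ ⟨hpp, hsk⟩
  rw [O.expect_forgeryValue A n hpp]
  exact Finset.sum_le_sum fun j _ => O.expect_targetProb_le A n j hpp hsk

/-- Correctness enters because the reduction's own signature of `1` must be accepted; of the two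
correctness statements only the one for `ver₁` is needed. -/
theorem oneTimeUnforgeable (hcorrect : O.Correct) (hsecure : O.Secure) :
    O.pairScheme.OneTimeUnforgeable := by
  intro A
  refine (AtMostNegligible.sum Finset.univ fun j : Bool =>
    (hsecure (O.breaker A j)).add (overwhelming_iff.mp hcorrect.2)).mono fun n => ?_
  refine (Mix.prob_le (O.coeff_forgeryGame_le A n)).trans ?_
  rw [Complex.re_sum]
  exact le_rfl

end TwoTierOSS

end RevSig

end

theorem mainTheorem2 (O : RevSig.TwoTierOSS) (hcorrect : O.Correct) (hsecure : O.Secure) :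
    ∃ D : RevSig.DSRKey, RevSig.IsPairConstruction O D ∧
      D.OneTimeCorrect ∧ D.OneTimeUnforgeable ∧
      D.OneTimeDeletionCorrect ∧ D.OneTimeDeletionSecure := by
  exact ⟨O.pairScheme, O.isPairConstruction, O.oneTimeCorrect hcorrect,
    O.oneTimeUnforgeable hcorrect hsecure, O.oneTimeDeletionCorrect hcorrect,
    O.oneTimeDeletionSecure hsecure⟩
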